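/- Let $\ell\ge 1$ and $m\ge 1$ be integers and put $n=(\ell+1)m+1$. Let $\mathbf D_{n/(\ell+1)}$ be the set of rational Dyck paths of slope $n/(\ell+1)$, that is, of sequences $x=(x_0,\dots,x_\ell)$ of nonnegative integers with $x_0+\cdots+x_\ell=n$ and $x_0+\cdots+x_i<\frac{n(i+1)}{\ell+1}$ for $0\le i\le \ell-1$. Put $$M=\sum_{i=0}^{\ell-1}\Big\lfloor \tfrac{n}{\ell+1}(i+1)\Big\rfloor,\qquad \mathrm{area}(x)=M-\sum_{k=0}^{\ell}(\ell-k)\,x_k .$$ For $1\le i\le j<\ell$ let $\beta_{ij}(x)=(x_i+\cdots+x_j)-\frac{n}{\ell+1}(j-i+1)$ (which is never $0$, as $\gcd(n,\ell+1)=1$), let $\gamma_{ij}(x)=\min(x_{i-1},\lfloor|\beta_{ij}(x)|\rfloor)$ if $\beta_{ij}(x)<0$ and $\gamma_{ij}(x)=\min(x_{i},\lfloor|\beta_{ij}(x)|\rfloor)$ if $\beta_{ij}(x)>0$, and put $$\mathrm{degr}(x)=\sum_{1\le i\le j<\ell}\gamma_{ij}(x).$$ Call $x$ maximal if $\min_{0\le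 i<\ell}\big(\frac{n}{\ell+1}(i+1)-(x_0+\cdots+x_i)\big)=\frac1{\ell+1}$. For an integer $d\ge0$ let $\mathbf D^d_{n/(\ell+1)}$ be the set of all paths $x\in\mathbf D_{n/(\ell+1)}$ with $\mathrm{degr}(x)=d$, let $\mathbf T^d_{n/(\ell+1)}$ be the set of the maximal ones among them, and let $$\mathcal C^d_{n/(\ell+1)}(q,t)=\sum_{x\in\mathbf D^d_{n/(\ell+1)}}q^{\mathrm{area}(x)}\,t^{\,M-d-\mathrm{area}(x)}$$ be the part of degree $M-d$ of the rational $q,t$-Catalan polynomial of slope $n/(\ell+1)$. For integers $a,b$ put $\mathrm{sym}(a,b)=\dfrac{q^{b+1}t^a-q^at^{b+1}}{q-t}$. Theorem. For every $0\le d\le 20$, in the field $\mathbb Q(q,t)$, $$\mathcal C^d_{n/(\ell+1)}(q,t)=\sum_{x\in\mathbf T^d_{n/(\ell+1)}}\mathrm{sym}\big(\mathrm{area}(x),\,M-d-\mathrm{area}(x)\big),$$ and consequently $\mathcal C^d_{n/(\ell+1)}(q,t)=\mathcal C^d_{n/(\ell+1)}(t,q)$. -/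

import Mathlib

namespace RationalCatalan

/-- The `k`-th step coordinate `x_k` of `x = (x_0, …, x_ℓ)`, with a natural-number index
(`0` for `k > ℓ`; such indices are never used below). -/
def coord {ℓ : ℕ} (x : Fin (ℓ + 1) → ℕ) (k : ℕ) : ℕ :=
  if h : k < ℓ + 1 then x ⟨k, h⟩ else 0

/-- The rational Dyck paths of slope `n / (ℓ + 1)`: sequences `x = (x_0, …, x_ℓ)` of nonnegative
integers with `x_0 + ⋯ + x_ℓ = n` and `x_0 + ⋯ + x_i < n (i + 1) / (ℓ + 1)` for `0 ≤ i ≤ ℓ - 1`.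
(`Finset.Nat.antidiagonalTuple (ℓ + 1) n` is the finite set of all `x` with total sum `n`.) -/
def paths (ℓ n : ℕ) : Finset (Fin (ℓ + 1) → ℕ) :=
  (Finset.Nat.antidiagonalTuple (ℓ + 1) n).filter fun x =>
    ∀ i ∈ Finset.range ℓ,
      (∑ k ∈ Finset.range (i + 1), (coord x k : ℚ)) < (n : ℚ) * ((i : ℚ) + 1) / ((ℓ : ℚ) + 1)

/-- `M = ∑_{i=0}^{ℓ-1} ⌊n (i + 1) / (ℓ + 1)⌋`. -/
def maxArea (ℓ n : ℕ) : ℤ :=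
  ∑ i ∈ Finset.range ℓ, ⌊(n : ℚ) / ((ℓ : ℚ) + 1) * ((i : ℚ) + 1)⌋

/-- `area x = M - (ℓ x_0 + (ℓ - 1) x_1 + ⋯ + 1 x_{ℓ-1} + 0 x_ℓ)`. -/
def area {ℓ : ℕ} (n : ℕ) (x : Fin (ℓ + 1) → ℕ) : ℤ :=
  maxArea ℓ n - ∑ k ∈ Finset.range (ℓ + 1), (coord x k : ℤ) * ((ℓ : ℤ) - (k : ℤ))

/-- `β_{ij}(x) = (x_i + ⋯ + x_j) - n (j - i + 1) / (ℓ + 1)`. -/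
def beta {ℓ : ℕ} (n : ℕ) (x : Fin (ℓ + 1) → ℕ) (i j : ℕ) : ℚ :=
  (∑ k ∈ Finset.Icc i j, (coord x k : ℚ)) - (n : ℚ) / ((ℓ : ℚ) + 1) * ((j : ℚ) - (i : ℚ) + 1)

/-- `γ_{ij}(x)`, for `1 ≤ i ≤ j < ℓ`. (For `n` coprime to `ℓ + 1` the case `β_{ij}(x) = 0` does
not occur for such `i, j`.) -/
def gamma {ℓ : ℕ} (n : ℕ) (x : Fin (ℓ + 1) → ℕ) (i j : ℕ) : ℤ :=
  if beta n x i j < 0 then min (coord x (i - 1) : ℤ) ⌊|beta n x i j|⌋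
  else if 0 < beta n x i j then min (coord x i : ℤ) ⌊|beta n x i j|⌋
  else 0

/-- `degr x = ∑_{1 ≤ i ≤ j < ℓ} γ_{ij}(x)`. -/
def degr {ℓ : ℕ} (n : ℕ) (x : Fin (ℓ + 1) → ℕ) : ℤ :=
  ∑ i ∈ Finset.Ico 1 ℓ, ∑ j ∈ Finset.Ico i ℓ, gamma n x i j

/-- `under x = min_{0 ≤ i < ℓ} (n (i + 1) / (ℓ + 1) - (x_0 + ⋯ + x_i))`; the minimum over the
empty index set (`ℓ = 0`) is `⊤`. -/
def under {ℓ : ℕ} (n : ℕ) (x : Fin (ℓ + 1) → ℕ) : WithTop ℚ :=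
  (Finset.range ℓ).inf fun i =>
    (((n : ℚ) / ((ℓ : ℚ) + 1) * ((i : ℚ) + 1)
      - ∑ k ∈ Finset.range (i + 1), (coord x k : ℚ) : ℚ) : WithTop ℚ)

/-- The maximal paths: those with `under x = 1 / (ℓ + 1)`. -/
def maximalPaths (ℓ n : ℕ) : Finset (Fin (ℓ + 1) → ℕ) :=
  (paths ℓ n).filter fun x => under n x = ((1 / ((ℓ : ℚ) + 1) : ℚ) : WithTop ℚ)

/-- The paths `x` with `degr x = d`. -/
def pathsOfDegr (ℓ n d : ℕ) : Finset (Fin (ℓ + 1) → ℕ) :=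
  (paths ℓ n).filter fun x => degr n x = (d : ℤ)

/-- The maximal paths `x` with `degr x = d`. -/
def maximalPathsOfDegr (ℓ n d : ℕ) : Finset (Fin (ℓ + 1) → ℕ) :=
  (maximalPaths ℓ n).filter fun x => degr n x = (d : ℤ)

/-- The part of degree `M - d` of the rational `q,t`-Catalan polynomial of slope `n / (ℓ + 1)`,
`∑ q ^ area x * t ^ (M - d - area x)` over the paths `x` with `degr x = d`. -/
def catalanPart {K : Type*} [Field K] (ℓ n d : ℕ) (q t : K) : K :=
  ∑ x ∈ pathsOfDegr ℓ n d, q ^ area n x * t ^ (maxArea ℓ n - (d : ℤ) - area n x)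

/-- `sym(a, b) = (q ^ (b + 1) * t ^ a - q ^ a * t ^ (b + 1)) / (q - t)`. -/
def sym {K : Type*} [Field K] (q t : K) (a b : ℤ) : K :=
  (q ^ (b + 1) * t ^ a - q ^ a * t ^ (b + 1)) / (q - t)

/-- The field `ℚ(q, t)` of rational functions in two variables, as the field of fractions of
`ℤ[q, t]`. -/
abbrev RatQT : Type := FractionRing (MvPolynomial (Fin 2) ℤ)

/-- The indeterminate `q`. -/
noncomputable def qVar : RatQT :=
  algebraMap (MvPolynomial (Fin 2) ℤ) RatQT (MvPolynomial.X 0)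

/-- The indeterminate `t`. -/
noncomputable def tVar : RatQT :=
  algebraMap (MvPolynomial (Fin 2) ℤ) RatQT (MvPolynomial.X 1)

end RationalCatalan

/-! Encode a path by its area sequence c, with c_0 = c_{ℓ+1} = 0 and x_k = m + c_k - c_{k+1} for k <
ℓ, and attach to it the rows [-c_k, m - c_{k+1}), 0 ≤ k ≤ ℓ. The numbers γ_{ij} count points of one
row that are missed by a later row, so M - area - degr is the statistic `rowStat` of the list of
rows (`IsAreaSeq.degr_add_rowStat`). A path is maximal exactly when c_1 = 0. Thus the coefficients
of C^d are the numbers A(i,j) of area sequences with sum i and statistic j, where i + j = M - d; the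
maximal paths give numbers T(i,j) in the same way.

Write A(q,t) and T(q,t) for the generating functions. The sum of the sym terms is (q T(t,q) - t
T(q,t)) / (q - t). If A is symmetric and A = T + q N with N symmetric, the numerator is (q - t) A,
which is the claim (`sum_symm_difference`). So everything rests on the symmetry of A and on the
existence of N (`pathCount_symm`, `exists_symm_difference`).

Both come from nonsymmetric Hall–Littlewood polynomials. The Demazure–Lusztig operators T_i and T̄_i
= q T_i^{-1}, applied to dominant monomials, give two families E and F (`nshl true`, `nshl false`).
The operators are self-adjoint for the functional `hlFun`, which multiplies by the product of (1 -
z_j/z_k)/(1 - q z_j/z_k) over j < k and adds up the coefficients of monomials without positive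
exponents. Exchange and rotation recurrences then show that pairing E_x with F_{-y} gives q^rowStat
of the rows [x_i, y_i), or 0 if a row is reversed (`rowPairing_eq`).

When x and y have equal sums this pairing is a Kronecker delta, so the families are biorthogonal.
Since the kernel of `kernel` reproduces monomials for the same pairing (`ct2_kernel`), a Cauchy
identity follows (`coeff_kernel`). Substituting y_i = 1/z_{i+1} in its terms and applying the
functional yields exactly the rows of area sequences (`hlFun_kernel`). Here t marks the area and q
the statistic. The specialised kernel times the density is a product of factors (1 - u)/((1 - qu)(1
- tu)), some multiplied by 1 - qtu, so it is symmetric in q and t (`swapQT_map_spec_kernel`), and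
hence A is symmetric.

Finally, multiplying the kernel by 1 - t x_p y_p, with p the last index, sets x_p = 0. This selects
the compositions with last part 0 (`coeff_one_sub_mul_kernel`), and those give the maximal paths
(`hlFun_one_sub_mul_kernel`). The term removed is t times a monomial times the kernel, so it is
symmetric up to the shift by t; this is N. -/

namespace RationalCatalan

open PowerSeries

/-! ### Braid words attached to integer lists -/

section WordBasis

variable {V : Type*} (τ : ℕ → V → V)

/-- The composite `τ_o ∘ τ_{o+1} ∘ ⋯ ∘ τ_{o+k-1}`. -/
def chain : ℕ → ℕ → V → V
  | _, 0, v => v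
  | o, k + 1, v => τ o (chain (o + 1) k v)

/-- The composite of generators that turns the weakly decreasing rearrangement of a list into
the list, acting at the positions from `o` on. -/
def word : ℕ → List ℤ → V → V
  | _, [], v => v
  | o, x :: r, v => word (o + 1) r (chain τ o (r.countP (x < ·)) v)

/-- The weakly decreasing rearrangement of a list. -/
def sortDesc (l : List ℤ) : List ℤ := l.insertionSort (· ≥ ·)

/-- Braid relations for a family of maps. -/
structure IsBraid : Prop where
  far : ∀ i j, i + 1 < j → ∀ v, τ i (τ j v) = τ j (τ i v)
  braid : ∀ i v, τ i (τ (i + 1) (τ i v)) = τ (i + 1) (τ i (τ (i + 1) v))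

variable {τ}

lemma chain_far (h : IsBraid τ) {j : ℕ} : ∀ {k o : ℕ}, (j + 1 < o ∨ o + k < j) → ∀ v,
    τ j (chain τ o k v) = chain τ o k (τ j v)
  | 0, _, _, _ => rfl
  | k + 1, o, hj, v => by
    simp only [chain]
    rw [← chain_far h (k := k) (o := o + 1) (by omega)]
    rcases hj with hj | hj
    · exact h.far _ _ hj _
    · exact (h.far _ _ (by omega) _).symm

lemma chain_succ_right : ∀ (k o : ℕ) (v : V),
    chain τ o (k + 1) v = chain τ o k (τ (o + k) v)
  | 0, _, _ => rfl
  | k + 1, o, v => by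
    rw [chain, chain_succ_right k (o + 1) v, chain]
    congr 3
    omega

lemma chain_shift (h : IsBraid τ) {j : ℕ} : ∀ {k o : ℕ}, o ≤ j → j + 1 < o + k → ∀ v,
    τ (j + 1) (chain τ o k v) = chain τ o k (τ j v)
  | 0, _, _, _, _ => by omega
  | k + 1, o, h1, h2, v => by
    rcases Nat.eq_or_lt_of_le h1 with rfl | h1
    · obtain ⟨k, rfl⟩ : ∃ k', k = k' + 1 := ⟨k - 1, by omega⟩
      simp only [chain]
      rw [← chain_far h (j := o) (o := o + 1 + 1) (Or.inl (by omega)), h.braid]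
    · simp only [chain]
      rw [← chain_shift h (k := k) (o := o + 1) h1 (by omega), h.far o (j + 1) (by omega)]

/-- Iterates `chain_shift`: a generator that passes through a long chain containing it has its index
lowered by one. -/
lemma chain_chain (h : IsBraid τ) {o n : ℕ} : ∀ {k a : ℕ}, o ≤ a → a + k < o + n → ∀ v,
    chain τ (a + 1) k (chain τ o n v) = chain τ o n (chain τ a k v)
  | 0, _, _, _, _ => rfl
  | k + 1, a, h1, h2, v => by
    simp only [chain]
    rw [chain_chain h (by omega) (by omega), chain_shift h h1 (by omega)]

lemma word_far (h : IsBraid τ) {j : ℕ} : ∀ {r : List ℤ} {o : ℕ}, j + 1 < o → ∀ v,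
    τ j (word τ o r v) = word τ o r (τ j v)
  | [], _, _, _ => rfl
  | x :: r, o, hj, v => by
    simp only [word]
    rw [word_far h (by omega), chain_far h (Or.inl hj)]

/-- Only the two heads matter. The new generator lengthens the chain of `y` by one at its front, and
`chain_chain` then interchanges this chain with the chain of `x`. An exchange of neighbours in
decreasing order thus costs exactly one generator. -/
lemma word_swap (h : IsBraid τ) {x y : ℤ} (hxy : y < x) (r : List ℤ) :
    ∀ (l : List ℤ) (o : ℕ) (v : V),
      τ (o + l.length) (word τ o (l ++ x :: y :: r) v) = word τ o (l ++ y :: x :: r) v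
  | [], o, v => by
    have hle : r.countP (x < ·) ≤ r.countP (y < ·) :=
      List.countP_mono_left fun z _ hz => by simp at hz ⊢; omega
    simp only [List.nil_append, word, List.length_nil, Nat.add_zero]
    rw [word_far h (by omega), List.countP_cons_of_neg (by simpa using hxy.le),
      List.countP_cons_of_pos (by simpa using hxy),
      chain_chain h (k := r.countP (x < ·)) (n := r.countP (y < ·) + 1) le_rfl (by omega)]
    rfl
  | c :: l, o, v => by
    have hc : (l ++ x :: y :: r).countP (c < ·) = (l ++ y :: x :: r).countP (c < ·) :=
      (List.Perm.append_left l (List.Perm.swap y x r)).countP_eq _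
    simp only [List.cons_append, word, List.length_cons]
    rw [← word_swap h hxy r l (o + 1), hc]
    congr 1
    omega

lemma sortDesc_perm (l : List ℤ) : (sortDesc l).Perm l := List.perm_insertionSort _ l

lemma sortDesc_pairwise (l : List ℤ) : (sortDesc l).Pairwise (· ≥ ·) :=
  List.pairwise_insertionSort _ l

lemma eq_of_perm_of_pairwise_ge {l l' : List ℤ} (h : l.Perm l') (h1 : l.Pairwise (· ≥ ·))
    (h2 : l'.Pairwise (· ≥ ·)) : l = l' :=
  h.eq_of_pairwise (fun _ _ _ _ a b => le_antisymm b a) h1 h2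

lemma sortDesc_eq_of_perm {l l' : List ℤ} (h : l.Perm l') : sortDesc l = sortDesc l' :=
  eq_of_perm_of_pairwise_ge ((sortDesc_perm l).trans (h.trans (sortDesc_perm l').symm))
    (sortDesc_pairwise l) (sortDesc_pairwise l')

lemma sortDesc_of_pairwise {l : List ℤ} (h : l.Pairwise (· ≥ ·)) : sortDesc l = l :=
  eq_of_perm_of_pairwise_ge (sortDesc_perm l) (sortDesc_pairwise l) h

lemma exists_split_pairwise_ge (a : ℤ) : ∀ l : List ℤ, l.Pairwise (· ≥ ·) →
    ∃ p s, l = p ++ s ∧ (∀ z ∈ p, a < z) ∧ (∀ z ∈ s, z ≤ a)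
  | [], _ => ⟨[], [], by simp⟩
  | c :: l, h => by
    rw [List.pairwise_cons] at h
    rcases le_or_gt c a with hc | hc
    · exact ⟨[], c :: l, by simp, by simp, by
        simp only [List.mem_cons]
        rintro z (rfl | hz)
        · exact hc
        · exact (h.1 z hz).trans hc⟩
    · obtain ⟨p, s, rfl, hp, hs⟩ := exists_split_pairwise_ge a l h.2
      exact ⟨c :: p, s, by simp, by
        simp only [List.mem_cons]
        rintro z (rfl | hz)
        · exact hc
        · exact hp z hz, hs⟩

/-- The split is at the place where `a` is inserted. The length of `p` is the length of the chain
used for `a` in `word`, which ties chain lengths to positions in the sorted list. -/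
lemma exists_split_sortDesc_cons (a : ℤ) (ρ : List ℤ) :
    ∃ p s, sortDesc ρ = p ++ s ∧ sortDesc (a :: ρ) = p ++ a :: s ∧ (∀ z ∈ p, a < z) ∧
      (∀ z ∈ s, z ≤ a) ∧ p.length = ρ.countP (a < ·) := by
  obtain ⟨p, s, h, hp, hs⟩ := exists_split_pairwise_ge a _ (sortDesc_pairwise ρ)
  refine ⟨p, s, h, ?_, hp, hs, ?_⟩
  · refine eq_of_perm_of_pairwise_ge ?_ (sortDesc_pairwise _) ?_
    · refine (sortDesc_perm _).trans ?_
      refine ((sortDesc_perm ρ).symm.cons a).trans ?_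
      rw [h]
      exact List.perm_middle.symm
    · have := sortDesc_pairwise ρ
      rw [h, List.pairwise_append] at this
      rw [List.pairwise_append, List.pairwise_cons]
      refine ⟨this.1, ⟨hs, this.2.1⟩, ?_⟩
      intro z hz w hw
      rcases List.mem_cons.1 hw with rfl | hw
      · exact (hp z hz).le
      · exact this.2.2 z hz w hw
  · rw [← (sortDesc_perm ρ).countP_eq, h, List.countP_append, List.countP_eq_length.2 (by
      simpa using hp), List.countP_eq_zero.2 (by simpa using hs)]
    rfl

/-- `τ` acts on `v` by `c` at every position at which the list repeats an entry. -/
def FixesRepeats (τ : ℕ → V → V) (c : V → V) (o : ℕ) (l : List ℤ) (v : V) : Prop :=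
  ∀ p x s, l = p ++ x :: x :: s → τ (o + p.length) v = c v

lemma chain_const {c : V → V} (hc : ∀ i v, τ i (c v) = c (τ i v)) : ∀ (k o : ℕ) (v : V),
    chain τ o k (c v) = c (chain τ o k v)
  | 0, _, _ => rfl
  | k + 1, o, v => by simp only [chain]; rw [chain_const hc k, hc]

lemma word_const {c : V → V} (hc : ∀ i v, τ i (c v) = c (τ i v)) : ∀ (l : List ℤ) (o : ℕ) (v : V),
    word τ o l (c v) = c (word τ o l v)
  | [], _, _ => rfl
  | x :: l, o, v => by simp only [word]; rw [chain_const hc, word_const hc l]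

/-- Taking `a` to the front moves the entries of `p` one place to the right and leaves those of `s`
where they are; `chain_shift` and `chain_far` do the same to the generators. A repeat cannot
straddle `p` and `s`, because the entries of `p` exceed `a` and those of `s` do not. -/
lemma FixesRepeats.chain (h : IsBraid τ) {c : V → V} (hc : ∀ i v, τ i (c v) = c (τ i v))
    {a : ℤ} {ρ : List ℤ} {o : ℕ} {v : V} (hv : FixesRepeats τ c o (sortDesc (a :: ρ)) v) :
    FixesRepeats τ c (o + 1) (sortDesc ρ) (chain τ o (ρ.countP (a < ·)) v) := by
  obtain ⟨p, s, h1, h2, hp, hs, hl⟩ := exists_split_sortDesc_cons a ρ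
  intro l x r hlr
  rw [← hl]
  rw [h1] at hlr
  rw [h2] at hv
  rcases List.append_eq_append_iff.1 hlr with ⟨s', rfl, h4⟩ | ⟨p', rfl, h4⟩
  · have := hv (p ++ a :: s') x r (by rw [h4]; simp)
    rw [chain_far h (Or.inr (by simp; omega))]
    rw [show o + 1 + (p ++ s').length = o + (p ++ a :: s').length by simp; omega, this,
      chain_const hc]
  · rcases p' with _ | ⟨x', p'⟩
    · have := hv (l ++ [a]) x r (by simp at h4 ⊢; exact h4.symm)
      rw [chain_far h (Or.inr (by simp))]
      rw [show o + 1 + l.length = o + (l ++ [a]).length by simp; omega, this, chain_const hc]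
    · rcases p' with _ | ⟨x'', p'⟩
      · simp only [List.cons_append, List.nil_append, List.cons.injEq] at h4
        have h5 := hs x (by rw [← h4.2]; simp)
        have h6 := hp x' (by simp)
        omega
      · simp only [List.cons_append, List.cons.injEq] at h4
        obtain ⟨rfl, rfl, rfl⟩ := h4
        have := hv l x (p' ++ a :: s) (by simp)
        rw [show o + 1 + l.length = o + l.length + 1 by omega,
          chain_shift h (by omega) (by simp; omega), this, chain_const hc]

lemma word_repeat (h : IsBraid τ) {c : V → V} (hc : ∀ i v, τ i (c v) = c (τ i v)) :
    ∀ (α : List ℤ) (o : ℕ) (v : V), FixesRepeats τ c o (sortDesc α) v →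
      FixesRepeats τ c o α (word τ o α v)
  | [], _, _, _ => fun p x s hp => by simp at hp
  | a :: ρ, o, v, hv => by
    intro l x r hl
    rcases l with _ | ⟨a', l⟩
    · simp only [List.nil_append, List.cons.injEq] at hl
      obtain ⟨rfl, rfl⟩ := hl
      obtain ⟨p, s, h1, h2, hp, hs, hpl⟩ := exists_split_sortDesc_cons a (a :: r)
      obtain ⟨p', s', h1', h2', hp', hs', hpl'⟩ := exists_split_sortDesc_cons a r
      have hk : (a :: r).countP (a < ·) = r.countP (a < ·) := by
        simp
      have hpp : p ++ a :: s = p' ++ a :: a :: s' := by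
        have : p ++ s = p' ++ a :: s' := h1.symm.trans h2'
        have hlen : p.length = p'.length := by rw [hpl, hpl', hk]
        obtain ⟨rfl, rfl⟩ := List.append_inj this hlen
        rfl
      have := hv p' a s' (h2.trans hpp)
      simp only [word, List.length_nil, Nat.add_zero]
      rw [word_far h (by omega), hk]
      set k := r.countP (a < ·)
      have e1 : τ o (RationalCatalan.chain τ (o + 1) k (RationalCatalan.chain τ o k v)) =
          RationalCatalan.chain τ o (k + 1) (RationalCatalan.chain τ o k v) := rfl
      -- Interchanging the chains brings the generator to index `o + k`, the place of this repeat in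
      -- the sorted list.
      rw [e1, ← chain_chain h le_rfl (by omega), chain_succ_right, ← hpl', this,
        chain_const hc, chain_const hc, word_const hc]
    · simp only [List.cons_append, List.cons.injEq] at hl
      obtain ⟨rfl, hl⟩ := hl
      have := word_repeat h hc ρ (o + 1) _ (hv.chain h hc) l x r hl
      simp only [word, List.length_cons]
      rw [← this]
      congr 1
      omega

/-- A property of lists that holds for weakly decreasing lists and is inherited when two adjacent
entries in decreasing order are exchanged holds for all lists. -/
lemma list_swap_induction {Q : List ℤ → Prop} (hs : ∀ l : List ℤ, l.Pairwise (· ≥ ·) → Q l)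
    (hQ : ∀ l x y r, y < x → Q (l ++ x :: y :: r) → Q (l ++ y :: x :: r)) (l : List ℤ) : Q l := by
  -- Bubbles `a` leftwards through larger entries, one use of `hQ` per step.
  have hmove : ∀ (a : ℤ) (s p l : List ℤ), (∀ z ∈ p, a < z) → Q (l ++ p ++ a :: s) →
      Q (l ++ a :: (p ++ s)) := by
    intro a s p
    induction p using List.reverseRecOn generalizing s with
    | nil => intro l _ h; simpa using h
    | append_singleton p z ih =>
      intro l hp h
      have := hQ (l ++ p) z a s (hp z (by simp)) (by simpa using h)
      have := ih (z :: s) l (fun w hw => hp w (by simp [hw])) (by simpa using this)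
      simpa using this
  have key : ∀ r l : List ℤ, Q (l ++ sortDesc r) → Q (l ++ r) := by
    intro r
    induction r with
    | nil => intro l h; simpa [sortDesc] using h
    | cons a r ih =>
      intro l h
      obtain ⟨p, s, h1, h2, hp, hs', hl⟩ := exists_split_sortDesc_cons a r
      have := hmove a s p l hp (by rw [h2] at h; simpa using h)
      rw [← h1] at this
      have := ih (l ++ [a]) (by simpa using this)
      simpa using this
  exact key l [] (hs _ (by simpa using sortDesc_pairwise l))

end WordBasis

/-! ### Power series in q over Laurent polynomials, and exchanges of variables -/

/-- Laurent polynomials in the variables `z_0, z_1, …`. -/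
abbrev Lau : Type := AddMonoidAlgebra ℤ (ℕ → ℤ)

/-- Formal power series in `q` over the Laurent polynomials. -/
abbrev Ser : Type := PowerSeries Lau

/-- The monomial `z^ν`. -/
noncomputable def mono (ν : ℕ → ℤ) : Ser := C (AddMonoidAlgebra.single ν 1)

/-- The variable `z_i`. -/
noncomputable def zi (i : ℕ) : Ser := mono (Pi.single i 1)

lemma mono_add (ν μ : ℕ → ℤ) : mono (ν + μ) = mono ν * mono μ := by
  rw [mono, mono, mono, ← map_mul, AddMonoidAlgebra.single_mul_single, one_mul]

lemma mono_zero : mono 0 = 1 := by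
  rw [mono, ← AddMonoidAlgebra.one_def, map_one]

/-- The additive map on Laurent polynomials with prescribed values on monomials. -/
noncomputable def lin {A : Type*} [AddCommGroup A] (φ : (ℕ → ℤ) → A) : Lau →+ A :=
  (Finsupp.liftAddHom fun ν => (smulAddHom ℤ A).flip (φ ν)).comp
    (AddMonoidAlgebra.coeffAddEquiv (R := ℤ) (M := ℕ → ℤ)).toAddMonoidHom

lemma lin_single {A : Type*} [AddCommGroup A] (φ : (ℕ → ℤ) → A) (ν : ℕ → ℤ) (c : ℤ) :
    lin φ (AddMonoidAlgebra.single ν c) = c • φ ν := by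
  simp only [lin, AddMonoidHom.comp_apply]
  erw [Finsupp.liftAddHom_apply_single]
  simp

lemma lau_hom_ext {A : Type*} [AddCommGroup A] {φ ψ : Lau →+ A}
    (h : ∀ ν, φ (AddMonoidAlgebra.single ν 1) = ψ (AddMonoidAlgebra.single ν 1)) : φ = ψ := by
  refine AddMonoidAlgebra.addMonoidHom_ext fun ν c => ?_
  have : (AddMonoidAlgebra.single ν c : Lau) = c • AddMonoidAlgebra.single ν 1 := by
    rw [AddMonoidAlgebra.smul_single]; simp
  rw [this, map_zsmul, map_zsmul, h]

/-- Apply an additive map to every coefficient of a power series in `q`. -/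
noncomputable def coeffwise {A B : Type*} [CommRing A] [CommRing B] (φ : A →+ B) :
    PowerSeries A →+ PowerSeries B where
  toFun f := PowerSeries.mk fun n => φ (coeff n f)
  map_zero' := by ext n; simp
  map_add' f g := by ext n; simp

@[simp] lemma coeff_coeffwise {A B : Type*} [CommRing A] [CommRing B] (φ : A →+ B) (n : ℕ)
    (f : PowerSeries A) : coeff n (coeffwise φ f) = φ (coeff n f) := by
  simp [coeffwise]

/-- The substitution of monomials for the variables given by a map on exponents. -/
noncomputable def reindex (φ : (ℕ → ℤ) →+ (ℕ → ℤ)) : Ser →+* Ser :=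
  PowerSeries.map (AddMonoidAlgebra.mapDomainRingHom ℤ φ)

lemma reindex_mono (φ : (ℕ → ℤ) →+ (ℕ → ℤ)) (ν : ℕ → ℤ) :
    reindex φ (mono ν) = mono (φ ν) := by
  simp [reindex, mono]

lemma reindex_X (φ : (ℕ → ℤ) →+ (ℕ → ℤ)) : reindex φ X = X := by
  simp [reindex]

lemma reindex_comp (φ ψ : (ℕ → ℤ) →+ (ℕ → ℤ)) (f : Ser) :
    reindex φ (reindex ψ f) = reindex (φ.comp ψ) f := by
  ext n : 1
  simp only [reindex, coeff_map]
  have : ((AddMonoidAlgebra.mapDomainRingHom ℤ φ : Lau →+* Lau) : Lau →+ Lau).comp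
      (AddMonoidAlgebra.mapDomainRingHom ℤ ψ : Lau →+* Lau) =
      (AddMonoidAlgebra.mapDomainRingHom ℤ (φ.comp ψ) : Lau →+* Lau) :=
    lau_hom_ext fun ν => by simp
  exact DFunLike.congr_fun this _

lemma reindex_id (f : Ser) : reindex (AddMonoidHom.id _) f = f := by
  ext n : 1
  simp only [reindex, coeff_map]
  have : ((AddMonoidAlgebra.mapDomainRingHom ℤ (AddMonoidHom.id (ℕ → ℤ)) : Lau →+* Lau) :
      Lau →+ Lau) = AddMonoidHom.id _ :=
    lau_hom_ext fun ν => by simp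
  exact DFunLike.congr_fun this _

/-- Precomposition of an exponent with a permutation of the indices. -/
def permExpo (e : Equiv.Perm ℕ) : (ℕ → ℤ) →+ (ℕ → ℤ) where
  toFun ν k := ν (e k)
  map_zero' := rfl
  map_add' _ _ := rfl

@[simp] lemma permExpo_apply (e : Equiv.Perm ℕ) (ν : ℕ → ℤ) (k : ℕ) :
    permExpo e ν k = ν (e k) := rfl

/-- The exchange of the variables `z_i` and `z_{i+1}`. -/
noncomputable def swapVar (i : ℕ) : Ser →+* Ser := reindex (permExpo (Equiv.swap i (i + 1)))

lemma swapVar_mono (i : ℕ) (ν : ℕ → ℤ) :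
    swapVar i (mono ν) = mono fun k => ν (Equiv.swap i (i + 1) k) := reindex_mono _ _

lemma swapVar_X (i : ℕ) : swapVar i X = X := reindex_X _

lemma permExpo_single (e : Equiv.Perm ℕ) (j : ℕ) (c : ℤ) :
    permExpo e (Pi.single j c) = Pi.single (e.symm j) c := by
  ext k
  simp only [permExpo_apply, Pi.single_apply, Equiv.eq_symm_apply]

lemma swapVar_zi (i j : ℕ) : swapVar i (zi j) = zi (Equiv.swap i (i + 1) j) := by
  rw [zi, swapVar, reindex_mono, permExpo_single, Equiv.symm_swap, zi]

lemma swapVar_zi_left (i : ℕ) : swapVar i (zi i) = zi (i + 1) := by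
  rw [swapVar_zi, Equiv.swap_apply_left]

lemma swapVar_zi_right (i : ℕ) : swapVar i (zi (i + 1)) = zi i := by
  rw [swapVar_zi, Equiv.swap_apply_right]

lemma swapVar_zi_of_ne {i j : ℕ} (h1 : j ≠ i) (h2 : j ≠ i + 1) : swapVar i (zi j) = zi j := by
  rw [swapVar_zi, Equiv.swap_apply_of_ne_of_ne h1 h2]

lemma swapVar_swapVar (i : ℕ) (f : Ser) : swapVar i (swapVar i f) = f := by
  rw [swapVar, reindex_comp]
  convert reindex_id f
  ext ν k
  simp

lemma swapVar_far {i j : ℕ} (h : i + 1 < j) (f : Ser) :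
    swapVar i (swapVar j f) = swapVar j (swapVar i f) := by
  rw [swapVar, swapVar, reindex_comp, reindex_comp]
  congr 2
  ext ν k
  simp only [AddMonoidHom.comp_apply, permExpo_apply]
  congr 1
  simp only [Equiv.swap_apply_def]
  split_ifs <;> omega

lemma swapVar_braid (i : ℕ) (f : Ser) :
    swapVar i (swapVar (i + 1) (swapVar i f)) =
      swapVar (i + 1) (swapVar i (swapVar (i + 1) f)) := by
  simp only [swapVar, reindex_comp]
  congr 2
  ext ν k
  simp only [AddMonoidHom.comp_apply, permExpo_apply]
  congr 1
  simp only [Equiv.swap_apply_def]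
  split_ifs <;> omega

lemma zi_injective {i j : ℕ} (h : zi i = zi j) : i = j := by
  have h1 := AddMonoidAlgebra.single_left_injective (R := ℤ) one_ne_zero
    (PowerSeries.C_injective h)
  by_contra hij
  have := congrFun h1 i
  simp [hij] at this

lemma zi_sub_ne_zero {i j : ℕ} (h : i ≠ j) : zi i - zi j ≠ 0 :=
  fun h0 => h (zi_injective (sub_eq_zero.1 h0))

/-! ### Divided differences and Demazure–Lusztig operators -/

/-- The divided difference of the monomial `z^ν` in the variables `z_i, z_{i+1}`. -/
noncomputable def divDiffMono (i : ℕ) (ν : ℕ → ℤ) : Lau :=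
  ∑ k ∈ Finset.range (ν i - ν (i + 1)).toNat,
      AddMonoidAlgebra.single (ν + Pi.single i (-(k : ℤ) - 1) + Pi.single (i + 1) (k : ℤ)) 1 -
    ∑ k ∈ Finset.range (ν (i + 1) - ν i).toNat,
      AddMonoidAlgebra.single (ν + Pi.single i (k : ℤ) + Pi.single (i + 1) (-(k : ℤ) - 1)) 1

/-- The divided difference `(f - s_i f) / (z_i - z_{i+1})`. -/
noncomputable def divDiff (i : ℕ) : Ser →+ Ser := coeffwise (lin (divDiffMono i))

lemma single_mul_sum_sub {a b : ℕ → ℤ} (F : ℕ → ℕ → ℤ) (n : ℕ)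
    (hF : ∀ k, F (k + 1) = F k - a + b) :
    (AddMonoidAlgebra.single a 1 - AddMonoidAlgebra.single b 1 : Lau) *
      ∑ k ∈ Finset.range n, AddMonoidAlgebra.single (F k - a) 1 =
      AddMonoidAlgebra.single (F 0) 1 - AddMonoidAlgebra.single (F n) 1 := by
  rw [Finset.mul_sum, ← Finset.sum_range_sub' (fun k => (AddMonoidAlgebra.single (F k) 1 : Lau))]
  refine Finset.sum_congr rfl fun k _ => ?_
  rw [sub_mul, AddMonoidAlgebra.single_mul_single, AddMonoidAlgebra.single_mul_single, hF,
    add_sub_cancel, add_comm b, one_mul]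

lemma lau_divDiffMono (i : ℕ) (ν : ℕ → ℤ) :
    (AddMonoidAlgebra.single (Pi.single i 1) 1 - AddMonoidAlgebra.single (Pi.single (i + 1) 1) 1 :
      Lau) * divDiffMono i ν =
    AddMonoidAlgebra.single ν 1 -
      AddMonoidAlgebra.single (permExpo (Equiv.swap i (i + 1)) ν) 1 := by
  rw [divDiffMono, mul_sub]
  have h1 := single_mul_sum_sub (a := Pi.single i 1) (b := Pi.single (i + 1) 1)
    (fun k => ν + Pi.single i (-(k : ℤ)) + Pi.single (i + 1) (k : ℤ)) (ν i - ν (i + 1)).toNat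
    (fun k => by
      ext j
      simp only [Pi.add_apply, Pi.sub_apply, Pi.single_apply]
      split_ifs <;> push_cast <;> omega)
  have h2 := single_mul_sum_sub (a := Pi.single (i + 1) 1) (b := Pi.single i 1)
    (fun k => ν + Pi.single i (k : ℤ) + Pi.single (i + 1) (-(k : ℤ))) (ν (i + 1) - ν i).toNat
    (fun k => by
      ext j
      simp only [Pi.add_apply, Pi.sub_apply, Pi.single_apply]
      split_ifs <;> push_cast <;> omega)
  have e1 : ∀ k : ℕ, ν + Pi.single i (-(k : ℤ)) + Pi.single (i + 1) (k : ℤ) - Pi.single i 1 =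
      ν + Pi.single i (-(k : ℤ) - 1) + Pi.single (i + 1) (k : ℤ) := fun k => by
    ext j
    simp only [Pi.add_apply, Pi.sub_apply, Pi.single_apply]
    split_ifs <;> omega
  have e2 : ∀ k : ℕ, ν + Pi.single i (k : ℤ) + Pi.single (i + 1) (-(k : ℤ)) -
      Pi.single (i + 1) 1 =
      ν + Pi.single i (k : ℤ) + Pi.single (i + 1) (-(k : ℤ) - 1) := fun k => by
    ext j
    simp only [Pi.add_apply, Pi.sub_apply, Pi.single_apply]
    split_ifs <;> omega
  simp only [e1] at h1
  simp only [e2] at h2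
  rw [h1]
  rw [← neg_sub (AddMonoidAlgebra.single (Pi.single (i + 1) 1) 1 : Lau), neg_mul, h2]
  rcases le_total (ν i) (ν (i + 1)) with h | h
  · rw [show (ν i - ν (i + 1)).toNat = 0 by omega]
    rw [sub_self, zero_sub, neg_neg]
    congr 2
    · ext j; simp
    · ext j
      simp only [Pi.add_apply, Pi.single_apply, permExpo_apply, Equiv.swap_apply_def]
      split_ifs <;> subst_vars <;> omega
  · rw [show (ν (i + 1) - ν i).toNat = 0 by omega]
    rw [sub_self, neg_zero, sub_zero]
    congr 2
    · ext j; simp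
    · ext j
      simp only [Pi.add_apply, Pi.single_apply, permExpo_apply, Equiv.swap_apply_def]
      split_ifs <;> subst_vars <;> omega

lemma zi_sub_mul_divDiff (i : ℕ) (f : Ser) :
    (zi i - zi (i + 1)) * divDiff i f = f - swapVar i f := by
  ext n : 1
  rw [zi, zi, mono, mono, ← map_sub, coeff_C_mul, divDiff, coeff_coeffwise, map_sub, swapVar,
    reindex, coeff_map]
  have : (AddMonoidHom.mulLeft (AddMonoidAlgebra.single (Pi.single i 1) 1 -
      AddMonoidAlgebra.single (Pi.single (i + 1) 1) 1 : Lau)).comp (lin (divDiffMono i)) =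
      AddMonoidHom.id Lau - (AddMonoidAlgebra.mapDomainRingHom ℤ
        (permExpo (Equiv.swap i (i + 1))) : Lau →+* Lau) :=
    lau_hom_ext fun ν => by
      simpa [lin_single] using lau_divDiffMono i ν
  exact DFunLike.congr_fun this (coeff n f)

/-- The Demazure–Lusztig operators: `hecke true i` is
`f ↦ q s_i f - (q - 1) z_{i+1} (f - s_i f) / (z_i - z_{i+1})`, with eigenvalues `q` and `-1`, and
`hecke false i` is `q` times its inverse. -/
noncomputable def hecke (b : Bool) (i : ℕ) : Ser →+ Ser :=
  (AddMonoidHom.mulLeft X).comp (swapVar i : Ser →+ Ser) -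
    (AddMonoidHom.mulLeft (X - 1)).comp
      ((AddMonoidHom.mulLeft (zi (i + 1))).comp (divDiff i) + bif b then 0 else AddMonoidHom.id _)

/-- The variable that occurs in the defining relation of `hecke b i`. -/
noncomputable def pivot (b : Bool) (i : ℕ) : Ser := bif b then zi (i + 1) else zi i

/-- Clears the denominator of the operator. As the ring is a domain, the relation determines the
image (`hecke_unique`), so every operator identity below reduces to a polynomial identity in z_i and
z_{i+1}. -/
lemma hecke_spec (b : Bool) (i : ℕ) (f : Ser) :
    (zi i - zi (i + 1)) * hecke b i f =
      (X * zi i - zi (i + 1)) * swapVar i f + (1 - X) * (pivot b i * f) := by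
  have h := zi_sub_mul_divDiff i f
  cases b <;> simp [hecke, pivot] <;> linear_combination (-(X - 1) * zi (i + 1)) * h

lemma hecke_unique {b : Bool} {i : ℕ} {f g : Ser}
    (h : (zi i - zi (i + 1)) * g =
      (X * zi i - zi (i + 1)) * swapVar i f + (1 - X) * (pivot b i * f)) :
    hecke b i f = g :=
  mul_left_cancel₀ (zi_sub_ne_zero (Nat.succ_ne_self i).symm) ((hecke_spec b i f).trans h.symm)

lemma hecke_of_swapVar_eq {b : Bool} {i : ℕ} {f : Ser} (h : swapVar i f = f) :
    hecke b i f = (bif b then X else 1) * f := by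
  apply hecke_unique
  rw [h]
  cases b <;> simp [pivot] <;> ring

lemma hecke_mul_left {b : Bool} {i : ℕ} {g : Ser} (h : swapVar i g = g) (f : Ser) :
    hecke b i (g * f) = g * hecke b i f := by
  apply hecke_unique
  rw [map_mul, h]
  linear_combination g * hecke_spec b i f

/-- The quadratic relation of the Hecke algebra: T_i - q T_i^{-1} = q - 1. -/
lemma hecke_true (i : ℕ) (f : Ser) : hecke true i f = hecke false i f + (X - 1) * f := by
  apply hecke_unique
  have := hecke_spec false i f
  simp only [pivot, cond_true, cond_false] at this ⊢
  linear_combination this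

lemma hecke_true_false (i : ℕ) (f : Ser) : hecke true i (hecke false i f) = X * f := by
  apply hecke_unique
  have h := hecke_spec false i f
  have hs := congrArg (swapVar i) h
  simp only [map_mul, map_add, map_sub, swapVar_X, swapVar_zi_left, swapVar_zi_right, pivot,
    cond_false, swapVar_swapVar, map_one, cond_true] at hs h ⊢
  apply mul_left_cancel₀ (zi_sub_ne_zero (Nat.succ_ne_self i).symm)
  linear_combination (X * zi i - zi (i + 1)) * hs - (1 - X) * zi (i + 1) * h

lemma hecke_false_true (i : ℕ) (f : Ser) : hecke false i (hecke true i f) = X * f := by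
  rw [hecke_true, map_add, ← hecke_true_false i f, hecke_true i (hecke false i f),
    hecke_mul_left (by simp [swapVar_X])]

/-- `T_i z_i = z_{i+1} T̄_i`. -/
lemma hecke_true_zi_mul (i : ℕ) (f : Ser) :
    hecke true i (zi i * f) = zi (i + 1) * hecke false i f := by
  apply hecke_unique
  have h := hecke_spec false i f
  simp only [map_mul, swapVar_zi_left, pivot, cond_false, cond_true] at h ⊢
  linear_combination zi (i + 1) * h

/-- `z_i T_i = T̄_i z_{i+1}`. -/
lemma zi_mul_hecke_true (i : ℕ) (f : Ser) :
    zi i * hecke true i f = hecke false i (zi (i + 1) * f) := by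
  symm
  apply hecke_unique
  have h := hecke_spec true i f
  simp only [map_mul, swapVar_zi_right, pivot, cond_false, cond_true] at h ⊢
  linear_combination zi i * h

lemma swapVar_hecke_far {b : Bool} {i j : ℕ} (h : i + 1 < j ∨ j + 1 < i) (f : Ser) :
    swapVar i (hecke b j f) = hecke b j (swapVar i f) := by
  symm
  apply hecke_unique
  have h1 := congrArg (swapVar i) (hecke_spec b j f)
  have hs : swapVar i (swapVar j f) = swapVar j (swapVar i f) := by
    rcases h with h | h
    · exact swapVar_far h f
    · exact (swapVar_far h f).symm
  have hz : swapVar i (zi j) = zi j := swapVar_zi_of_ne (by omega) (by omega)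
  have hz' : swapVar i (zi (j + 1)) = zi (j + 1) := swapVar_zi_of_ne (by omega) (by omega)
  have hp : swapVar i (pivot b j) = pivot b j := by cases b <;> simp [pivot, hz, hz']
  simp only [map_mul, map_add, map_sub, swapVar_X, hz, hz', hp, hs, map_one] at h1
  exact h1

lemma hecke_far {b b' : Bool} {i j : ℕ} (h : i + 1 < j) (f : Ser) :
    hecke b i (hecke b' j f) = hecke b' j (hecke b i f) := by
  apply hecke_unique
  rw [swapVar_hecke_far (Or.inl h)]
  have hz : swapVar j (zi i) = zi i := swapVar_zi_of_ne (by omega) (by omega)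
  have hz' : swapVar j (zi (i + 1)) = zi (i + 1) := swapVar_zi_of_ne (by omega) (by omega)
  have hp : swapVar j (pivot b i) = pivot b i := by cases b <;> simp [pivot, hz, hz']
  rw [← hecke_mul_left (by simp [hz, hz']), hecke_spec, map_add,
    hecke_mul_left (by simp [hz, hz', swapVar_X]), hecke_mul_left (by simp [swapVar_X]),
    hecke_mul_left hp]

/-- The braid relation as an identity of rational functions. The letters u, v, w are the successive
results on one side and u', v', w' those on the other; the prefixes denote images under the two
exchanges of variables. Once the linear equations are solved for w and w', the six permuted copies
of f are free variables. -/
lemma braid_aux {K : Type*} [Field K] (b : Bool) {x y z q f f1 f2 f12 f21 f121 : K}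
    {u su tu v sv w u' su' tu' v' sv' w' stu stu' : K}
    (hxy : x - y ≠ 0) (hyz : y - z ≠ 0) (hxz : x - z ≠ 0)
    (hu : (x - y) * u = (q * x - y) * f1 + (1 - q) * ((bif b then y else x) * f))
    (hsu : (x - z) * su = (q * x - z) * f21 + (1 - q) * ((bif b then z else x) * f2))
    (htu : (y - x) * tu = (q * y - x) * f + (1 - q) * ((bif b then x else y) * f1))
    (hstu : (y - z) * stu = (q * y - z) * f121 + (1 - q) * ((bif b then z else y) * f12))
    (hv : (y - z) * v = (q * y - z) * su + (1 - q) * ((bif b then z else y) * u))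
    (hsv : (x - z) * sv = (q * x - z) * stu + (1 - q) * ((bif b then z else x) * tu))
    (hw : (x - y) * w = (q * x - y) * sv + (1 - q) * ((bif b then y else x) * v))
    (hu' : (y - z) * u' = (q * y - z) * f2 + (1 - q) * ((bif b then z else y) * f))
    (hsu' : (x - z) * su' = (q * x - z) * f12 + (1 - q) * ((bif b then z else x) * f1))
    (htu' : (z - y) * tu' = (q * z - y) * f + (1 - q) * ((bif b then y else z) * f2))
    (hstu' : (x - y) * stu' = (q * x - y) * f121 + (1 - q) * ((bif b then y else x) * f21))
    (hv' : (x - y) * v' = (q * x - y) * su' + (1 - q) * ((bif b then y else x) * u'))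
    (hsv' : (x - z) * sv' = (q * x - z) * stu' + (1 - q) * ((bif b then z else x) * tu'))
    (hw' : (y - z) * w' = (q * y - z) * sv' + (1 - q) * ((bif b then z else y) * v')) :
    w = w' := by
  have hyx : y - x ≠ 0 := fun h => hxy (by linear_combination -h)
  have hzy : z - y ≠ 0 := fun h => hyz (by linear_combination -h)
  have solve : ∀ {a c d : K}, a ≠ 0 → a * c = d → c = d / a := fun ha h => by
    rw [eq_div_iff ha, mul_comm]; exact h
  rw [solve hxy hw, solve hyz hw', solve hxz hsv, solve hxz hsv', solve hyz hv, solve hxy hv',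
    solve hyz hstu, solve hxy hstu', solve hyx htu, solve hzy htu', solve hxz hsu, solve hxz hsu',
    solve hxy hu, solve hyz hu']
  rw [show y - x = -(x - y) by ring, show z - y = -(y - z) by ring]
  cases b <;> simp only [cond_true, cond_false] <;> field_simp <;> ring

lemma isBraid_hecke (b : Bool) : IsBraid (fun i => (hecke b i : Ser → Ser)) where
  far i j h v := hecke_far h v
  braid i f := by
    have hx1 := swapVar_zi_left i
    have hx2 := swapVar_zi_right i
    have hx3 : swapVar i (zi (i + 2)) = zi (i + 2) := swapVar_zi_of_ne (by omega) (by omega)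
    have hy1 : swapVar (i + 1) (zi i) = zi i := swapVar_zi_of_ne (by omega) (by omega)
    have hy2 : swapVar (i + 1) (zi (i + 1)) = zi (i + 2) := swapVar_zi_left (i + 1)
    have hy3 : swapVar (i + 1) (zi (i + 2)) = zi (i + 1) := swapVar_zi_right (i + 1)
    have hu := hecke_spec b i f
    have hv := hecke_spec b (i + 1) (hecke b i f)
    have hw := hecke_spec b i (hecke b (i + 1) (hecke b i f))
    have hu' := hecke_spec b (i + 1) f
    have hv' := hecke_spec b i (hecke b (i + 1) f)
    have hw' := hecke_spec b (i + 1) (hecke b i (hecke b (i + 1) f))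
    have hbr := swapVar_braid i f
    have hsu := congrArg (swapVar (i + 1)) hu
    have htu := congrArg (swapVar i) hu
    have hstu := congrArg (swapVar i) hsu
    have hsv := congrArg (swapVar i) hv
    have hsu' := congrArg (swapVar i) hu'
    have htu' := congrArg (swapVar (i + 1)) hu'
    have hstu' := congrArg (swapVar (i + 1)) hsu'
    have hsv' := congrArg (swapVar (i + 1)) hv'
    have hp : pivot b i = bif b then zi (i + 1) else zi i := rfl
    have hp' : pivot b (i + 1) = bif b then zi (i + 2) else zi (i + 1) := rfl
    have hcond : ∀ (g : Ser →+* Ser) (a c : Ser), g (bif b then a else c) =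
        bif b then g a else g c := by intro g a c; cases b <;> rfl
    rw [show i + 1 + 1 = i + 2 from rfl] at *
    simp only [map_mul, map_add, map_sub, map_one, swapVar_X, hx1, hx2, hx3, hy1, hy2, hy3,
      swapVar_swapVar, hp, hp', hcond] at hu hv hw hu' hv' hw' hsu htu hstu hsv hsu' htu' hstu' hsv'
    rw [← hbr] at hstu'
    have inj := IsFractionRing.injective Ser (FractionRing Ser)
    have hne : ∀ {j k : ℕ}, j ≠ k → algebraMap Ser (FractionRing Ser) (zi j) -
        algebraMap Ser (FractionRing Ser) (zi k) ≠ 0 := by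
      intro j k hjk
      rw [← map_sub]
      exact fun h => zi_sub_ne_zero hjk ((map_eq_zero_iff _ inj).1 h)
    have hc : ∀ (a c : Ser), algebraMap Ser (FractionRing Ser) (bif b then a else c) =
        bif b then algebraMap Ser (FractionRing Ser) a else algebraMap Ser (FractionRing Ser) c := by
      intro a c; cases b <;> rfl
    apply inj
    have A := fun {a c : Ser} (h : a = c) => congrArg (algebraMap Ser (FractionRing Ser)) h
    replace hu := A hu
    replace hv := A hv
    replace hw := A hw
    replace hu' := A hu'
    replace hv' := A hv'
    replace hw' := A hw'
    replace hsu := A hsu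
    replace htu := A htu
    replace hstu := A hstu
    replace hsv := A hsv
    replace hsu' := A hsu'
    replace htu' := A htu'
    replace hstu' := A hstu'
    replace hsv' := A hsv'
    simp only [map_mul, map_add, map_sub, map_one, hc] at hu hv hw hu' hv' hw' hsu htu hstu hsv hsu' htu' hstu' hsv'
    exact braid_aux b (hne (by omega)) (hne (by omega)) (hne (by omega)) hu hsu htu hstu hv hsv hw
      hu' hsu' htu' hstu' hv' hsv' hw'

/-! ### Nonsymmetric Hall–Littlewood polynomials and the affine rotation -/

/-- The exponent with the entries of a list as its first coordinates. -/
def listExpo (l : List ℤ) : ℕ → ℤ := fun i => l.getD i 0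

/-- The nonsymmetric Hall–Littlewood Laurent polynomial indexed by a list, for the operators
`hecke b i`. -/
noncomputable def nshl (b : Bool) (l : List ℤ) : Ser :=
  word (fun i => (hecke b i : Ser → Ser)) 0 l (mono (listExpo (sortDesc l)))

/-- The eigenvalue of `hecke b i` on symmetric elements. -/
noncomputable def heckeEig (b : Bool) : Ser := bif b then X else 1

lemma hecke_heckeEig_mul (b b' : Bool) (i : ℕ) (f : Ser) :
    hecke b i (heckeEig b' * f) = heckeEig b' * hecke b i f :=
  hecke_mul_left (by cases b' <;> simp [heckeEig, swapVar_X]) f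

lemma hecke_X_pow_mul (b : Bool) (i k : ℕ) (f : Ser) :
    hecke b i (X ^ k * f) = X ^ k * hecke b i f :=
  hecke_mul_left (by simp [swapVar_X]) f

lemma nshl_of_pairwise (b : Bool) : ∀ {l : List ℤ}, l.Pairwise (· ≥ ·) →
    nshl b l = mono (listExpo l) := by
  intro l hl
  have : ∀ (l : List ℤ) (o : ℕ) (v : Ser), l.Pairwise (· ≥ ·) →
      word (fun i => (hecke b i : Ser → Ser)) o l v = v := by
    intro l
    induction l with
    | nil => intros; rfl
    | cons x r ih =>
      intro o v h
      rw [List.pairwise_cons] at h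
      rw [word, List.countP_eq_zero.2 (by simpa using h.1), chain, ih _ _ h.2]
  rw [nshl, this _ _ _ hl, sortDesc_of_pairwise hl]

lemma nshl_swap_of_lt (b : Bool) {x y : ℤ} (h : y < x) (l r : List ℤ) :
    hecke b l.length (nshl b (l ++ x :: y :: r)) = nshl b (l ++ y :: x :: r) := by
  have := word_swap (isBraid_hecke b) h r l 0 (mono (listExpo (sortDesc (l ++ x :: y :: r))))
  rw [Nat.zero_add] at this
  rw [nshl, this, nshl, sortDesc_eq_of_perm ((List.Perm.swap y x r).append_left l)]

/-- The dominant monomial is symmetric at the places of equal entries, so the operator acts there by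
its eigenvalue; `word_repeat` carries this from the sorted list to the given one. -/
lemma nshl_repeat (b : Bool) (x : ℤ) (l r : List ℤ) :
    hecke b l.length (nshl b (l ++ x :: x :: r)) = heckeEig b * nshl b (l ++ x :: x :: r) := by
  have := word_repeat (isBraid_hecke b) (c := fun f => heckeEig b * f)
    (fun i v => hecke_heckeEig_mul b b i v) (l ++ x :: x :: r) 0
    (mono (listExpo (sortDesc (l ++ x :: x :: r)))) ?_ l x r rfl
  · rwa [Nat.zero_add] at this
  · intro p y s hp
    rw [Nat.zero_add]
    apply hecke_of_swapVar_eq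
    rw [swapVar_mono, hp]
    congr 1
    funext k
    have h1 : (p ++ y :: y :: s).getD p.length 0 = y := by simp
    have h2 : (p ++ y :: y :: s).getD (p.length + 1) 0 = y := by simp
    simp only [listExpo, Equiv.swap_apply_def]
    split_ifs with h h'
    · rw [h, h1, h2]
    · rw [h', h1, h2]
    · rfl

/-- The operator `hecke false` has eigenvalue 1 on symmetric elements, so ties do no harm for this
family. For `true` they would produce a factor q. -/
lemma nshl_swap {b : Bool} {x y : ℤ} (h : y < x ∨ b = false ∧ y ≤ x) (l r : List ℤ) :
    hecke b l.length (nshl b (l ++ x :: y :: r)) = nshl b (l ++ y :: x :: r) := by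
  rcases lt_or_ge y x with h' | h'
  · exact nshl_swap_of_lt b h' l r
  · obtain ⟨rfl, h⟩ := h.resolve_left (by omega)
    obtain rfl : x = y := by omega
    simp [nshl_repeat, heckeEig]

/-- The composite `T_{o+k-1} ∘ ⋯ ∘ T_{o+1} ∘ T_o`. -/
noncomputable def heckeDown (b : Bool) : ℕ → ℕ → Ser → Ser
  | _, 0, v => v
  | o, k + 1, v => heckeDown b (o + 1) k (hecke b o v)

/-- The composite `T_o ∘ T_{o+1} ∘ ⋯ ∘ T_{o+k-1}`. -/
noncomputable def heckeUp (b : Bool) (o k : ℕ) (v : Ser) : Ser :=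
  chain (fun i => (hecke b i : Ser → Ser)) o k v

lemma heckeUp_zero (b : Bool) (o : ℕ) (v : Ser) : heckeUp b o 0 v = v := rfl

lemma heckeUp_succ (b : Bool) (o k : ℕ) (v : Ser) :
    heckeUp b o (k + 1) v = hecke b o (heckeUp b (o + 1) k v) := rfl

lemma heckeUp_add (b : Bool) (k m : ℕ) : ∀ (o : ℕ) (v : Ser),
    heckeUp b o (k + m) v = heckeUp b o k (heckeUp b (o + k) m v) := by
  induction k with
  | zero => intro o v; simp [heckeUp_zero]
  | succ k ih =>
    intro o v
    rw [heckeUp_succ, show k + 1 + m = k + m + 1 by omega, heckeUp_succ, ih]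
    congr 3
    omega

lemma heckeDown_add (b : Bool) (k m : ℕ) : ∀ (o : ℕ) (v : Ser),
    heckeDown b o (k + m) v = heckeDown b (o + k) m (heckeDown b o k v) := by
  induction k with
  | zero => intro o v; simp [heckeDown]
  | succ k ih =>
    intro o v
    rw [heckeDown, show k + 1 + m = k + m + 1 by omega, heckeDown, ih]
    congr 1
    omega

lemma heckeDown_far {b : Bool} {j : ℕ} : ∀ {k o : ℕ}, j + 1 < o → ∀ v,
    heckeDown b o k (hecke b j v) = hecke b j (heckeDown b o k v)
  | 0, _, _, _ => rfl
  | k + 1, o, hj, v => by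
    rw [heckeDown, heckeDown, ← hecke_far hj, heckeDown_far (by omega)]

lemma hecke_braid (b : Bool) (i : ℕ) (v : Ser) :
    hecke b i (hecke b (i + 1) (hecke b i v)) =
      hecke b (i + 1) (hecke b i (hecke b (i + 1) v)) :=
  (isBraid_hecke b).braid i v

lemma heckeDown_shift {b : Bool} {j : ℕ} (k : ℕ) : ∀ {o : ℕ}, o ≤ j → j + 1 < o + k → ∀ v,
    heckeDown b o k (hecke b (j + 1) v) = hecke b j (heckeDown b o k v) := by
  induction k with
  | zero => intro o h1 h2; omega
  | succ k ih =>
    intro o h1 h2 v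
    rcases Nat.eq_or_lt_of_le h1 with h1 | h1
    · obtain ⟨k, rfl⟩ : ∃ k', k = k' + 1 := ⟨k - 1, by omega⟩
      subst h1
      rw [heckeDown, heckeDown, heckeDown, heckeDown, ← hecke_braid,
        heckeDown_far (Nat.lt_succ_self _)]
    · rw [heckeDown, heckeDown, hecke_far (by omega), ih h1 (by omega)]

lemma heckeDown_X_mul (b : Bool) (n : ℕ) : ∀ (k o : ℕ) (v : Ser),
    heckeDown b o k (X ^ n * v) = X ^ n * heckeDown b o k v
  | 0, _, _ => rfl
  | k + 1, o, v => by rw [heckeDown, hecke_X_pow_mul, heckeDown_X_mul b n k, heckeDown]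

lemma heckeUp_mul (b : Bool) {c : Ser} (hc : ∀ i, swapVar i c = c) (o k : ℕ) (v : Ser) :
    heckeUp b o k (c * v) = c * heckeUp b o k v :=
  chain_const (c := fun v => c * v) (fun i v => hecke_mul_left (hc i) v) k o v

lemma heckeUp_sub (b : Bool) : ∀ (k o : ℕ) (v w : Ser),
    heckeUp b o k (v - w) = heckeUp b o k v - heckeUp b o k w
  | 0, _, _, _ => rfl
  | k + 1, o, v, w => by rw [heckeUp_succ, heckeUp_sub b k, map_sub, heckeUp_succ, heckeUp_succ]

lemma hecke_false_eq (i : ℕ) (f : Ser) : hecke false i f = hecke true i f - (X - 1) * f := by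
  rw [hecke_true]; ring

lemma heckeUp_true_shift_false {j k o : ℕ} (h1 : o ≤ j) (h2 : j + 1 < o + k) (v : Ser) :
    hecke false (j + 1) (heckeUp true o k v) = heckeUp true o k (hecke false j v) := by
  rw [hecke_false_eq, hecke_false_eq, heckeUp_sub, heckeUp_mul true (by simp [swapVar_X])]
  congr 1
  exact chain_shift (isBraid_hecke true) h1 h2 v

lemma heckeDown_nshl {b : Bool} {x : ℤ} : ∀ (s l : List ℤ),
    (∀ z ∈ s, z < x ∨ b = false ∧ z ≤ x) →
    heckeDown b l.length s.length (nshl b (l ++ x :: s)) = nshl b (l ++ s ++ [x])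
  | [], l, _ => by simp [heckeDown]
  | z :: s, l, h => by
    rw [List.length_cons, heckeDown, nshl_swap (h z (by simp))]
    have := heckeDown_nshl s (l ++ [z]) (fun w hw => h w (by simp [hw]))
    simpa using this

lemma heckeUp_nshl {b : Bool} {x : ℤ} (s : List ℤ) : ∀ (p l : List ℤ),
    (∀ z ∈ p, x < z ∨ b = false ∧ x ≤ z) →
    heckeUp b l.length p.length (nshl b (l ++ p ++ x :: s)) = nshl b (l ++ x :: (p ++ s))
  | [], l, _ => by simp [heckeUp_zero]
  | z :: p, l, h => by
    rw [List.length_cons, heckeUp_succ]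
    have := heckeUp_nshl s p (l ++ [z]) (fun w hw => h w (by simp [hw]))
    simp only [List.length_append, List.length_cons, List.length_nil, List.append_assoc,
      List.cons_append, List.nil_append, Nat.zero_add] at this ⊢
    rw [this, nshl_swap (h z (by simp))]

/-- Each step uses z_i T_i = T̄_i z_{i+1} and then T_i T̄_i = q. -/
lemma heckeDown_zi_mul_heckeUp : ∀ (k o : ℕ) (f : Ser),
    heckeDown true o k (zi o * heckeUp true o k f) = X ^ k * (zi (o + k) * f)
  | 0, o, f => by simp [heckeDown, heckeUp_zero]
  | k + 1, o, f => by
    rw [heckeUp_succ, zi_mul_hecke_true, heckeDown, hecke_true_false, ← pow_one (X : Ser),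
      heckeDown_X_mul, heckeDown_zi_mul_heckeUp k (o + 1)]
    rw [show o + 1 + k = o + (k + 1) by omega]
    ring

lemma heckeUp_heckeDown : ∀ (k o : ℕ) (f : Ser),
    heckeUp true o k (heckeDown false o k f) = X ^ k * f
  | 0, o, f => by simp [heckeDown, heckeUp_zero]
  | k + 1, o, f => by
    rw [heckeUp_succ, heckeDown, heckeUp_heckeDown k, hecke_X_pow_mul, hecke_true_false]
    ring

lemma zi_mul_heckeUp : ∀ (k o : ℕ) (f : Ser),
    zi o * heckeUp true o k f = heckeUp false o k (zi (o + k) * f)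
  | 0, o, f => by simp [heckeUp_zero]
  | k + 1, o, f => by
    rw [heckeUp_succ, zi_mul_hecke_true, zi_mul_heckeUp k, heckeUp_succ]
    rw [show o + 1 + k = o + (k + 1) by omega]

lemma zi_mul_mono_listExpo (p s : List ℤ) (x : ℤ) :
    zi p.length * mono (listExpo (p ++ x :: s)) = mono (listExpo (p ++ (x + 1) :: s)) := by
  rw [zi, ← mono_add]
  congr 1
  funext k
  simp only [Pi.add_apply, Pi.single_apply, listExpo]
  rcases lt_trichotomy k p.length with h | rfl | h
  · rw [List.getD_append _ _ _ _ h, List.getD_append _ _ _ _ h, if_neg h.ne, zero_add]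
  · simp [add_comm]
  · obtain ⟨j, rfl⟩ : ∃ j, k = p.length + (j + 1) := ⟨k - p.length - 1, by omega⟩
    rw [List.getD_append_right _ _ _ _ (by omega), List.getD_append_right _ _ _ _ (by omega)]
    simp

/-- The affine rotation acts on the nonsymmetric Hall–Littlewood polynomials by rotation of the
index. -/
lemma heckeDown_zi_mul_nshl (x : ℤ) (r : List ℤ) :
    heckeDown true 0 r.length (zi 0 * nshl true (x :: r)) =
      X ^ r.countP (x < ·) * nshl true (r ++ [x + 1]) := by
  induction r using list_swap_induction with
  | hs r hr =>
    obtain ⟨p, s, rfl, hp, hs⟩ := exists_split_pairwise_ge x r hr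
    have h1 := heckeUp_nshl (b := true) (x := x) s p [] (fun z hz => Or.inl (hp z hz))
    have hcount : (p ++ s).countP (x < ·) = p.length := by
      rw [List.countP_append, List.countP_eq_length.2 (by simpa using hp),
        List.countP_eq_zero.2 (by simpa using hs)]
      rfl
    rw [List.pairwise_append] at hr
    have h2 : ∀ y : ℤ, (∀ z ∈ p, y ≤ z) → (∀ z ∈ s, z ≤ y) → (p ++ y :: s).Pairwise (· ≥ ·) := by
      intro y h3 h4
      rw [List.pairwise_append, List.pairwise_cons]
      refine ⟨hr.1, ⟨h4, hr.2.1⟩, fun z hz w hw => ?_⟩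
      rcases List.mem_cons.1 hw with rfl | hw
      · exact h3 z hz
      · exact hr.2.2 z hz w hw
    simp only [List.nil_append, List.length_nil] at h1
    -- The entry `x` is taken to the front from its sorted place, and the first part of the descent
    -- undoes this, raising it to `x + 1` at the cost of q^|p|. The list is still sorted since `p`
    -- exceeds `x`; the rest of the descent carries `x + 1` past `s` to the end.
    rw [← h1, List.length_append, heckeDown_add, heckeDown_zi_mul_heckeUp, heckeDown_X_mul,
      hcount, Nat.zero_add, nshl_of_pairwise true (h2 x (fun z hz => (hp z hz).le) hs),
      zi_mul_mono_listExpo,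
      ← nshl_of_pairwise true (h2 (x + 1) hp (fun z hz => (hs z hz).trans (by omega))),
      heckeDown_nshl s p (fun z hz => Or.inl (by have := hs z hz; omega))]
  | hQ l c d s hdc h =>
    have hperm : (l ++ d :: c :: s).Perm (l ++ c :: d :: s) :=
      (List.Perm.swap c d s).append_left l
    have h1 := nshl_swap (b := true) (Or.inl hdc) (x :: l) s
    have h2 := nshl_swap (b := true) (Or.inl hdc) l (s ++ [x + 1])
    simp only [List.length_cons, List.cons_append] at h1
    -- The exchange sits one place further right before the rotation than after it, and
    -- `heckeDown_shift` accounts for that.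
    rw [← h1, ← hecke_mul_left (swapVar_zi_of_ne (by omega) (by omega)), hperm.length_eq,
      heckeDown_shift _ (by omega) (by simp), h, hecke_X_pow_mul, hperm.countP_eq]
    simp only [List.append_assoc, List.cons_append] at h2 ⊢
    rw [h2]

/-- The rotation for the family `false`, in the form adjoint to `heckeDown_zi_mul_nshl`. The sorted
list is split at `x - 1`, because ties with the moved entry are free for this family. -/
lemma zi_mul_heckeUp_nshl (x : ℤ) (r : List ℤ) :
    zi 0 * heckeUp true 0 r.length (nshl false (r ++ [x - 1])) =
      X ^ r.countP (· < x) * nshl false (x :: r) := by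
  induction r using list_swap_induction with
  | hs r hr =>
    obtain ⟨p, s, rfl, hp, hs⟩ := exists_split_pairwise_ge (x - 1) r hr
    have h1 := heckeUp_nshl (b := false) (x := x) s p []
      (fun z hz => Or.inr ⟨rfl, by have := hp z hz; omega⟩)
    have hcount : (p ++ s).countP (· < x) = s.length := by
      rw [List.countP_append, List.countP_eq_zero.2 (fun z hz => by
        have := hp z hz; simp; omega), List.countP_eq_length.2 (fun z hz => by
        have := hs z hz; simp; omega), Nat.zero_add]
    rw [List.pairwise_append] at hr
    have h2 : ∀ y : ℤ, (∀ z ∈ p, y ≤ z) → (∀ z ∈ s, z ≤ y) → (p ++ y :: s).Pairwise (· ≥ ·) := by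
      intro y h3 h4
      rw [List.pairwise_append, List.pairwise_cons]
      refine ⟨hr.1, ⟨h4, hr.2.1⟩, fun z hz w hw => ?_⟩
      rcases List.mem_cons.1 hw with rfl | hw
      · exact h3 z hz
      · exact hr.2.2 z hz w hw
    simp only [List.nil_append, List.length_nil] at h1
    rw [← heckeDown_nshl s p (fun z hz => Or.inr ⟨rfl, hs z hz⟩), List.length_append, heckeUp_add,
      Nat.zero_add, heckeUp_heckeDown, heckeUp_mul _ (by simp [swapVar_X]), mul_left_comm,
      zi_mul_heckeUp, Nat.zero_add, hcount,
      nshl_of_pairwise false (h2 (x - 1) (fun z hz => (hp z hz).le) hs),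
      zi_mul_mono_listExpo, sub_add_cancel,
      ← nshl_of_pairwise false (h2 x (fun z hz => by have := hp z hz; omega)
        (fun z hz => (hs z hz).trans (by omega))), h1]
  | hQ l c d s hdc h =>
    have hperm : (l ++ d :: c :: s).Perm (l ++ c :: d :: s) :=
      (List.Perm.swap c d s).append_left l
    have h1 := nshl_swap (b := false) (Or.inl hdc) (x :: l) s
    have h2 := nshl_swap (b := false) (Or.inl hdc) l (s ++ [x - 1])
    simp only [List.append_assoc, List.cons_append, List.length_cons] at h1 h2 h ⊢
    rw [← h1, ← h2, hperm.countP_eq, ← hecke_X_pow_mul, ← h, hperm.length_eq,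
      ← heckeUp_true_shift_false (by omega) (by simp),
      hecke_mul_left (swapVar_zi_of_ne (by omega) (by omega))]

/-! ### The Hall–Littlewood density and functional -/

/-- The geometric series `∑ u^n X^n`. -/
noncomputable def geo {A : Type*} [CommRing A] (u : A) : PowerSeries A :=
  PowerSeries.mk fun n => u ^ n

lemma one_sub_mul_geo {A : Type*} [CommRing A] (u : A) : (1 - X * C u) * geo u = 1 := by
  ext n
  rw [sub_mul, one_mul, map_sub, mul_assoc]
  cases n with
  | zero => simp [geo]
  | succ n =>
    rw [coeff_succ_X_mul, coeff_C_mul, geo, coeff_mk, coeff_mk, coeff_one, if_neg (by omega)]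
    ring

lemma map_geo {A B : Type*} [CommRing A] [CommRing B] (φ : A →+* B) (u : A) :
    PowerSeries.map φ (geo u) = geo (φ u) := by
  ext n; simp [geo]

/-- The monomial `z_i / z_j` as a Laurent polynomial. -/
noncomputable def lauRatio (i j : ℕ) : Lau :=
  AddMonoidAlgebra.single (Pi.single i 1 - Pi.single j 1) 1

/-- The factor `(1 - z_i / z_j) / (1 - q z_i / z_j)`. -/
noncomputable def hlFactor (i j : ℕ) : Ser := (1 - C (lauRatio i j)) * geo (lauRatio i j)

/-- The Hall–Littlewood density `∏_{j < k < n} (1 - z_j / z_k) / (1 - q z_j / z_k)`. -/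
noncomputable def hlDensity (n : ℕ) : Ser := ∏ k ∈ Finset.range n, ∏ j ∈ Finset.range k, hlFactor j k

lemma C_lauRatio_mul_zi (i j : ℕ) : C (lauRatio i j) * zi j = zi i := by
  rw [show C (lauRatio i j) = mono (Pi.single i 1 - Pi.single j 1) from rfl, zi, ← mono_add,
    sub_add_cancel, zi]

lemma hlFactor_mul (i j : ℕ) : (1 - X * C (lauRatio i j)) * hlFactor i j = 1 - C (lauRatio i j) := by
  rw [hlFactor, mul_left_comm, one_sub_mul_geo, mul_one]

lemma swapVar_hlFactor (i j k : ℕ) : swapVar i (hlFactor j k) =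
    hlFactor (Equiv.swap i (i + 1) j) (Equiv.swap i (i + 1) k) := by
  have h : AddMonoidAlgebra.mapDomainRingHom ℤ (permExpo (Equiv.swap i (i + 1))) (lauRatio j k) =
      lauRatio (Equiv.swap i (i + 1) j) (Equiv.swap i (i + 1) k) := by
    simp only [lauRatio, AddMonoidAlgebra.mapDomainRingHom_apply, AddMonoidAlgebra.mapDomain_single,
      map_sub, permExpo_single, Equiv.symm_swap]
  rw [hlFactor, map_mul, map_sub, map_one, swapVar, reindex, PowerSeries.map_C, map_geo, h, hlFactor]

/-- Exchanging z_i and z_{i+1} permutes the pairs j < k other than (i, i+1), so a single factor of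
the density fails to be symmetric. -/
lemma hlDensity_eq_mul {i n : ℕ} (h : i + 1 < n) : ∃ G, swapVar i G = G ∧
    hlDensity n = hlFactor i (i + 1) * G := by
  let F : ℕ → ℕ → Ser := fun j k => if j < k ∧ ¬ (j = i ∧ k = i + 1) then hlFactor j k else 1
  refine ⟨∏ k ∈ Finset.range n, ∏ j ∈ Finset.range n, F j k, ?_, ?_⟩
  · have hF : ∀ j k, swapVar i (F j k) = F (Equiv.swap i (i + 1) j) (Equiv.swap i (i + 1) k) := by
      intro j k
      have hiff : (j < k ∧ ¬ (j = i ∧ k = i + 1)) ↔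
          (Equiv.swap i (i + 1) j < Equiv.swap i (i + 1) k ∧
            ¬ (Equiv.swap i (i + 1) j = i ∧ Equiv.swap i (i + 1) k = i + 1)) := by
        simp only [Equiv.swap_apply_def]
        split_ifs <;> omega
      simp only [F]
      by_cases hjk : j < k ∧ ¬ (j = i ∧ k = i + 1)
      · rw [if_pos hjk, if_pos (hiff.1 hjk), swapVar_hlFactor]
      · rw [if_neg hjk, if_neg (mt hiff.2 hjk), map_one]
    have hmem : ∀ k, k ∈ Finset.range n ↔ Equiv.swap i (i + 1) k ∈ Finset.range n := by
      intro k
      simp only [Finset.mem_range, Equiv.swap_apply_def]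
      split_ifs <;> omega
    simp only [map_prod, hF]
    rw [Finset.prod_equiv (Equiv.swap i (i + 1)) hmem
      (g := fun k => ∏ j ∈ Finset.range n, F (Equiv.swap i (i + 1) j) k) fun _ _ => rfl]
    refine Finset.prod_congr rfl fun k _ => ?_
    exact Finset.prod_equiv (Equiv.swap i (i + 1)) hmem fun _ _ => rfl
  · have h1 : hlDensity n = ∏ k ∈ Finset.range n, ∏ j ∈ Finset.range n,
        if j < k then hlFactor j k else 1 := by
      refine Finset.prod_congr rfl fun k hk => ?_
      rw [← Finset.prod_filter]
      refine Finset.prod_congr ?_ fun _ _ => rfl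
      ext j
      simp only [Finset.mem_range, Finset.mem_filter] at hk ⊢
      omega
    have h2 : hlFactor i (i + 1) = ∏ k ∈ Finset.range n, ∏ j ∈ Finset.range n,
        if k = i + 1 then (if j = i then hlFactor i (i + 1) else 1) else 1 := by
      rw [Finset.prod_eq_single (i + 1), Finset.prod_eq_single i]
      · simp
      · intro j _ hj; simp [hj]
      · intro hj; simp at hj; omega
      · intro k _ hk; simp [hk]
      · intro hk; simp at hk; omega
    rw [h1]
    conv_rhs => rw [h2]
    rw [← Finset.prod_mul_distrib]
    refine Finset.prod_congr rfl fun k _ => ?_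
    rw [← Finset.prod_mul_distrib]
    refine Finset.prod_congr rfl fun j _ => ?_
    simp only [F]
    by_cases hk : k = i + 1 <;> by_cases hj : j = i
    · subst hk hj; simp
    · simp [hk, hj]
    · simp [hk, hj]
    · simp [hk, hj]

open Classical in
/-- The indicator of the exponents without positive coordinates. -/
noncomputable def nonposInd (ν : ℕ → ℤ) : ℤ := if ∀ i, ν i ≤ 0 then 1 else 0

/-- The sum of the coefficients of the monomials without positive exponents. -/
noncomputable def nonposSum : Ser →+ PowerSeries ℤ := coeffwise (lin nonposInd)

lemma coeffwise_X_mul {A B : Type*} [CommRing A] [CommRing B] (φ : A →+ B) (f : PowerSeries A) :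
    coeffwise φ (X * f) = X * coeffwise φ f := by
  ext n
  rw [coeff_coeffwise]
  cases n with
  | zero => simp
  | succ n => rw [coeff_succ_X_mul, coeff_succ_X_mul, coeff_coeffwise]

lemma nonposSum_swapVar (i : ℕ) (f : Ser) : nonposSum (swapVar i f) = nonposSum f := by
  ext n
  rw [nonposSum, coeff_coeffwise, coeff_coeffwise, swapVar, reindex, coeff_map]
  have : (lin nonposInd).comp ((AddMonoidAlgebra.mapDomainRingHom ℤ
      (permExpo (Equiv.swap i (i + 1))) : Lau →+* Lau) : Lau →+ Lau) = lin nonposInd :=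
    lau_hom_ext fun ν => by
      simp only [AddMonoidHom.comp_apply, AddMonoidHom.coe_coe,
        AddMonoidAlgebra.mapDomainRingHom_apply, AddMonoidAlgebra.mapDomain_single, lin_single,
        nonposInd, permExpo_apply]
      congr 2
      apply propext
      exact ⟨fun h k => by simpa using h (Equiv.swap i (i + 1) k), fun h k => h _⟩
  exact DFunLike.congr_fun this _

/-- The Hall–Littlewood functional in `n` variables. -/
noncomputable def hlFun (n : ℕ) (f : Ser) : PowerSeries ℤ := nonposSum (f * hlDensity n)

lemma hlFun_add (n : ℕ) (f g : Ser) : hlFun n (f + g) = hlFun n f + hlFun n g := by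
  rw [hlFun, add_mul, map_add, hlFun, hlFun]

lemma hlFun_sub (n : ℕ) (f g : Ser) : hlFun n (f - g) = hlFun n f - hlFun n g := by
  rw [hlFun, sub_mul, map_sub, hlFun, hlFun]

lemma hlFun_X_mul (n : ℕ) (f : Ser) : hlFun n (X * f) = X * hlFun n f := by
  rw [hlFun, mul_assoc, nonposSum, coeffwise_X_mul, hlFun, nonposSum]

lemma hlFun_X_pow_mul (n k : ℕ) (f : Ser) : hlFun n (X ^ k * f) = X ^ k * hlFun n f := by
  induction k with
  | zero => simp
  | succ k ih => rw [pow_succ', mul_assoc, hlFun_X_mul, ih, pow_succ', mul_assoc]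

/-- The exceptional factor of the density turns z_{i+1} - q z_i into z_{i+1} - z_i. The product is
then antisymmetric, while summing over nonpositive exponents is invariant under the exchange, so the
value equals its own negative. -/
lemma hlFun_eq_zero_of_swapVar {n i : ℕ} (h : i + 1 < n) {G : Ser} (hG : swapVar i G = G) :
    hlFun n ((zi (i + 1) - X * zi i) * G) = 0 := by
  obtain ⟨D, hD, hn⟩ := hlDensity_eq_mul h
  have e : (zi (i + 1) - X * zi i) * G * hlDensity n = (zi (i + 1) - zi i) * (G * D) := by
    rw [hn]
    have h1 := hlFactor_mul i (i + 1)
    have h2 := C_lauRatio_mul_zi i (i + 1)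
    rw [← h2]
    linear_combination zi (i + 1) * G * D * h1
  have hneg : swapVar i ((zi (i + 1) - zi i) * (G * D)) = -((zi (i + 1) - zi i) * (G * D)) := by
    simp only [map_mul, map_sub, swapVar_zi_left, swapVar_zi_right, hG, hD]
    ring
  rw [hlFun, e]
  have := nonposSum_swapVar i ((zi (i + 1) - zi i) * (G * D))
  rw [hneg, map_neg] at this
  ext k
  have := congrArg (coeff k) this
  rw [map_neg] at this
  rw [map_zero]
  omega

/-- The operators `hecke b i` are self-adjoint for the Hall–Littlewood functional. -/
lemma hlFun_hecke_mul {n i : ℕ} (h : i + 1 < n) (b : Bool) (f g : Ser) :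
    hlFun n (hecke b i f * g) = hlFun n (f * hecke b i g) := by
  have h1 := zi_sub_mul_divDiff i f
  have h2 := zi_sub_mul_divDiff i g
  have hG : (zi i - zi (i + 1)) * (divDiff i f * g - f * divDiff i g) =
      f * swapVar i g - swapVar i f * g := by linear_combination g * h1 - f * h2
  have hsG : swapVar i (divDiff i f * g - f * divDiff i g) =
      divDiff i f * g - f * divDiff i g := by
    have := congrArg (swapVar i) hG
    simp only [map_mul, map_sub, swapVar_zi_left, swapVar_zi_right, swapVar_swapVar] at this
    apply mul_left_cancel₀ (zi_sub_ne_zero (Nat.succ_ne_self i).symm)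
    rw [hG]
    simp only [map_mul, map_sub]
    linear_combination -this
  -- The failure of self-adjointness before applying the functional is z_{i+1} - q z_i times a
  -- symmetric element.
  have e : hecke b i f * g - f * hecke b i g =
      (zi (i + 1) - X * zi i) * (divDiff i f * g - f * divDiff i g) := by
    apply mul_left_cancel₀ (zi_sub_ne_zero (Nat.succ_ne_self i).symm)
    linear_combination g * hecke_spec b i f - f * hecke_spec b i g - (zi (i + 1) - X * zi i) * hG
  rw [← sub_eq_zero, ← hlFun_sub, e, hlFun_eq_zero_of_swapVar h hsG]

/-- By self-adjointness the operator acts on 1 instead, with eigenvalue 1. Hence the functional does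
not see T̄_i. -/
lemma hlFun_hecke_false {n i : ℕ} (h : i + 1 < n) (f : Ser) :
    hlFun n (hecke false i f) = hlFun n f := by
  have := hlFun_hecke_mul h false f 1
  rw [mul_one, hecke_of_swapVar_eq (map_one _)] at this
  simpa using this

lemma hlFun_heckeDown_mul {n : ℕ} (b : Bool) (g : Ser) : ∀ (k o : ℕ) (f : Ser), o + k < n →
    hlFun n (heckeDown b o k f * g) = hlFun n (f * heckeUp b o k g)
  | 0, _, _, _ => rfl
  | k + 1, o, f, h => by
    rw [heckeDown, hlFun_heckeDown_mul b g k (o + 1) _ (by omega), hlFun_hecke_mul (by omega),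
      heckeUp_succ]

/-! ### Supports, and the functional on monomials -/

/-- All exponents that occur in `f` lie in `S`. -/
def SuppIn (S : Set (ℕ → ℤ)) (f : Ser) : Prop := ∀ n ν, (coeff n f).coeff ν ≠ 0 → ν ∈ S

lemma suppIn_mono {S : Set (ℕ → ℤ)} {ν : ℕ → ℤ} (h : ν ∈ S) : SuppIn S (mono ν) := by
  classical
  intro n μ hμ
  rw [mono, coeff_C] at hμ
  split_ifs at hμ
  · rw [AddMonoidAlgebra.coeff_single, Finsupp.single_apply] at hμ
    split_ifs at hμ with h'
    · rwa [← h']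
    · exact absurd rfl hμ
  · simp at hμ

lemma SuppIn.add {S : Set (ℕ → ℤ)} {f g : Ser} (hf : SuppIn S f) (hg : SuppIn S g) :
    SuppIn S (f + g) := by
  intro n ν h
  rw [map_add, AddMonoidAlgebra.coeff_add, Finsupp.add_apply] at h
  by_cases h1 : (coeff n f).coeff ν = 0
  · exact hg n ν fun h2 => h (by rw [h1, h2, add_zero])
  · exact hf n ν h1

lemma SuppIn.neg {S : Set (ℕ → ℤ)} {f : Ser} (hf : SuppIn S f) : SuppIn S (-f) := by
  intro n ν h
  rw [map_neg, AddMonoidAlgebra.coeff_neg, Finsupp.neg_apply] at h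
  exact hf n ν (neg_ne_zero.1 h)

lemma SuppIn.sub {S : Set (ℕ → ℤ)} {f g : Ser} (hf : SuppIn S f) (hg : SuppIn S g) :
    SuppIn S (f - g) := by
  rw [sub_eq_add_neg]; exact hf.add hg.neg

lemma lau_coeff_mul_ne_zero {f g : Lau} {ν : ℕ → ℤ} (h : (f * g).coeff ν ≠ 0) :
    ∃ a b, f.coeff a ≠ 0 ∧ g.coeff b ≠ 0 ∧ ν = a + b := by
  classical
  have := AddMonoidAlgebra.support_coeff_mul_subset f g (Finsupp.mem_support_iff.2 h)
  obtain ⟨a, ha, b, hb, hab⟩ := Finset.mem_add.1 this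
  exact ⟨a, b, Finsupp.mem_support_iff.1 ha, Finsupp.mem_support_iff.1 hb, hab.symm⟩

lemma lau_coeff_sum_ne_zero {ι : Type*} {s : Finset ι} {f : ι → Lau} {ν : ℕ → ℤ}
    (h : (∑ i ∈ s, f i).coeff ν ≠ 0) : ∃ i ∈ s, (f i).coeff ν ≠ 0 := by
  rw [AddMonoidAlgebra.coeff_sum, Finsupp.finsetSum_apply] at h
  exact Finset.exists_ne_zero_of_sum_ne_zero h

lemma SuppIn.mul {S S' S'' : Set (ℕ → ℤ)} {f g : Ser} (hf : SuppIn S f) (hg : SuppIn S' g)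
    (h : ∀ a ∈ S, ∀ b ∈ S', a + b ∈ S'') : SuppIn S'' (f * g) := by
  intro n ν hν
  rw [coeff_mul] at hν
  obtain ⟨p, -, hp⟩ := lau_coeff_sum_ne_zero hν
  obtain ⟨a, b, ha, hb, rfl⟩ := lau_coeff_mul_ne_zero hp
  exact h a (hf _ _ ha) b (hg _ _ hb)

lemma SuppIn.X_mul {S : Set (ℕ → ℤ)} {f : Ser} (hf : SuppIn S f) : SuppIn S (X * f) := by
  intro n ν hν
  cases n with
  | zero => simp at hν
  | succ n => rw [coeff_succ_X_mul] at hν; exact hf n ν hν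

lemma SuppIn.subset {S S' : Set (ℕ → ℤ)} {f : Ser} (hf : SuppIn S f) (h : S ⊆ S') : SuppIn S' f :=
  fun n ν hν => h (hf n ν hν)

lemma suppIn_one {S : Set (ℕ → ℤ)} (h : 0 ∈ S) : SuppIn S 1 := by
  rw [← mono_zero]; exact suppIn_mono h

/-- The exponents in an additive submonoid. -/
def suppSubring (S : AddSubmonoid (ℕ → ℤ)) : Subring Ser where
  carrier := {f | SuppIn S f}
  mul_mem' hf hg := SuppIn.mul hf hg fun _ ha _ hb => S.add_mem ha hb
  one_mem' := suppIn_one S.zero_mem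
  add_mem' := SuppIn.add
  zero_mem' := fun n ν h => by simp at h
  neg_mem' := SuppIn.neg

lemma geo_mem_suppSubring {S : AddSubmonoid (ℕ → ℤ)} {ν : ℕ → ℤ} (h : ν ∈ S) :
    geo (AddMonoidAlgebra.single ν 1 : Lau) ∈ suppSubring S := by
  classical
  intro n μ hμ
  rw [geo, coeff_mk, AddMonoidAlgebra.single_pow, AddMonoidAlgebra.coeff_single,
    Finsupp.single_apply] at hμ
  split_ifs at hμ with h'
  · rw [← h']; exact S.nsmul_mem h n
  · exact absurd rfl hμ

lemma hlFactor_mem_suppSubring {S : AddSubmonoid (ℕ → ℤ)} {i j : ℕ}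
    (h : (Pi.single i 1 - Pi.single j 1 : ℕ → ℤ) ∈ S) : hlFactor i j ∈ suppSubring S :=
  mul_mem (sub_mem (one_mem _) (suppIn_mono h)) (geo_mem_suppSubring h)

/-- The `q`-linear extension of a map on Laurent polynomials. -/
noncomputable def qExt (φ : Lau →+ PowerSeries ℤ) : Ser →+ PowerSeries ℤ where
  toFun f := PowerSeries.mk fun n =>
    ∑ p ∈ Finset.HasAntidiagonal.antidiagonal n, coeff p.2 (φ (coeff p.1 f))
  map_zero' := by ext n; simp
  map_add' f g := by ext n; simp [Finset.sum_add_distrib]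

lemma coeff_qExt (φ : Lau →+ PowerSeries ℤ) (f : Ser) (n : ℕ) :
    coeff n (qExt φ f) = ∑ p ∈ Finset.HasAntidiagonal.antidiagonal n, coeff p.2 (φ (coeff p.1 f)) := by
  simp [qExt]

lemma qExt_X_mul (φ : Lau →+ PowerSeries ℤ) (f : Ser) : qExt φ (X * f) = X * qExt φ f := by
  ext n
  rw [coeff_qExt]
  cases n with
  | zero => simp
  | succ n =>
    rw [coeff_succ_X_mul, coeff_qExt, Finset.Nat.sum_antidiagonal_succ]
    simp [coeff_succ_X_mul]

lemma qExt_C (φ : Lau →+ PowerSeries ℤ) (a : Lau) : qExt φ (C a) = φ a := by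
  ext n
  rw [coeff_qExt, Finset.sum_eq_single (0, n)]
  · simp
  · rintro ⟨i, j⟩ hij h
    have : i ≠ 0 := by
      rintro rfl
      simp at hij
      simp [hij] at h
    simp [coeff_C, this]
  · simp

lemma lau_hom_eq_zero {A : Type*} [AddCommGroup A] (φ : Lau →+ A) (f : Lau)
    (h : ∀ ν, f.coeff ν ≠ 0 → φ (AddMonoidAlgebra.single ν 1) = 0) : φ f = 0 := by
  have hf : f = ∑ ν ∈ f.coeff.support, f.coeff ν • AddMonoidAlgebra.single ν 1 := by
    conv_lhs => rw [← AddMonoidAlgebra.sum_coeff_single f]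
    rw [Finsupp.sum]
    refine Finset.sum_congr rfl fun ν _ => ?_
    rw [AddMonoidAlgebra.smul_single]
    simp
  rw [hf, map_sum]
  refine Finset.sum_eq_zero fun ν hν => ?_
  rw [map_zsmul, h ν (Finsupp.mem_support_iff.1 hν), smul_zero]

lemma qExt_eq_zero {φ : Lau →+ PowerSeries ℤ} {S : Set (ℕ → ℤ)} {f : Ser} (hf : SuppIn S f)
    (h : ∀ ν ∈ S, φ (AddMonoidAlgebra.single ν 1) = 0) : qExt φ f = 0 := by
  ext n
  rw [coeff_qExt, map_zero]
  refine Finset.sum_eq_zero fun p _ => ?_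
  rw [lau_hom_eq_zero φ _ fun ν hν => h ν (hf _ _ hν), map_zero]

lemma coeffwise_eq_zero {B : Type*} [CommRing B] {φ : Lau →+ B} {S : Set (ℕ → ℤ)} {f : Ser}
    (hf : SuppIn S f) (h : ∀ ν ∈ S, φ (AddMonoidAlgebra.single ν 1) = 0) :
    coeffwise φ f = 0 := by
  ext n
  rw [coeff_coeffwise, map_zero]
  exact lau_hom_eq_zero φ _ fun ν hν => h ν (hf _ _ hν)

open Classical in
/-- The weight `q^{∑ w_i (-ν_i)}` of an exponent without positive coordinates. -/
noncomputable def weight (n : ℕ) (w : ℕ → ℕ) (ν : ℕ → ℤ) : PowerSeries ℤ :=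
  if ∀ i, ν i ≤ 0 then X ^ ∑ i ∈ Finset.range n, w i * (-ν i).toNat else 0

/-- The weighted sum of the coefficients of the monomials without positive exponents. -/
noncomputable def weightSum (n : ℕ) (w : ℕ → ℕ) : Ser →+ PowerSeries ℤ := qExt (lin (weight n w))

lemma weightSum_mono (n : ℕ) (w : ℕ → ℕ) (ν : ℕ → ℤ) : weightSum n w (mono ν) = weight n w ν := by
  rw [weightSum, mono, qExt_C, lin_single, one_smul]

lemma nonposSum_eq_weightSum (n : ℕ) (f : Ser) : nonposSum f = weightSum n (fun _ => 0) f := by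
  ext k
  rw [nonposSum, coeff_coeffwise, weightSum, coeff_qExt]
  have h : lin (weight n fun _ => 0) =
      ((C : ℤ →+* PowerSeries ℤ) : ℤ →+ PowerSeries ℤ).comp (lin nonposInd) :=
    lau_hom_ext fun ν => by
      simp only [lin_single, AddMonoidHom.comp_apply, weight, nonposInd]
      split_ifs <;> simp
  rw [Finset.sum_eq_single (k, 0)]
  · rw [h]; simp
  · rintro ⟨i, j⟩ hij hne
    have : j ≠ 0 := by
      rintro rfl
      simp at hij
      simp [hij] at hne
    rw [h]
    change coeff j (C (lin nonposInd (coeff i f))) = 0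
    rw [coeff_C, if_neg this]
  · simp

/-- The exponents whose `c`-th coordinate is not positive. -/
def coordNonpos (c : ℕ) : AddSubmonoid (ℕ → ℤ) where
  carrier := {ν | ν c ≤ 0}
  zero_mem' := by simp
  add_mem' ha hb := add_nonpos (α := ℤ) ha hb

lemma mem_coordNonpos {c : ℕ} {ν : ℕ → ℤ} : ν ∈ coordNonpos c ↔ ν c ≤ 0 := Iff.rfl

/-- The exponents whose `c`-th coordinate is not negative. -/
def coordNonneg (c : ℕ) : AddSubmonoid (ℕ → ℤ) where
  carrier := {ν | 0 ≤ ν c}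
  zero_mem' := by simp
  add_mem' ha hb := add_nonneg (α := ℤ) ha hb

/-- Expand G / (1 - q z_j/z_c) into monomials ν and compare the contributions of ν and of ν times
z_j/z_c. If ν_j < 0, the equal weights `w j = w c` make the left contributions cancel, and the extra
unit in `w j` makes the right ones cancel against the factor q. If ν_j = 0, the shifted exponent is
positive and drops out on both sides, and the weight of z_j plays no role. The assumption on `G`
keeps ν_c nonpositive. -/
lemma weightSum_hlFactor {n j c : ℕ} (hj : j < n) (hc : c < n) (hjc : j ≠ c) {w : ℕ → ℕ}
    (hw : w j = w c) {G : Ser} (hG : SuppIn {ν | ν c ≤ 0} G) :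
    weightSum n w (G * hlFactor j c) = weightSum n (Function.update w j (w j + 1)) G := by
  set w' := Function.update w j (w j + 1) with hw'
  set δ : ℕ → ℤ := Pi.single j 1 - Pi.single c 1 with hδ
  have hH : SuppIn {ν | ν c ≤ 0} (G * geo (lauRatio j c)) := by
    have : geo (lauRatio j c) ∈ suppSubring (coordNonpos c) := geo_mem_suppSubring (by
      rw [mem_coordNonpos]
      simp [hjc.symm])
    exact SuppIn.mul hG this fun a ha b hb => (coordNonpos c).add_mem ha hb
  set H := G * geo (lauRatio j c) with hHdef
  have hGH : G = H - X * (H * C (lauRatio j c)) := by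
    rw [hHdef]
    linear_combination (-G) * one_sub_mul_geo (lauRatio j c)
  have hGf : G * hlFactor j c = H - H * C (lauRatio j c) := by
    rw [hHdef, hlFactor]; ring
  have hshift : ∀ φ : Lau →+ PowerSeries ℤ, qExt φ (H * C (lauRatio j c)) =
      qExt (φ.comp (AddMonoidHom.mulRight (lauRatio j c))) H := by
    intro φ
    ext k
    simp [coeff_qExt]
  rw [hGf]
  conv_rhs => rw [hGH]
  rw [map_sub, map_sub, weightSum, weightSum, qExt_X_mul, hshift, hshift]
  set φ := lin (weight n w)
  set ψ := lin (weight n w')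
  let θ : Lau →+ PowerSeries ℤ := φ - φ.comp (AddMonoidHom.mulRight (lauRatio j c)) -
    (ψ - (AddMonoidHom.mulLeft X).comp (ψ.comp (AddMonoidHom.mulRight (lauRatio j c))))
  have hθ : qExt θ H = qExt φ H - qExt (φ.comp (AddMonoidHom.mulRight (lauRatio j c))) H -
      (qExt ψ H - X * qExt (ψ.comp (AddMonoidHom.mulRight (lauRatio j c))) H) := by
    have hX : ∀ χ : Lau →+ PowerSeries ℤ,
        X * qExt χ H = qExt ((AddMonoidHom.mulLeft X).comp χ) H := by
      intro χ
      ext k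
      rw [coeff_qExt]
      cases k with
      | zero => simp
      | succ k =>
        rw [coeff_succ_X_mul, coeff_qExt, Finset.Nat.sum_antidiagonal_succ']
        simp [coeff_succ_X_mul]
    rw [hX]
    ext k
    simp [coeff_qExt, θ, Finset.sum_sub_distrib]
  rw [← sub_eq_zero, ← hθ]
  refine qExt_eq_zero hH fun ν hν => ?_
  have hνc : ν c ≤ 0 := hν
  have he : ∀ (v : ℕ → ℕ), ν j < 0 →
      ∑ i ∈ Finset.range n, v i * (-(ν + δ) i).toNat + v j =
      ∑ i ∈ Finset.range n, v i * (-ν i).toNat + v c := by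
    intro v hνj
    have h1 : v j = ∑ i ∈ Finset.range n, if i = j then v j else 0 := by simp [hj]
    have h2 : v c = ∑ i ∈ Finset.range n, if i = c then v c else 0 := by simp [hc]
    rw [h1]
    conv_rhs => rw [h2]
    rw [← Finset.sum_add_distrib, ← Finset.sum_add_distrib]
    refine Finset.sum_congr rfl fun i _ => ?_
    by_cases hij : i = j
    · subst hij
      have : (-(ν + δ) i).toNat + 1 = (-ν i).toNat := by
        simp [hδ, hjc]; omega
      rw [← this]; simp [hjc]; ring
    · by_cases hic : i = c
      · subst hic
        have : (-(ν + δ) i).toNat = (-ν i).toNat + 1 := by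
          simp [hδ, hij]; omega
        rw [this]; simp [hij]; ring
      · simp [hδ, hij, hic]
  have he' : ∑ i ∈ Finset.range n, w' i * (-ν i).toNat =
      ∑ i ∈ Finset.range n, w i * (-ν i).toNat + (-ν j).toNat := by
    have h1 : (-ν j).toNat = ∑ i ∈ Finset.range n, if i = j then (-ν j).toNat else 0 := by simp [hj]
    rw [h1, ← Finset.sum_add_distrib]
    refine Finset.sum_congr rfl fun i _ => ?_
    by_cases hij : i = j
    · subst hij; simp [hw']; ring
    · simp [hw', hij]
  have hval : ∀ (v : ℕ → ℕ) (μ : ℕ → ℤ), lin (weight n v) (AddMonoidAlgebra.single μ 1) =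
      weight n v μ := fun v μ => by rw [lin_single, one_smul]
  have hmulr : (AddMonoidAlgebra.single ν 1 : Lau) * lauRatio j c =
      AddMonoidAlgebra.single (ν + δ) 1 := by
    rw [lauRatio, AddMonoidAlgebra.single_mul_single, one_mul]
  simp only [θ, φ, ψ, AddMonoidHom.sub_apply, AddMonoidHom.comp_apply,
    AddMonoidHom.coe_mulRight, AddMonoidHom.coe_mulLeft, hmulr, hval]
  have hδj : (ν + δ) j = ν j + 1 := by simp [hδ, hjc]
  have hδc : (ν + δ) c = ν c - 1 := by simp [hδ, hjc.symm]; ring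
  have hδi : ∀ i, i ≠ j → i ≠ c → (ν + δ) i = ν i := fun i h1 h2 => by simp [hδ, h1, h2]
  by_cases hall : ∀ i, ν i ≤ 0
  · rcases (hall j).lt_or_eq with hνj | hνj
    · have hall' : ∀ i, (ν + δ) i ≤ 0 := by
        intro i
        by_cases h1 : i = j
        · rw [h1, hδj]; omega
        · by_cases h2 : i = c
          · rw [h2, hδc]; omega
          · rw [hδi i h1 h2]; exact hall i
      have e1 := he w hνj
      have e2 := he w' hνj
      have e3 : w' j = w' c + 1 := by simp [hw', hjc.symm, hw]
      simp only [weight, if_pos hall, if_pos hall']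
      rw [show ∑ i ∈ Finset.range n, w i * (-(ν + δ) i).toNat =
        ∑ i ∈ Finset.range n, w i * (-ν i).toNat by omega,
        show ∑ i ∈ Finset.range n, w' i * (-ν i).toNat =
        ∑ i ∈ Finset.range n, w' i * (-(ν + δ) i).toNat + 1 by omega]
      ring
    · have hall' : ¬ ∀ i, (ν + δ) i ≤ 0 := fun h => by have := h j; rw [hδj] at this; omega
      simp only [weight, if_pos hall, if_neg hall']
      rw [he', hνj]
      simp
  · have hall' : ¬ ∀ i, (ν + δ) i ≤ 0 := by
      obtain ⟨i, hi⟩ := not_forall.1 hall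
      intro h
      by_cases h1 : i = j
      · have := h j; rw [hδj] at this; rw [h1] at hi; omega
      · by_cases h2 : i = c
        · rw [h2] at hi; exact hi hνc
        · have := h i; rw [hδi i h1 h2] at this; exact hi this
    simp only [weight, if_neg hall, if_neg hall']
    ring

lemma weightSum_prod_hlFactor {n c : ℕ} (hc : c < n) {G : Ser} (hG : SuppIn {ν | ν c ≤ 0} G) :
    ∀ (b : ℕ), b ≤ c → ∀ w : ℕ → ℕ, (∀ j < b, w j = w c) →
    weightSum n w (G * ∏ j ∈ Finset.range b, hlFactor j c) =
      weightSum n (fun i => if i < b then w i + 1 else w i) G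
  | 0, _, w, _ => by simp
  | b + 1, hb, w, hw => by
    have hP : ∏ j ∈ Finset.range b, hlFactor j c ∈ suppSubring (coordNonpos c) := by
      refine prod_mem fun j hj => hlFactor_mem_suppSubring ?_
      have : c ≠ j := by have := Finset.mem_range.1 hj; omega
      rw [mem_coordNonpos]
      simp [this]
    rw [Finset.prod_range_succ, ← mul_assoc,
      weightSum_hlFactor (by omega) hc (by omega) (hw b (by omega))
        (SuppIn.mul hG hP fun a ha b hb => (coordNonpos c).add_mem ha hb),
      weightSum_prod_hlFactor hc hG b (by omega) _ fun j hj => by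
        rw [Function.update_of_ne (by omega), Function.update_of_ne (by omega), hw j (by omega)]]
    congr 2
    funext i
    rcases lt_trichotomy i b with h | rfl | h
    · rw [if_pos h, if_pos (by omega), Function.update_of_ne h.ne]
    · simp
    · rw [if_neg (by omega), if_neg (by omega), Function.update_of_ne h.ne']

/-- The factors are removed column by column, starting from the last variable: column c raises the
weight of every earlier variable by one. At `c = n` the weights of the n variables are 0, which is
the case of `hlFun`; at `c = 0` no factor is left. -/
lemma weightSum_mono_mul_hlDensity {n : ℕ} {ν : ℕ → ℤ} (hν : ∀ i, ν i ≤ 0) : ∀ c ≤ n,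
    weightSum n (fun i => if i < c then n - c else n - 1 - i) (mono ν * hlDensity c) =
      weight n (fun i => n - 1 - i) ν
  | 0, _ => by simp [hlDensity, weightSum_mono]
  | c + 1, hc => by
    have hD : hlDensity c ∈ suppSubring (coordNonpos c) := by
      refine prod_mem fun k hk => prod_mem fun j hj => hlFactor_mem_suppSubring ?_
      have h1 : c ≠ j := by simp at hj hk; omega
      have h2 : c ≠ k := by simp at hk; omega
      rw [mem_coordNonpos]
      simp [h1, h2]
    rw [hlDensity, Finset.prod_range_succ, ← hlDensity, ← mul_assoc,
      weightSum_prod_hlFactor (by omega) (SuppIn.mul (suppIn_mono (S := {ν | ν c ≤ 0}) (hν c)) hD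
        fun a ha b hb => (coordNonpos c).add_mem ha hb) c le_rfl _ fun j hj => by
          rw [if_pos (by omega), if_pos (by omega)],
      ← weightSum_mono_mul_hlDensity hν c (by omega)]
    congr 2
    funext i
    split_ifs <;> omega

lemma hlFun_mono {n : ℕ} {ν : ℕ → ℤ} (hν : ∀ i, ν i ≤ 0) :
    hlFun n (mono ν) = X ^ ∑ i ∈ Finset.range n, (n - 1 - i) * (-ν i).toNat := by
  have := weightSum_mono_mul_hlDensity hν n le_rfl
  rw [weight, if_pos hν] at this
  rw [← this, hlFun, nonposSum_eq_weightSum n]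
  ext k
  rw [weightSum, weightSum, coeff_qExt, coeff_qExt]
  refine Finset.sum_congr rfl fun p _ => ?_
  congr 3
  funext μ
  rw [weight, weight]
  congr 2
  refine Finset.sum_congr rfl fun i hi => ?_
  rw [if_pos (Finset.mem_range.1 hi), Nat.sub_self]

/-- In the density z_0 occurs only in numerators z_0/z_k, so its exponent cannot come down. -/
lemma hlFun_mono_eq_zero {n : ℕ} {ν : ℕ → ℤ} (hν : 0 < ν 0) : hlFun n (mono ν) = 0 := by
  have hD : hlDensity n ∈ suppSubring (coordNonneg 0) := by
    refine prod_mem fun k hk => prod_mem fun j hj => hlFactor_mem_suppSubring ?_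
    have h2 : k ≠ 0 := by simp at hj; omega
    change 0 ≤ (Pi.single j 1 - Pi.single k 1 : ℕ → ℤ) 0
    rcases eq_or_ne j 0 with rfl | h
    · simp [h2.symm]
    · simp [h2.symm, h.symm]
  rw [hlFun, nonposSum]
  refine coeffwise_eq_zero (SuppIn.mul (suppIn_mono (S := {ν}) rfl) hD
    (S'' := {ν | 0 < ν 0}) ?_) fun μ hμ => ?_
  · rintro a rfl b hb
    exact add_pos_of_pos_of_nonneg (α := ℤ) hν hb
  · rw [lin_single, one_smul, nonposInd, if_neg]
    intro h
    exact absurd (h 0) (not_le.2 hμ)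

/-! ### The pairing of the two families, evaluated on rows -/

/-- The interaction of two rows. -/
def rowPair (r s : ℤ × ℤ) : ℕ :=
  (min r.2 s.2 - max r.1 s.1).toNat + if r.1 < s.1 ∧ s.1 ≤ r.2 then 1 else 0

/-- The sum of the interactions of all pairs of rows. -/
def rowStat : List (ℤ × ℤ) → ℕ
  | [] => 0
  | r :: l => (l.map (rowPair r)).sum + rowStat l

/-- The generating monomial of a list of rows, zero if a row is reversed. -/
noncomputable def rowMono (l : List (ℤ × ℤ)) : PowerSeries ℤ :=
  if ∀ r ∈ l, r.1 ≤ r.2 then X ^ rowStat l else 0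

/-- The pairing of the two families of nonsymmetric polynomials at a list of rows. -/
noncomputable def rowPairing (l : List (ℤ × ℤ)) : PowerSeries ℤ :=
  hlFun l.length (nshl true (l.map Prod.fst) * nshl false (l.map fun r => -r.2))

lemma rowStat_append (l l' : List (ℤ × ℤ)) : rowStat (l ++ l') =
    rowStat l + rowStat l' + (l.map fun r => (l'.map (rowPair r)).sum).sum := by
  induction l with
  | nil => simp [rowStat]
  | cons r l ih =>
    simp only [List.cons_append, rowStat, List.map_append, List.sum_append, ih, List.map_cons,
      List.sum_cons]
    omega

lemma rowStat_mid (l r : List (ℤ × ℤ)) (A B : ℤ × ℤ) : rowStat (l ++ A :: B :: r) =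
    rowPair A B + (rowStat l + rowStat r + (l.map fun R => (r.map (rowPair R)).sum).sum +
      (l.map fun R => rowPair R A + rowPair R B).sum +
      (r.map fun R => rowPair A R + rowPair B R).sum) := by
  rw [rowStat_append]
  simp only [rowStat, List.map_cons, List.sum_cons, List.sum_map_add]
  omega

lemma rowStat_exchange (l r : List (ℤ × ℤ)) (A B : ℤ × ℤ) :
    rowStat (l ++ A :: B :: r) + rowPair B A = rowStat (l ++ B :: A :: r) + rowPair A B := by
  rw [rowStat_mid, rowStat_mid l r B A]
  simp only [add_comm (rowPair _ B), add_comm (rowPair B _)]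
  omega

/-- The two pairs of rows cover the same points with the same multiplicities, so a third row
interacts equally with both; only the mutual interaction changes. -/
lemma rowStat_cross {x x' y y' : ℤ} (h1 : x' ≤ x) (h2 : x ≤ y) (h3 : y ≤ y') (l r : List (ℤ × ℤ)) :
    rowStat (l ++ (x', y) :: (x, y') :: r) + rowPair (x, y) (x', y') =
      rowStat (l ++ (x, y) :: (x', y') :: r) + rowPair (x', y) (x, y') := by
  rw [rowStat_mid, rowStat_mid l r (x, y)]
  have e1 : ∀ R, rowPair R (x', y) + rowPair R (x, y') =
      rowPair R (x, y) + rowPair R (x', y') := by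
    intro R; simp only [rowPair]; split_ifs <;> omega
  have e2 : ∀ R, rowPair (x', y) R + rowPair (x, y') R =
      rowPair (x, y) R + rowPair (x', y') R := by
    intro R; simp only [rowPair]; split_ifs <;> omega
  simp only [e1, e2]
  omega

lemma forall_mid_iff {α : Type*} {P : α → Prop} {l r : List α} {A B : α} :
    (∀ R ∈ l ++ A :: B :: r, P R) ↔ (P A ∧ P B) ∧ ∀ R ∈ l ++ r, P R := by
  simp only [List.mem_append, List.mem_cons]
  constructor
  · intro h
    exact ⟨⟨h _ (by simp), h _ (by simp)⟩, fun R hR => h R (by tauto)⟩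
  · rintro ⟨⟨h1, h2⟩, h⟩ R (hR | rfl | rfl | hR)
    · exact h R (Or.inl hR)
    · exact h1
    · exact h2
    · exact h R (Or.inr hR)

/-- For `x ≤ y` the three statistics are k + 1, k and k, and the identity is q^(k+1) = q^k + (q - 1)
q^k. For `y < x` the last list has a reversed row and the other two terms agree. -/
lemma rowMono_swap_of_lt {x x' y y' : ℤ} (hx : x' < x) (hy : y < y') (l r : List (ℤ × ℤ)) :
    rowMono (l ++ (x', y) :: (x, y') :: r) = rowMono (l ++ (x, y') :: (x', y) :: r) +
      (X - 1) * rowMono (l ++ (x, y) :: (x', y') :: r) := by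
  simp only [rowMono, forall_mid_iff]
  by_cases h : ∀ R ∈ l ++ r, R.1 ≤ R.2
  · simp only [and_iff_left h]
    have e := rowStat_exchange l r (x', y) (x, y')
    by_cases h1 : x ≤ y
    · have e2 := rowStat_cross hx.le h1 hy.le l r
      have p1 : rowPair (x', y) (x, y') = (y - x).toNat + 1 := by
        simp only [rowPair]; split_ifs <;> omega
      have p2 : rowPair (x, y) (x', y') = (y - x).toNat := by
        simp only [rowPair]; split_ifs <;> omega
      have p3 : rowPair (x, y') (x', y) = (y - x).toNat := by
        simp only [rowPair]; split_ifs <;> omega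
      rw [if_pos ⟨by omega, by omega⟩, if_pos ⟨by omega, by omega⟩, if_pos ⟨by omega, by omega⟩,
        show rowStat (l ++ (x', y) :: (x, y') :: r) = rowStat (l ++ (x, y') :: (x', y) :: r) + 1 by
          omega,
        show rowStat (l ++ (x, y) :: (x', y') :: r) = rowStat (l ++ (x, y') :: (x', y) :: r) by
          omega]
      ring
    · have p1 : rowPair (x', y) (x, y') = 0 := by
        simp only [rowPair]; split_ifs <;> omega
      have p3 : rowPair (x, y') (x', y) = 0 := by
        simp only [rowPair]; split_ifs <;> omega
      rw [if_neg (c := x ≤ y ∧ x' ≤ y') (by omega), mul_zero, add_zero]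
      rw [show rowStat (l ++ (x', y) :: (x, y') :: r) = rowStat (l ++ (x, y') :: (x', y) :: r) by
          omega]
      by_cases h2 : x' ≤ y ∧ x ≤ y'
      · rw [if_pos h2, if_pos h2.symm]
      · rw [if_neg h2, if_neg (mt And.symm h2)]
  · rw [if_neg (fun h' => h h'.2), if_neg (fun h' => h h'.2), if_neg (fun h' => h h'.2), mul_zero,
      add_zero]

lemma rowMono_swap_of_le {x x' y y' : ℤ} (hx : x' < x) (hy : y' ≤ y) (l r : List (ℤ × ℤ)) :
    rowMono (l ++ (x', y) :: (x, y') :: r) = X * rowMono (l ++ (x, y') :: (x', y) :: r) := by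
  simp only [rowMono, forall_mid_iff]
  by_cases h : (∀ R ∈ l ++ r, R.1 ≤ R.2) ∧ x' ≤ y ∧ x ≤ y'
  · have e := rowStat_exchange l r (x', y) (x, y')
    have p1 : rowPair (x', y) (x, y') = (y' - x).toNat + 1 := by
      simp only [rowPair]; split_ifs <;> omega
    have p3 : rowPair (x, y') (x', y) = (y' - x).toNat := by
      simp only [rowPair]; split_ifs <;> omega
    rw [if_pos ⟨h.2, h.1⟩, if_pos ⟨h.2.symm, h.1⟩,
      show rowStat (l ++ (x', y) :: (x, y') :: r) = rowStat (l ++ (x, y') :: (x', y) :: r) + 1 by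
        omega]
    ring
  · rw [if_neg (by tauto), if_neg (by tauto), mul_zero]

/-- The comparison is made row by row: moving (x, y) from the front to the back and shifting it by
one changes its interaction with a row r by the difference of the indicators of x < r.1 and y < r.2,
which are what the two powers of q count. -/
lemma rowMono_rotate (x y : ℤ) (R : List (ℤ × ℤ)) :
    X ^ (R.map Prod.fst).countP (x < ·) * rowMono (R ++ [(x + 1, y + 1)]) =
      X ^ (R.map fun r => -r.2).countP (· < -y) * rowMono ((x, y) :: R) := by
  simp only [rowMono]
  by_cases h : x ≤ y ∧ ∀ r ∈ R, r.1 ≤ r.2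
  · rw [if_pos (by simpa [or_imp, forall_and, and_comm] using h),
      if_pos (by simpa [or_imp, forall_and, and_comm] using h), ← pow_add, ← pow_add, rowStat_append,
      rowStat, rowStat]
    congr 1
    simp only [List.map_cons, List.map_nil, List.sum_nil, List.sum_cons, rowStat]
    have key : ∀ R : List (ℤ × ℤ), (∀ r ∈ R, r.1 ≤ r.2) → (R.map Prod.fst).countP (x < ·) +
        (R.map fun r => rowPair r (x + 1, y + 1) + 0).sum =
        (R.map fun r => -r.2).countP (· < -y) + (R.map (rowPair (x, y))).sum := by
      intro R
      induction R with
      | nil => simp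
      | cons r R ih =>
        intro hR
        have h1 := ih fun s hs => hR s (by simp [hs])
        have h2 := hR r (by simp)
        have h3 := h.1
        simp only [List.map_cons, List.countP_cons, List.sum_cons, decide_eq_true_eq]
        have : (if x < r.1 then 1 else 0) + rowPair r (x + 1, y + 1) =
            (if -r.2 < -y then 1 else 0) + rowPair (x, y) r := by
          simp only [rowPair]; split_ifs <;> omega
        omega
    have := key R h.2
    omega
  · rw [if_neg (by simpa [or_imp, forall_and, and_comm] using h),
      if_neg (by simpa [or_imp, forall_and, and_comm] using h), mul_zero, mul_zero]

/-- The exchange of the left ends is T_i on the first polynomial. By self-adjointness it acts on the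
second as T̄_i + (q - 1), and T̄_i exchanges the right ends. -/
lemma rowPairing_swap_of_lt {x x' y y' : ℤ} (hx : x' < x) (hy : y < y') (l r : List (ℤ × ℤ)) :
    rowPairing (l ++ (x', y) :: (x, y') :: r) = rowPairing (l ++ (x, y') :: (x', y) :: r) +
      (X - 1) * rowPairing (l ++ (x, y) :: (x', y') :: r) := by
  have h1 := nshl_swap_of_lt true hx (l.map Prod.fst) (r.map Prod.fst)
  have h2 := nshl_swap_of_lt false (neg_lt_neg hy) (l.map fun r => -r.2) (r.map fun r => -r.2)
  simp only [rowPairing, List.map_append, List.map_cons, List.length_append, List.length_cons,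
    List.length_map] at h1 h2 ⊢
  rw [← h1, hlFun_hecke_mul (by omega), hecke_true, h2, mul_add, hlFun_add, sub_mul, one_mul, mul_sub,
    hlFun_sub, mul_left_comm, hlFun_X_mul]
  ring

/-- Now the second polynomial is itself T̄_i of the exchanged one, so T_i T̄_i = q gives a single
term. -/
lemma rowPairing_swap_of_le {x x' y y' : ℤ} (hx : x' < x) (hy : y' ≤ y) (l r : List (ℤ × ℤ)) :
    rowPairing (l ++ (x', y) :: (x, y') :: r) = X * rowPairing (l ++ (x, y') :: (x', y) :: r) := by
  have h1 := nshl_swap_of_lt true hx (l.map Prod.fst) (r.map Prod.fst)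
  have h2 := nshl_swap (b := false) (Or.inr ⟨rfl, neg_le_neg hy⟩) (l.map fun r => -r.2)
    (r.map fun r => -r.2)
  simp only [rowPairing, List.map_append, List.map_cons, List.length_append, List.length_cons,
    List.length_map] at h1 h2 ⊢
  rw [← h1, hlFun_hecke_mul (by omega), ← h2, hecke_true_false, mul_left_comm, hlFun_X_mul]

/-- The two rotation formulas are joined by the adjointness of `heckeDown` and `heckeUp`. -/
lemma rowPairing_rotate (x y : ℤ) (R : List (ℤ × ℤ)) :
    X ^ (R.map Prod.fst).countP (x < ·) * rowPairing (R ++ [(x + 1, y + 1)]) =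
      X ^ (R.map fun r => -r.2).countP (· < -y) * rowPairing ((x, y) :: R) := by
  have h1 := heckeDown_zi_mul_nshl x (R.map Prod.fst)
  have h2 := zi_mul_heckeUp_nshl (-y) (R.map fun r => -r.2)
  simp only [rowPairing, List.map_append, List.map_cons, List.length_append, List.length_cons,
    List.length_map, List.map_nil, List.length_nil] at h1 h2 ⊢
  rw [← hlFun_X_pow_mul, ← mul_assoc, ← h1, hlFun_heckeDown_mul _ _ _ _ _ (by omega), mul_right_comm,
    mul_assoc, mul_left_comm (zi 0), ← hlFun_X_pow_mul,
    mul_left_comm (X ^ _), ← h2, neg_add', mul_left_comm (heckeUp _ _ _ _),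
    mul_left_comm (nshl true _) (zi 0), mul_comm (nshl true _)]

/-- The evaluation of the pairing for all rows with prescribed left ends. -/
def PairingEval (α : List ℤ) : Prop :=
  ∀ R : List (ℤ × ℤ), R.map Prod.fst = α → rowPairing R = rowMono R

lemma map_fst_eq_mid {R : List (ℤ × ℤ)} {l r : List ℤ} {a b : ℤ}
    (h : R.map Prod.fst = l ++ a :: b :: r) : ∃ l' r' u v,
      R = l' ++ (a, u) :: (b, v) :: r' ∧ l'.map Prod.fst = l ∧ r'.map Prod.fst = r := by
  obtain ⟨l', t, rfl, hl, ht⟩ := List.map_eq_append_iff.1 h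
  obtain ⟨A, t, rfl, hA, ht⟩ := List.map_eq_cons_iff.1 ht
  obtain ⟨B, r', rfl, hB, hr⟩ := List.map_eq_cons_iff.1 ht
  exact ⟨l', r', A.2, B.2, by rw [← hA, ← hB], hl, hr⟩

/-- The recurrences determine the pairing in either direction. For `b < a` they apply as they stand;
for `a < b` the case of right ends `u ≤ v` is obtained by cancelling q, and it then yields the
remaining case by subtraction. -/
lemma PairingEval.swap {l r : List ℤ} {a b : ℤ} (h : PairingEval (l ++ a :: b :: r)) :
    PairingEval (l ++ b :: a :: r) := by
  intro R hR
  obtain ⟨l', r', u, v, rfl, rfl, rfl⟩ := map_fst_eq_mid hR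
  have h' : ∀ u v, rowPairing (l' ++ (a, u) :: (b, v) :: r') =
      rowMono (l' ++ (a, u) :: (b, v) :: r') := fun u v => h _ (by simp)
  rcases lt_trichotomy b a with hab | rfl | hab
  · rcases lt_or_ge u v with huv | huv
    · rw [rowPairing_swap_of_lt hab huv, rowMono_swap_of_lt hab huv, h', h']
    · rw [rowPairing_swap_of_le hab huv, rowMono_swap_of_le hab huv, h']
  · exact h' u v
  · have h1 : ∀ u v, u ≤ v → rowPairing (l' ++ (b, u) :: (a, v) :: r') =
        rowMono (l' ++ (b, u) :: (a, v) :: r') := by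
      intro u v huv
      have e1 := rowPairing_swap_of_le hab huv l' r'
      rw [h', rowMono_swap_of_le hab huv] at e1
      exact (mul_left_cancel₀ PowerSeries.X_ne_zero e1).symm
    rcases le_or_gt u v with huv | huv
    · exact h1 u v huv
    · have e1 := rowPairing_swap_of_lt hab huv l' r'
      rw [h', rowMono_swap_of_lt hab huv, h1 _ _ huv.le] at e1
      exact (add_right_cancel e1).symm

lemma perm_induction {α : Type*} {Q : List α → Prop}
    (hQ : ∀ l x y r, Q (l ++ x :: y :: r) → Q (l ++ y :: x :: r)) {l l' : List α}
    (h : l.Perm l') (hl : Q l) : Q l' := by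
  have : ∀ p, Q (p ++ l) → Q (p ++ l') := by
    clear hl
    induction h with
    | nil => exact fun p h => h
    | cons x _ ih => intro p h; simpa using ih (p ++ [x]) (by simpa using h)
    | swap x y l => intro p h; exact hQ p y x l h
    | trans _ _ ih1 ih2 => exact fun p h => ih2 p (ih1 p h)
  exact this [] hl

lemma PairingEval.perm {α α' : List ℤ} (h : α.Perm α') (hα : PairingEval α) : PairingEval α' :=
  perm_induction (fun _ _ _ _ => PairingEval.swap) h hα

lemma PairingEval.rotate {x : ℤ} {r : List ℤ} (h : PairingEval (x :: r)) :
    PairingEval (r ++ [x + 1]) := by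
  intro R hR
  obtain ⟨R, t, rfl, rfl, ht⟩ := List.map_eq_append_iff.1 hR
  obtain ⟨⟨A, y⟩, t, rfl, hA, ht⟩ := List.map_eq_cons_iff.1 ht
  obtain rfl := List.map_eq_nil_iff.1 ht
  obtain rfl : A = x + 1 := hA
  have e := rowPairing_rotate x (y - 1) R
  rw [h ((x, y - 1) :: R) rfl, ← rowMono_rotate, sub_add_cancel] at e
  exact mul_left_cancel₀ (pow_ne_zero _ PowerSeries.X_ne_zero) e

lemma PairingEval.unrotate {x : ℤ} {r : List ℤ} (h : PairingEval (r ++ [x + 1])) :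
    PairingEval (x :: r) := by
  intro R hR
  obtain ⟨⟨A, y⟩, R, rfl, hA, rfl⟩ := List.map_eq_cons_iff.1 hR
  obtain rfl : A = x := hA
  have e := rowPairing_rotate A y R
  rw [h _ (by simp), rowMono_rotate] at e
  exact (mul_left_cancel₀ (pow_ne_zero _ PowerSeries.X_ne_zero) e).symm

lemma hlFun_nshl_false (l : List ℤ) :
    hlFun l.length (nshl false l) = hlFun l.length (mono (listExpo (sortDesc l))) := by
  induction l using list_swap_induction with
  | hs l hl => rw [nshl_of_pairwise false hl, sortDesc_of_pairwise hl]
  | hQ l c d s hdc h =>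
    have hp : (l ++ c :: d :: s).Perm (l ++ d :: c :: s) :=
      (List.Perm.swap d c s).append_left l
    rw [← nshl_swap_of_lt false hdc, hlFun_hecke_false (by simp), ← hp.length_eq, h,
      sortDesc_eq_of_perm hp]

lemma rowStat_zero_perm {β β' : List ℤ} (h : β.Perm β') :
    rowStat (β.map fun y => (0, y)) = rowStat (β'.map fun y => (0, y)) := by
  refine perm_induction (Q := fun γ => rowStat (β.map fun y => (0, y)) =
    rowStat (γ.map fun y => ((0 : ℤ), y))) ?_ h rfl
  intro l x y r e
  simp only [List.map_append, List.map_cons] at e ⊢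
  have e1 := rowStat_exchange (l.map fun y => ((0 : ℤ), y)) (r.map fun y => (0, y)) (0, x) (0, y)
  have e2 : rowPair (0, x) (0, y) = rowPair (0, y) (0, x) := by simp [rowPair, min_comm]
  rw [e]
  omega

/-- Two rows starting at 0 interact by the smaller of their lengths. As `v` decreases the lengths
increase, so row i is the shorter one in its interaction with each of the later rows. -/
lemma rowStat_zero_sorted : ∀ {v : List ℤ}, v.Pairwise (· ≥ ·) → (∀ z ∈ v, z ≤ 0) →
    ∑ i ∈ Finset.range v.length, (v.length - 1 - i) * (-listExpo v i).toNat =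
      rowStat (v.map fun z => ((0 : ℤ), -z))
  | [], _, _ => by simp [rowStat]
  | z :: v, h, h0 => by
    rw [List.pairwise_cons] at h
    have ih := rowStat_zero_sorted h.2 fun w hw => h0 w (by simp [hw])
    rw [List.length_cons, Finset.sum_range_succ', List.map_cons, rowStat, ← ih]
    have e : ∀ v' : List ℤ, (∀ w ∈ v', z ≥ w) → ((v'.map fun z => ((0 : ℤ), -z)).map
        (rowPair (0, -z))).sum = v'.length * (-z).toNat := by
      intro v'
      induction v' with
      | nil => simp
      | cons w v' ih =>
        intro hw
        have h1 := ih fun u hu => hw u (by simp [hu])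
        have h2 := hw w (by simp)
        have h3 : rowPair (0, -z) (0, -w) = (-z).toNat := by
          simp only [rowPair]; split_ifs <;> omega
        simp only [List.map_cons, List.sum_cons, h1, h3, List.length_cons]
        ring
    rw [e v h.1, add_comm]
    congr 1
    refine Finset.sum_congr rfl fun i hi => ?_
    have : i < v.length := Finset.mem_range.1 hi
    congr 1
    omega

/-- With all left ends 0 the first polynomial is 1, the operators in the second are invisible to the
functional, and what remains is the value on a sorted monomial. If some right end is negative, the
leading exponent of that monomial is positive and the value is 0. -/
lemma pairingEval_replicate (n : ℕ) : PairingEval (List.replicate n 0) := by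
  intro R hR
  obtain ⟨v, rfl, rfl⟩ : ∃ v : List ℤ, R = v.map (fun z => ((0 : ℤ), -z)) ∧ v.length = n := by
    refine ⟨R.map fun r => -r.2, ?_, ?_⟩
    · rw [List.map_map]
      conv_lhs => rw [← List.map_id R]
      refine List.map_congr_left fun r hr => ?_
      have : r.1 ∈ List.replicate n (0 : ℤ) := hR ▸ List.mem_map_of_mem hr
      have := List.eq_of_mem_replicate this
      simp [← this]
    · have := congrArg List.length hR
      simpa using this
  have h1 : rowPairing (v.map fun z => ((0 : ℤ), -z)) =
      hlFun v.length (mono (listExpo (sortDesc v))) := by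
    rw [rowPairing, hR, nshl_of_pairwise true (List.pairwise_replicate.2 (Or.inr le_rfl)),
      List.length_map, List.map_map]
    have e1 : listExpo (List.replicate v.length 0) = 0 := by
      funext i
      simp [listExpo]
    have e2 : ((fun r : ℤ × ℤ => -r.2) ∘ fun z : ℤ => ((0 : ℤ), -z)) = id := by
      funext z; simp
    rw [e1, mono_zero, one_mul, e2, List.map_id, hlFun_nshl_false]
  have hperm := sortDesc_perm v
  have hlen := hperm.length_eq
  rw [h1, rowMono]
  by_cases h : ∀ z ∈ v, z ≤ 0
  · rw [if_pos (by simpa using h)]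
    have hs : ∀ z ∈ sortDesc v, z ≤ 0 := fun z hz => h z (hperm.mem_iff.1 hz)
    have e1 := rowStat_zero_sorted (sortDesc_pairwise v) hs
    have e2 := rowStat_zero_perm (hperm.map fun z => -z)
    simp only [List.map_map] at e2
    rw [hlFun_mono, ← hlen, e1]
    · congr 1
    · intro i
      rw [listExpo]
      rcases lt_or_ge i (sortDesc v).length with hi | hi
      · rw [List.getD_eq_getElem _ _ hi]; exact hs _ (List.getElem_mem hi)
      · rw [List.getD_eq_default _ _ hi]
  · rw [if_neg (by simpa using h), hlFun_mono_eq_zero]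
    push Not at h
    obtain ⟨z, hz, hz0⟩ := h
    have hz' := hperm.mem_iff.2 hz
    have hs := sortDesc_pairwise v
    rcases hv : sortDesc v with _ | ⟨w, t⟩
    · rw [hv] at hz'; simp at hz'
    · rw [hv] at hz' hs
      rw [List.pairwise_cons] at hs
      simp only [listExpo, List.getD_cons_zero]
      rcases List.mem_cons.1 hz' with rfl | h'
      · exact hz0
      · exact hz0.trans_le (hs.1 z h')

/-- Induction on the sum of the absolute values of the left ends: a nonzero entry is permuted to one
end and rotated one step towards 0. -/
lemma pairingEval (α : List ℤ) : PairingEval α := by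
  obtain ⟨n, hn⟩ : ∃ n, n = (α.map Int.natAbs).sum := ⟨_, rfl⟩
  induction n using Nat.strong_induction_on generalizing α with
  | _ n ih =>
  by_cases h : ∀ z ∈ α, z = 0
  · rw [List.eq_replicate_of_mem h]
    exact pairingEval_replicate _
  · push Not at h
    obtain ⟨z, hz, hz0⟩ := h
    have hp := List.perm_cons_erase hz
    have hs := (hp.map Int.natAbs).sum_eq
    rw [List.map_cons, List.sum_cons] at hs
    rcases lt_or_gt_of_ne hz0 with hz0 | hz0
    · refine PairingEval.perm hp.symm (PairingEval.unrotate (ih _ ?_ _ rfl))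
      simp only [List.map_append, List.sum_append, List.map_cons, List.map_nil, List.sum_cons,
        List.sum_nil]
      omega
    · have := ih _ (?_ : (((z - 1) :: α.erase z).map Int.natAbs).sum < n) _ rfl
      · have := this.rotate
        rw [sub_add_cancel] at this
        exact this.perm ((List.perm_append_singleton z _).trans hp.symm)
      · simp only [List.map_cons, List.sum_cons]
        omega

/-- The Hall–Littlewood pairing of the two families of nonsymmetric polynomials. -/
theorem rowPairing_eq (R : List (ℤ × ℤ)) : rowPairing R = rowMono R := pairingEval _ R rfl

/-! ### Padding by zeros, translation, and supports of the polynomials -/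

/-- The shift of exponents by `k` variables. -/
def shiftExpo (k : ℕ) : (ℕ → ℤ) →+ (ℕ → ℤ) where
  toFun ν i := if k ≤ i then ν (i - k) else 0
  map_zero' := by ext i; simp
  map_add' ν μ := by ext i; simp only [Pi.add_apply]; split_ifs <;> simp

lemma shiftExpo_apply (k : ℕ) (ν : ℕ → ℤ) (i : ℕ) :
    shiftExpo k ν i = if k ≤ i then ν (i - k) else 0 := rfl

lemma shiftExpo_single (k i : ℕ) (c : ℤ) : shiftExpo k (Pi.single i c) = Pi.single (k + i) c := by
  ext j
  simp only [shiftExpo_apply, Pi.single_apply]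
  split_ifs <;> first | rfl | omega

/-- The substitution `z_i ↦ z_{k + i}`. -/
noncomputable def shiftVar (k : ℕ) : Ser →+* Ser := reindex (shiftExpo k)

lemma shiftVar_zi (k i : ℕ) : shiftVar k (zi i) = zi (k + i) := by
  rw [shiftVar, zi, reindex_mono, shiftExpo_single, zi]

lemma swapVar_shiftVar (k i : ℕ) (f : Ser) :
    swapVar (k + i) (shiftVar k f) = shiftVar k (swapVar i f) := by
  simp only [swapVar, shiftVar, reindex_comp]
  congr 2
  ext ν j
  simp only [AddMonoidHom.comp_apply, permExpo_apply, shiftExpo_apply, Equiv.swap_apply_def]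
  split_ifs <;> first | rfl | omega | (congr 1; omega)

lemma hecke_shiftVar (b : Bool) (k i : ℕ) (f : Ser) :
    hecke b (k + i) (shiftVar k f) = shiftVar k (hecke b i f) := by
  apply hecke_unique
  have h := congrArg (shiftVar k) (hecke_spec b i f)
  have hX : shiftVar k X = X := reindex_X _
  have hp : shiftVar k (pivot b i) = pivot b (k + i) := by
    cases b
    · exact shiftVar_zi k i
    · exact shiftVar_zi k (i + 1)
  rw [map_mul, map_add, map_mul, map_mul, map_mul, map_sub, map_sub, map_sub, map_mul, map_one, hX,
    hp, shiftVar_zi, shiftVar_zi, ← swapVar_shiftVar] at h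
  exact h

/-- A final 0 below all other entries stays last under sorting, so the same exchanges build both
polynomials. Together with `nshl_cons_zero` this lifts the two families from n to n + 1 variables,
offset by one place. -/
lemma nshl_append_zero (b : Bool) {l : List ℤ} (h : ∀ z ∈ l, 0 ≤ z) :
    nshl b (l ++ [0]) = nshl b l := by
  induction l using list_swap_induction with
  | hs l hl =>
    rw [nshl_of_pairwise b hl, nshl_of_pairwise b (by
      rw [List.pairwise_append]
      exact ⟨hl, List.pairwise_singleton _ _, by simpa using h⟩)]
    congr 1
    funext i
    simp only [listExpo]
    rcases lt_or_ge i l.length with hi | hi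
    · rw [List.getD_append _ _ _ _ hi]
    · rw [List.getD_append_right _ _ _ _ hi, List.getD_eq_default l _ hi]
      rcases i - l.length with _ | j <;> simp
  | hQ l x y r hxy ih =>
    have := ih fun z hz => h z (by
      simp only [List.mem_append, List.mem_cons] at hz ⊢; tauto)
    rw [← nshl_swap_of_lt b hxy, ← this]
    simp only [List.append_assoc, List.cons_append]
    rw [nshl_swap_of_lt b hxy]

lemma nshl_cons_zero (b : Bool) {l : List ℤ} (h : ∀ z ∈ l, z ≤ 0) :
    nshl b (0 :: l) = shiftVar 1 (nshl b l) := by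
  induction l using list_swap_induction with
  | hs l hl =>
    rw [nshl_of_pairwise b hl, nshl_of_pairwise b (by
      rw [List.pairwise_cons]
      exact ⟨by simpa using h, hl⟩), shiftVar, reindex_mono]
    congr 1
    funext i
    simp only [listExpo, shiftExpo_apply]
    rcases i with _ | i <;> simp
  | hQ l x y r hxy ih =>
    have h1 := ih fun z hz => h z (by
      simp only [List.mem_append, List.mem_cons] at hz ⊢; tauto)
    rw [← nshl_swap_of_lt b hxy, ← hecke_shiftVar, ← h1]
    have := nshl_swap_of_lt b hxy (0 :: l) r
    rw [List.length_cons, add_comm] at this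
    simpa using this.symm

/-- The exponent with the entry `k` in the first `n` coordinates. -/
def constExpo (n : ℕ) (k : ℤ) : ℕ → ℤ := fun i => if i < n then k else 0

lemma nshl_map_add (b : Bool) (k : ℤ) (l : List ℤ) :
    nshl b (l.map (· + k)) = mono (constExpo l.length k) * nshl b l := by
  induction l using list_swap_induction with
  | hs l hl =>
    rw [nshl_of_pairwise b hl, nshl_of_pairwise b (hl.map _ fun a b h => by simpa using h),
      ← mono_add]
    congr 1
    funext i
    simp only [listExpo, constExpo, Pi.add_apply]
    rcases lt_or_ge i l.length with hi | hi
    · simp [hi, add_comm]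
    · simp [not_lt.2 hi]
  | hQ l x y r hxy ih =>
    have hlen : (l ++ y :: x :: r).length = (l ++ x :: y :: r).length := by simp
    have h1 := nshl_swap_of_lt b (add_lt_add_left hxy k) (l.map (· + k)) (r.map (· + k))
    simp only [List.map_append, List.map_cons, List.length_map] at h1 ih ⊢
    rw [← h1, ih, hlen, hecke_mul_left, nshl_swap_of_lt b hxy]
    rw [swapVar_mono]
    congr 1
    funext i
    simp only [constExpo, Equiv.swap_apply_def, List.length_append, List.length_cons]
    split_ifs <;> first | rfl | omega

/-- Sets of exponents that are stable under the operators `hecke b i` in `n` variables. -/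
def HeckeClosed (n : ℕ) (S : Set (ℕ → ℤ)) : Prop :=
  ∀ i, i + 1 < n → ∀ ν ∈ S, ∀ μ : ℕ → ℤ, (∀ k, k ≠ i → k ≠ i + 1 → μ k = ν k) →
    μ i + μ (i + 1) = ν i + ν (i + 1) → min (ν i) (ν (i + 1)) ≤ μ i →
    min (ν i) (ν (i + 1)) ≤ μ (i + 1) → μ ∈ S

lemma lau_lin_coeff_ne_zero {φ : (ℕ → ℤ) → Lau} {f : Lau} {μ : ℕ → ℤ}
    (h : (lin φ f).coeff μ ≠ 0) : ∃ ν, f.coeff ν ≠ 0 ∧ (φ ν).coeff μ ≠ 0 := by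
  by_contra hc
  push Not at hc
  refine h ?_
  let ev : Lau →+ ℤ := (Finsupp.applyAddHom μ).comp
    (AddMonoidAlgebra.coeffAddEquiv (R := ℤ) (M := ℕ → ℤ)).toAddMonoidHom
  refine lau_hom_eq_zero (ev.comp (lin φ)) f fun ν hν => ?_
  rw [AddMonoidHom.comp_apply, lin_single, one_smul]
  exact hc ν hν

lemma divDiffMono_coeff_ne_zero {i : ℕ} {ν μ : ℕ → ℤ} (h : (divDiffMono i ν).coeff μ ≠ 0) :
    (∀ k, k ≠ i → k ≠ i + 1 → μ k = ν k) ∧ μ i + μ (i + 1) + 1 = ν i + ν (i + 1) ∧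
      min (ν i) (ν (i + 1)) ≤ μ i ∧ min (ν i) (ν (i + 1)) ≤ μ (i + 1) := by
  classical
  rw [divDiffMono, AddMonoidAlgebra.coeff_sub, Finsupp.sub_apply] at h
  have : (∃ k ∈ Finset.range (ν i - ν (i + 1)).toNat,
      ν + Pi.single i (-(k : ℤ) - 1) + Pi.single (i + 1) (k : ℤ) = μ) ∨
      ∃ k ∈ Finset.range (ν (i + 1) - ν i).toNat,
      ν + Pi.single i (k : ℤ) + Pi.single (i + 1) (-(k : ℤ) - 1) = μ := by
    by_contra hc
    push Not at hc
    refine h ?_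
    rw [AddMonoidAlgebra.coeff_sum, AddMonoidAlgebra.coeff_sum, Finsupp.finsetSum_apply,
      Finsupp.finsetSum_apply, Finset.sum_eq_zero, Finset.sum_eq_zero, sub_zero]
    · intro k hk
      rw [AddMonoidAlgebra.coeff_single, Finsupp.single_apply, if_neg (hc.2 k hk)]
    · intro k hk
      rw [AddMonoidAlgebra.coeff_single, Finsupp.single_apply, if_neg (hc.1 k hk)]
  rcases this with ⟨k, hk, rfl⟩ | ⟨k, hk, rfl⟩ <;> rw [Finset.mem_range] at hk <;>
  refine ⟨fun j h1 h2 => by simp [h1, h2], ?_, ?_, ?_⟩ <;> simp <;> omega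

/-- Both s_i and z_{i+1} times the divided difference replace a pair of neighbouring exponents by
pairs with the same sum and with no entry below the smaller one; these are the moves allowed by
`HeckeClosed`. -/
lemma suppIn_hecke {n : ℕ} {S : Set (ℕ → ℤ)} (hS : HeckeClosed n S) {b : Bool} {i : ℕ}
    (hi : i + 1 < n) {f : Ser} (hf : SuppIn S f) : SuppIn S (hecke b i f) := by
  have h1 : SuppIn S (swapVar i f) := by
    intro k μ hμ
    rw [swapVar, reindex, coeff_map, AddMonoidAlgebra.mapDomainRingHom_apply] at hμ
    have hinj : Function.Injective (permExpo (Equiv.swap i (i + 1))) := by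
      intro a b hab
      funext j
      have := congrFun hab (Equiv.swap i (i + 1) j)
      simpa using this
    obtain ⟨ν, rfl⟩ : ∃ ν, permExpo (Equiv.swap i (i + 1)) ν = μ :=
      ⟨permExpo (Equiv.swap i (i + 1)) μ, by ext; simp⟩
    have hν : (coeff k f).coeff ν ≠ 0 := by
      intro h0
      refine hμ ?_
      rw [AddMonoidAlgebra.coeff_mapDomain]
      erw [Finsupp.mapDomain_apply hinj]
      exact h0
    have := hf k ν hν
    refine hS i hi ν this _ (fun j h1 h2 => ?_) ?_ ?_ ?_
    · simp [Equiv.swap_apply_of_ne_of_ne h1 h2]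
    · simp [add_comm]
    · simp
    · simp
  have h2 : SuppIn S (zi (i + 1) * divDiff i f) := by
    intro k μ hμ
    rw [zi, mono, coeff_C_mul, divDiff, coeff_coeffwise] at hμ
    obtain ⟨a, c, ha, hc, rfl⟩ := lau_coeff_mul_ne_zero hμ
    obtain ⟨ν, hν, hc⟩ := lau_lin_coeff_ne_zero hc
    have ha' : a = Pi.single (i + 1) 1 := by
      classical
      by_contra hne
      rw [AddMonoidAlgebra.coeff_single, Finsupp.single_apply, if_neg (Ne.symm hne)] at ha
      exact ha rfl
    obtain ⟨h1, h2, h3, h4⟩ := divDiffMono_coeff_ne_zero hc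
    subst ha'
    refine hS i hi ν (hf k ν hν) _ (fun j e1 e2 => ?_) ?_ ?_ ?_
    · simp [e2, h1 j e1 e2]
    · simp; omega
    · simp; omega
    · simp; omega
  rw [hecke]
  simp only [AddMonoidHom.sub_apply, AddMonoidHom.comp_apply, AddMonoidHom.coe_mulLeft,
    AddMonoidHom.add_apply]
  have h3 : SuppIn S ((bif b then (0 : Ser →+ Ser) else AddMonoidHom.id Ser) f) := by
    cases b
    · exact hf
    · intro k ν h; simp at h
  refine SuppIn.sub h1.X_mul ?_
  rw [sub_mul, one_mul]
  exact SuppIn.sub (h2.add h3).X_mul (h2.add h3)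

lemma suppIn_nshl {l : List ℤ} {S : Set (ℕ → ℤ)} (hS : HeckeClosed l.length S)
    (h : listExpo (sortDesc l) ∈ S) (b : Bool) : SuppIn S (nshl b l) := by
  induction l using list_swap_induction with
  | hs l hl => rw [nshl_of_pairwise b hl, ← sortDesc_of_pairwise hl]; exact suppIn_mono h
  | hQ l x y r hxy ih =>
    have hp : (l ++ y :: x :: r).Perm (l ++ x :: y :: r) :=
      (List.Perm.swap x y r).append_left l
    rw [← nshl_swap_of_lt b hxy]
    refine suppIn_hecke (n := (l ++ y :: x :: r).length) hS (by simp) (ih ?_ ?_)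
    · rwa [← hp.length_eq]
    · rwa [← sortDesc_eq_of_perm hp]

/-- The exponents in `n` variables with entries between `lo` and `hi` and total degree `D`. -/
def expoBox (n : ℕ) (lo hi D : ℤ) : Set (ℕ → ℤ) :=
  {ν | (∀ i < n, lo ≤ ν i ∧ ν i ≤ hi) ∧ (∀ i, n ≤ i → ν i = 0) ∧ ∑ i ∈ Finset.range n, ν i = D}

lemma sum_range_pair {n i : ℕ} (hi : i + 1 < n) (ν μ : ℕ → ℤ)
    (h : ∀ k, k ≠ i → k ≠ i + 1 → μ k = ν k) (h' : μ i + μ (i + 1) = ν i + ν (i + 1)) :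
    ∑ k ∈ Finset.range n, μ k = ∑ k ∈ Finset.range n, ν k := by
  have h1 : ∀ f : ℕ → ℤ, ∑ k ∈ Finset.range n, f k =
      f i + (f (i + 1) + ∑ k ∈ ((Finset.range n).erase i).erase (i + 1), f k) := by
    intro f
    rw [Finset.add_sum_erase _ _ (by simp; omega), Finset.add_sum_erase _ _ (by simp; omega)]
  rw [h1, h1 ν, ← add_assoc, ← add_assoc, h']
  congr 1
  refine Finset.sum_congr rfl fun k hk => ?_
  simp only [Finset.mem_erase] at hk
  exact h k hk.2.1 hk.1

lemma heckeClosed_expoBox (n : ℕ) (lo hi D : ℤ) : HeckeClosed n (expoBox n lo hi D) := by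
  rintro i hi' ν ⟨h1, h2, h3⟩ μ hμ hs hm1 hm2
  have e1 := h1 i (by omega)
  have e2 := h1 (i + 1) hi'
  refine ⟨fun k hk => ?_, fun k hk => ?_, ?_⟩
  · by_cases hki : k = i
    · subst hki; omega
    · by_cases hki' : k = i + 1
      · subst hki'; omega
      · rw [hμ k hki hki']; exact h1 k hk
  · rw [hμ k (by omega) (by omega)]; exact h2 k hk
  · rw [← h3]; exact sum_range_pair hi' ν μ hμ hs

lemma listExpo_mem_expoBox {l : List ℤ} {lo hi : ℤ} (h : ∀ z ∈ l, lo ≤ z ∧ z ≤ hi) :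
    listExpo l ∈ expoBox l.length lo hi l.sum := by
  refine ⟨fun i hi => ?_, fun i hi => ?_, ?_⟩
  · rw [listExpo, List.getD_eq_getElem _ _ hi]
    exact h _ (List.getElem_mem hi)
  · rw [listExpo, List.getD_eq_default _ _ hi]
  · clear h
    induction l with
    | nil => simp
    | cons z l ih =>
      rw [List.length_cons, Finset.sum_range_succ', List.sum_cons, ← ih, add_comm]
      rfl

lemma suppIn_nshl_expoBox {l : List ℤ} {lo hi : ℤ} (h : ∀ z ∈ l, lo ≤ z ∧ z ≤ hi) (b : Bool) :
    SuppIn (expoBox l.length lo hi l.sum) (nshl b l) := by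
  have hp := sortDesc_perm l
  refine suppIn_nshl (heckeClosed_expoBox _ _ _ _) ?_ b
  have := listExpo_mem_expoBox (l := sortDesc l) (lo := lo) (hi := hi)
    fun z hz => h z (hp.mem_iff.1 hz)
  rwa [hp.length_eq, hp.sum_eq] at this

lemma heckeDown_true_zi_mul : ∀ (k o : ℕ) (f : Ser),
    heckeDown true o k (zi o * f) = zi (o + k) * heckeDown false o k f
  | 0, o, f => rfl
  | k + 1, o, f => by
    rw [heckeDown, hecke_true_zi_mul, heckeDown_true_zi_mul k, heckeDown]
    rw [show o + 1 + k = o + (k + 1) by omega]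

lemma suppIn_heckeDown {n : ℕ} {S : Set (ℕ → ℤ)} (hS : HeckeClosed n S) {b : Bool} :
    ∀ {k o : ℕ}, o + k < n → ∀ {f : Ser}, SuppIn S f → SuppIn S (heckeDown b o k f)
  | 0, _, _, _, hf => hf
  | k + 1, o, h, f, hf => by
    rw [heckeDown]
    exact suppIn_heckeDown hS (by omega) (suppIn_hecke hS (by omega) hf)

lemma suppIn_of_X_pow_mul {S : Set (ℕ → ℤ)} {f : Ser} {k : ℕ} (h : SuppIn S (X ^ k * f)) :
    SuppIn S f := by
  intro n ν hν
  refine h (n + k) ν ?_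
  rwa [coeff_X_pow_mul]

/-- If the last entry of a composition is positive then so are the last exponents. -/
lemma suppIn_nshl_true_last {r : List ℤ} {x : ℤ} (hr : ∀ z ∈ r, 0 ≤ z) (hx : 0 < x) :
    SuppIn {ν | 1 ≤ ν r.length} (nshl true (r ++ [x])) := by
  have h1 := heckeDown_zi_mul_nshl (x - 1) r
  -- The rotation formula exhibits a power of q times the polynomial as the last variable times an
  -- element with nonnegative exponents.
  rw [heckeDown_true_zi_mul, sub_add_cancel] at h1
  refine suppIn_of_X_pow_mul (k := r.countP (x - 1 < ·)) ?_
  rw [← h1]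
  obtain ⟨B, hB⟩ : ∃ B, ∀ z ∈ (x - 1) :: r, 0 ≤ z ∧ z ≤ B := by
    refine ⟨((x - 1) :: r).sum, fun z hz => ?_⟩
    have h0 : ∀ z ∈ (x - 1) :: r, 0 ≤ z := by
      intro z hz
      rcases List.mem_cons.1 hz with rfl | hz
      · omega
      · exact hr z hz
    exact ⟨h0 z hz, List.single_le_sum h0 z hz⟩
  have h2 := suppIn_heckeDown (heckeClosed_expoBox _ _ _ _) (b := false) (k := r.length) (o := 0)
    (by simp) (suppIn_nshl_expoBox hB true)
  refine SuppIn.mul (suppIn_mono (S := {Pi.single (0 + r.length) 1}) rfl) h2 ?_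
  rintro a rfl ν ⟨hν, -, -⟩
  have := hν r.length (by simp)
  simp only [Set.mem_ofPred_eq, Pi.add_apply, zero_add, Pi.single_eq_same]
  omega

/-! ### The Cauchy kernel and its reproducing property -/

/-- Formal power series in `t` over the power series in `q`. -/
abbrev Ser2 : Type := PowerSeries Ser

/-- All exponents that occur in `f` lie in `S`. -/
def SuppIn2 (S : Set (ℕ → ℤ)) (f : Ser2) : Prop := ∀ d, SuppIn S (coeff d f)

lemma suppIn_zero (S : Set (ℕ → ℤ)) : SuppIn S 0 := fun n ν h => by simp at h

lemma suppIn_sum {ι : Type*} {S : Set (ℕ → ℤ)} {s : Finset ι} {f : ι → Ser}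
    (h : ∀ i ∈ s, SuppIn S (f i)) : SuppIn S (∑ i ∈ s, f i) :=
  Finset.sum_induction _ (SuppIn S) (fun _ _ => SuppIn.add) (suppIn_zero S) h

lemma SuppIn2.mul {S S' S'' : Set (ℕ → ℤ)} {f g : Ser2} (hf : SuppIn2 S f) (hg : SuppIn2 S' g)
    (h : ∀ a ∈ S, ∀ b ∈ S', a + b ∈ S'') : SuppIn2 S'' (f * g) := by
  intro d
  rw [coeff_mul]
  exact suppIn_sum fun p _ => SuppIn.mul (hf _) (hg _) h

lemma suppIn2_C {S : Set (ℕ → ℤ)} {f : Ser} (hf : SuppIn S f) : SuppIn2 S (C f) := by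
  intro d
  rw [coeff_C]
  split_ifs
  · exact hf
  · exact suppIn_zero S

lemma SuppIn2.sub {S : Set (ℕ → ℤ)} {f g : Ser2} (hf : SuppIn2 S f) (hg : SuppIn2 S g) :
    SuppIn2 S (f - g) := fun d => by rw [map_sub]; exact (hf d).sub (hg d)

lemma SuppIn2.X_mul {S : Set (ℕ → ℤ)} {f : Ser2} (hf : SuppIn2 S f) : SuppIn2 S (X * f) := by
  intro d
  cases d with
  | zero => simpa using suppIn_zero S
  | succ d => rw [coeff_succ_X_mul]; exact hf d

lemma mono_pow (ν : ℕ → ℤ) (n : ℕ) : mono ν ^ n = mono (n • ν) := by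
  rw [mono, mono, ← map_pow, AddMonoidAlgebra.single_pow, one_pow]

lemma suppIn2_geo {S : AddSubmonoid (ℕ → ℤ)} {ν : ℕ → ℤ} (h : ν ∈ S) :
    SuppIn2 S (geo (mono ν)) := by
  intro d
  rw [geo, coeff_mk, mono_pow]
  exact suppIn_mono (S.nsmul_mem h d)

/-- The coefficient of a monomial. -/
noncomputable def coefAt (ν : ℕ → ℤ) : Lau →+ ℤ := (Finsupp.applyAddHom ν).comp
  (AddMonoidAlgebra.coeffAddEquiv (R := ℤ) (M := ℕ → ℤ)).toAddMonoidHom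

lemma coefAt_apply (ν : ℕ → ℤ) (f : Lau) : coefAt ν f = f.coeff ν := rfl

open Classical in
lemma coefAt_single (ν μ : ℕ → ℤ) :
    coefAt ν (AddMonoidAlgebra.single μ 1) = if μ = ν then 1 else 0 := by
  rw [coefAt_apply, AddMonoidAlgebra.coeff_single, Finsupp.single_apply]

/-- The constant term in the Laurent variables. -/
noncomputable def ctSer : Ser →+ PowerSeries ℤ := coeffwise (coefAt 0)

/-- The constant term in the Laurent variables, for two series variables. -/
noncomputable def ct2 : Ser2 →+ PowerSeries (PowerSeries ℤ) := coeffwise ctSer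

lemma ctSer_eq_zero {S : Set (ℕ → ℤ)} {f : Ser} (hf : SuppIn S f) (h : (0 : ℕ → ℤ) ∉ S) :
    ctSer f = 0 := by
  ext n
  rw [ctSer, coeff_coeffwise]
  change (coeff n f).coeff 0 = 0
  by_contra h0
  exact h (hf n 0 h0)

lemma ct2_eq_zero {S : Set (ℕ → ℤ)} {f : Ser2} (hf : SuppIn2 S f) (h : (0 : ℕ → ℤ) ∉ S) :
    ct2 f = 0 := by
  ext1 n
  rw [ct2, coeff_coeffwise, ctSer_eq_zero (hf n) h, map_zero]

lemma ct2_X_mul (f : Ser2) : ct2 (X * f) = X * ct2 f := coeffwise_X_mul _ _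

/-- The exponent of `z_i / z_j`. -/
def ratioExpo (i j : ℕ) : ℕ → ℤ := Pi.single i 1 - Pi.single j 1

lemma ratioExpo_apply (i j k : ℕ) :
    ratioExpo i j k = (if k = i then 1 else 0) - if k = j then 1 else 0 := by
  simp [ratioExpo, Pi.single_apply]

lemma ratioExpo_add (i j k : ℕ) : ratioExpo i j + ratioExpo j k = ratioExpo i k := by
  simp [ratioExpo]

/-- The factor `(1 - q t x_i y_j) / (1 - t x_i y_j)`, where `x_i = z_i` and `y_j = 1 / z_{o+j}`. -/
noncomputable def kerFactor (o i j : ℕ) : Ser2 :=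
  (1 - X * C (X * mono (ratioExpo i (o + j)))) * geo (mono (ratioExpo i (o + j)))

/-- The Cauchy kernel `∏_{i < j < n} (1 - q t x_i y_j) / ∏_{i ≤ j < n} (1 - t x_i y_j)`, where
`x_i = z_i` and `y_j = 1 / z_{o+j}`. -/
noncomputable def kernel (o n : ℕ) : Ser2 := ∏ j ∈ Finset.range n,
  (geo (mono (ratioExpo j (o + j))) * ∏ i ∈ Finset.range j, kerFactor o i j)

lemma kernel_succ (o n : ℕ) : kernel o (n + 1) = kernel o n *
    (geo (mono (ratioExpo n (o + n))) * ∏ i ∈ Finset.range n, kerFactor o i n) := by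
  rw [kernel, Finset.prod_range_succ, kernel]

/-- Since 1/(1 - t z^ω) = 1 + t z^ω/(1 - t z^ω), the two sides differ by the constant term of z^ρ G,
whose exponents at c are negative. For z^ω = x_c y_c this says that x_c^{-1} may be replaced by t
y_c. -/
lemma ct2_step {c : ℕ} {ρ ω : ℕ → ℤ} (hρ : ρ c = -1) {G : Ser2} (hG : SuppIn2 {ν | ν c ≤ 0} G) :
    ct2 (C (mono ρ) * G * geo (mono ω)) = ct2 (X * C (mono (ρ + ω)) * G * geo (mono ω)) := by
  have h0 : ct2 (C (mono ρ) * G) = 0 := by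
    refine ct2_eq_zero (SuppIn2.mul (suppIn2_C (suppIn_mono (S := {ρ}) rfl)) hG
      (S'' := {ν | ν c ≤ -1}) ?_) (by simp)
    rintro a rfl b hb
    have : b c ≤ 0 := hb
    change a c + b c ≤ -1
    omega
  rw [← sub_eq_zero, ← map_sub, ← h0, mono_add, map_mul]
  congr 1
  linear_combination C (mono ρ) * G * one_sub_mul_geo (mono ω)

lemma C_lauRatio (i j : ℕ) : C (lauRatio i j) = mono (ratioExpo i j) := rfl

/-- Once `r` may be replaced by `t * u`, the factor (1 - r)/(1 - q r) becomes (1 - t u)/(1 - q t u),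
the inverse of `K`. The two replacements `e1` and `e2` are all that this requires. -/
lemma kerFactor_aux {R A : Type*} [CommRing R] [AddCommGroup A] (φ : R →+ A)
    {B K g gu u r gr t q : R} (hk : K = (1 - t * (q * u)) * gu) (h1 : (1 - t * u) * gu = 1)
    (h2 : (1 - q * r) * gr = 1)
    (e1 : φ (r * (B * gr * K) * g) = φ (t * u * (B * gr * K) * g))
    (e2 : φ (r * (q * (B * gr)) * g) = φ (t * u * (q * (B * gr)) * g)) :
    φ (B * (K * ((1 - r) * gr)) * g) = φ (B * g) := by
  have h3 : B * (K * ((1 - r) * gr)) * g = B * gr * K * g - r * (B * gr * K) * g := by ring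
  have h4 : B * g = B * gr * g - r * (q * (B * gr)) * g := by
    linear_combination (-B * g) * h2
  rw [h3, h4, map_sub, map_sub, e1, e2, ← map_sub, ← map_sub]
  congr 1
  rw [hk]
  linear_combination (B * gr * g * (1 - t * (q * u))) * h1

/-- Under x_c^{-1} = t y_c the ratio z_i/z_c becomes t x_i y_c, so a factor of the density cancels
the corresponding factor of the kernel. -/
lemma ct2_kerFactor {o i c : ℕ} (hic : i ≠ c) {B : Ser2} (hB : SuppIn2 {ν | ν c ≤ 0} B)
    (ho : 0 < o) :
    ct2 (B * (kerFactor o i c * C (hlFactor i c)) * geo (mono (ratioExpo c (o + c)))) =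
      ct2 (B * geo (mono (ratioExpo c (o + c)))) := by
  have hadd := ratioExpo_add i c (o + c)
  have hstep := fun (G : Ser2) (hG : SuppIn2 {ν | ν c ≤ 0} G) =>
    ct2_step (ρ := ratioExpo i c) (ω := ratioExpo c (o + c)) (c := c)
      (by simp [ratioExpo_apply, hic.symm]) hG
  rw [hadd] at hstep
  have h1 := one_sub_mul_geo (mono (ratioExpo i (o + c)))
  have h2 : (1 - C X * C (mono (ratioExpo i c))) * (C (geo (lauRatio i c)) : Ser2) = 1 := by
    rw [← C_lauRatio, ← map_mul, ← map_one (C : Ser →+* Ser2), ← map_sub, ← map_mul,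
      one_sub_mul_geo]
  have hu : ratioExpo i (o + c) ∈ coordNonpos c := by
    rw [mem_coordNonpos, ratioExpo_apply]; split_ifs <;> omega
  have hr : ratioExpo i c ∈ coordNonpos c := by
    rw [mem_coordNonpos, ratioExpo_apply]; split_ifs <;> omega
  have hcl : ∀ a ∈ coordNonpos c, ∀ b ∈ coordNonpos c, a + b ∈ coordNonpos c :=
    fun a ha b hb => (coordNonpos c).add_mem ha hb
  have hH' : SuppIn2 (coordNonpos c) (B * C (geo (lauRatio i c))) :=
    SuppIn2.mul hB (suppIn2_C (geo_mem_suppSubring (S := coordNonpos c) hr)) hcl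
  have hX : SuppIn2 (coordNonpos c) (C X * (B * C (geo (lauRatio i c)))) := by
    refine SuppIn2.mul (suppIn2_C (S := coordNonpos c) ?_) hH' hcl
    rw [← mul_one X]
    exact (suppIn_one (coordNonpos c).zero_mem).X_mul
  have hG1 : SuppIn2 (coordNonpos c) (B * C (geo (lauRatio i c)) * kerFactor o i c) := by
    refine SuppIn2.mul hH' ?_ hcl
    refine SuppIn2.mul (SuppIn2.sub ?_ (SuppIn2.X_mul (suppIn2_C (SuppIn.X_mul (suppIn_mono hu)))))
      (suppIn2_geo hu) hcl
    rw [← map_one C]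
    exact suppIn2_C (suppIn_one (coordNonpos c).zero_mem)
  have hf : (C (hlFactor i c) : Ser2) =
      (1 - C (mono (ratioExpo i c))) * C (geo (lauRatio i c)) := by
    rw [hlFactor, RingHom.map_mul, RingHom.map_sub, RingHom.map_one, C_lauRatio]
  rw [hf]
  exact kerFactor_aux ct2 (by rw [kerFactor, RingHom.map_mul]) h1 h2 (hstep _ hG1) (hstep _ hX)

lemma suppIn2_kerFactor {S : AddSubmonoid (ℕ → ℤ)} {o i j : ℕ} (h : ratioExpo i (o + j) ∈ S) :
    SuppIn2 S (kerFactor o i j) := by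
  refine SuppIn2.mul (SuppIn2.sub ?_ (SuppIn2.X_mul (suppIn2_C (SuppIn.X_mul (suppIn_mono h)))))
    (suppIn2_geo h) fun a ha b hb => S.add_mem ha hb
  rw [← map_one C]
  exact suppIn2_C (suppIn_one S.zero_mem)

lemma suppIn2_prod {ι : Type*} {S : AddSubmonoid (ℕ → ℤ)} {s : Finset ι} {f : ι → Ser2}
    (h : ∀ i ∈ s, SuppIn2 S (f i)) : SuppIn2 S (∏ i ∈ s, f i) := by
  refine Finset.prod_induction _ (SuppIn2 S) (fun _ _ hf hg => SuppIn2.mul hf hg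
    fun a ha b hb => S.add_mem ha hb) ?_ h
  rw [← map_one C]
  exact suppIn2_C (suppIn_one S.zero_mem)

lemma suppIn2_kernel {S : AddSubmonoid (ℕ → ℤ)} {o n : ℕ}
    (h : ∀ i j, i ≤ j → j < n → ratioExpo i (o + j) ∈ S) : SuppIn2 S (kernel o n) := by
  refine suppIn2_prod fun j hj => SuppIn2.mul (suppIn2_geo (h j j le_rfl (Finset.mem_range.1 hj)))
    (suppIn2_prod fun i hi => suppIn2_kerFactor (h i j (Finset.mem_range.1 hi).le
      (Finset.mem_range.1 hj))) fun a ha b hb => S.add_mem ha hb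

/-- The exponents whose `c`-th coordinate is zero. -/
def coordZero (c : ℕ) : AddSubmonoid (ℕ → ℤ) where
  carrier := {ν | ν c = 0}
  zero_mem' := by simp
  add_mem' {a b} ha hb := by
    have h1 : a c = 0 := ha
    have h2 : b c = 0 := hb
    change a c + b c = 0
    omega

lemma mem_coordZero {c : ℕ} {ν : ℕ → ℤ} : ν ∈ coordZero c ↔ ν c = 0 := Iff.rfl

lemma hlDensity_mem_suppSubring_coordZero {n c : ℕ} (h : n ≤ c) :
    hlDensity n ∈ suppSubring (coordZero c) := by
  refine prod_mem fun k hk => prod_mem fun j hj => hlFactor_mem_suppSubring ?_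
  have h1 : c ≠ j := by simp at hj hk; omega
  have h2 : c ≠ k := by simp at hk; omega
  rw [mem_coordZero]
  simp [h1, h2]

lemma ct2_prod_kerFactor {o c : ℕ} (ho : 0 < o) {B : Ser2} (hB : SuppIn2 {ν | ν c ≤ 0} B) :
    ∀ b ≤ c, ct2 (B * (∏ i ∈ Finset.range b, kerFactor o i c * C (hlFactor i c)) *
      geo (mono (ratioExpo c (o + c)))) = ct2 (B * geo (mono (ratioExpo c (o + c))))
  | 0, _ => by simp
  | b + 1, hb => by
    have hP : SuppIn2 (coordNonpos c) (∏ i ∈ Finset.range b, kerFactor o i c * C (hlFactor i c)) := by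
      refine suppIn2_prod fun i hi => SuppIn2.mul (suppIn2_kerFactor (S := coordNonpos c) ?_)
        (suppIn2_C (hlFactor_mem_suppSubring (S := coordNonpos c) ?_))
        fun a ha b hb => (coordNonpos c).add_mem ha hb
      · have := Finset.mem_range.1 hi
        rw [mem_coordNonpos, ratioExpo_apply]
        split_ifs <;> omega
      · have := Finset.mem_range.1 hi
        rw [mem_coordNonpos]
        simp [show c ≠ i by omega]
    rw [Finset.prod_range_succ, ← mul_assoc, ct2_kerFactor (by omega)
      (SuppIn2.mul hB hP fun a ha b hb => (coordNonpos c).add_mem ha hb) ho,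
      ct2_prod_kerFactor ho hB b (by omega)]

/-- The exponents to which `kernel o n` reproduces the monomial `(t y)^ε`. -/
def Matched (o n : ℕ) (ε : ℕ → ℤ) : Prop :=
  (∀ i < n, ε (o + i) = -ε i) ∧ ∀ i, n ≤ i → i < o ∨ o + n ≤ i → ε i = 0

lemma Matched.congr {o n : ℕ} {ε ε' : ℕ → ℤ} (h1 : ∀ i < n, ε' (o + i) + ε' i = ε (o + i) + ε i)
    (h2 : ∀ i, n ≤ i → i < o ∨ o + n ≤ i → ε' i = ε i) : Matched o n ε' ↔ Matched o n ε := by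
  constructor
  · rintro ⟨m1, m2⟩
    exact ⟨fun i hi => by have := h1 i hi; have := m1 i hi; omega,
      fun i h4 h5 => h2 i h4 h5 ▸ m2 i h4 h5⟩
  · rintro ⟨m1, m2⟩
    exact ⟨fun i hi => by have := h1 i hi; have := m1 i hi; omega,
      fun i h4 h5 => (h2 i h4 h5).trans (m2 i h4 h5)⟩

lemma matched_succ_iff {o c : ℕ} (hc : c < o) {ε : ℕ → ℤ} (h : ε c = 0) :
    Matched o (c + 1) ε ↔ Matched o c ε := by
  constructor
  · rintro ⟨m1, m2⟩
    refine ⟨fun i hi => m1 i (by omega), fun i h3 h4 => ?_⟩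
    by_cases e : i = c
    · rw [e, h]
    · by_cases e' : i = o + c
      · rw [e', m1 c (by omega), h, neg_zero]
      · exact m2 i (by omega) (by omega)
  · rintro ⟨m1, m2⟩
    refine ⟨fun i hi => ?_, fun i h3 h4 => m2 i (by omega) (by omega)⟩
    rcases Nat.lt_succ_iff_lt_or_eq.1 hi with hi | rfl
    · exact m1 i hi
    · rw [m2 (o + i) (by omega) (by omega), h, neg_zero]

open Classical in
lemma ctSer_mono (ε : ℕ → ℤ) : ctSer (mono ε) = if ε = 0 then 1 else 0 := by
  ext n
  rw [ctSer, coeff_coeffwise, mono, coeff_C]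
  split_ifs with h1 h2 h2
  · rw [coefAt_single, if_pos h2, h1]; simp
  · rw [coefAt_single, if_neg h2]; simp
  · simp [coeff_one, h1]
  · simp

open Classical in
lemma ct2_C_mono (ε : ℕ → ℤ) : ct2 (C (mono ε)) = if ε = 0 then 1 else 0 := by
  ext1 n
  rw [ct2, coeff_coeffwise, coeff_C]
  split_ifs with h3 h4 h4
  · rw [ctSer_mono, if_pos h4, h3]; simp
  · rw [ctSer_mono, if_neg h4]; simp
  · simp [coeff_one, h3]
  · simp

lemma suppIn2_C_mono_mul {c : ℕ} {D : Ser2} (hD : SuppIn2 (coordZero c) D) (ε : ℕ → ℤ) :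
    SuppIn2 {ν | ν c = ε c} (C (mono ε) * D) := by
  refine SuppIn2.mul (suppIn2_C (suppIn_mono (S := {ε}) rfl)) hD ?_
  rintro a rfl b hb
  have : b c = 0 := hb
  change a c + b c = a c
  omega

lemma ct2_geo_of_zero {c k : ℕ} (hck : c ≠ k) {D : Ser2} (hD : SuppIn2 (coordZero c) D)
    {ε : ℕ → ℤ} (h : ε c = 0) :
    ct2 (C (mono ε) * D * geo (mono (ratioExpo c k))) = ct2 (C (mono ε) * D) := by
  have h1 : C (mono ε) * D * geo (mono (ratioExpo c k)) - C (mono ε) * D =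
      X * (C (mono (ε + ratioExpo c k)) * D * geo (mono (ratioExpo c k))) := by
    rw [mono_add, map_mul]
    linear_combination C (mono ε) * D * one_sub_mul_geo (mono (ratioExpo c k))
  have hr : ratioExpo c k c = 1 := by rw [ratioExpo_apply]; split_ifs <;> omega
  have hg : SuppIn2 (coordNonneg c) (geo (mono (ratioExpo c k))) := by
    refine suppIn2_geo ?_
    change 0 ≤ ratioExpo c k c
    omega
  rw [← sub_eq_zero, ← map_sub, h1, ct2_X_mul, ct2_eq_zero (S := {ν | 1 ≤ ν c})
    (SuppIn2.mul (suppIn2_C_mono_mul hD _) hg ?_) (by simp), mul_zero]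
  intro a ha b hb
  have h3 : a c = ε c + ratioExpo c k c := ha
  have h4 : 0 ≤ b c := hb
  change 1 ≤ a c + b c
  omega

lemma ct2_geo_of_neg {c k : ℕ} {D : Ser2} (hD : SuppIn2 (coordZero c) D)
    {ε : ℕ → ℤ} (h : ε c < 0) :
    ct2 (C (mono ε) * D * geo (mono (ratioExpo c k))) =
      X * ct2 (C (mono (ε + ratioExpo c k)) * D * geo (mono (ratioExpo c k))) := by
  have hG : SuppIn2 {ν | ν c ≤ 0} (C (mono (ε + Pi.single c 1)) * D) := by
    intro d n ν hν
    have : ν c = (ε + Pi.single c 1 : ℕ → ℤ) c := suppIn2_C_mono_mul hD _ d n ν hν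
    change ν c ≤ 0
    rw [this]
    simp
    omega
  have := ct2_step (c := c) (ρ := -Pi.single c 1) (ω := ratioExpo c k) (by simp) hG
  rw [← ct2_X_mul]
  have e1 : mono (-Pi.single c 1) * mono (ε + Pi.single c 1) = mono ε := by
    rw [← mono_add]; congr 1; abel
  have e2 : mono (-Pi.single c 1 + ratioExpo c k) * mono (ε + Pi.single c 1) =
      mono (ε + ratioExpo c k) := by
    rw [← mono_add]; congr 1; abel
  rw [← e1, ← e2, RingHom.map_mul, RingHom.map_mul, mul_assoc (C (mono (-Pi.single c 1))), this,
    mul_assoc X, mul_assoc X, mul_assoc (C (mono (-Pi.single c 1 + ratioExpo c k)))]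
  simp only [mul_assoc]

-- Induction on -ε_c: each factor z_c^{-1} is traded for t y_c, and when none is left the geometric
-- series contributes only its leading term 1.
open Classical in
lemma ct2_kernel_succ {o c : ℕ} (hc : c < o) {D : Ser2} (hD : SuppIn2 (coordZero c) D)
    (hDct : ∀ ε : ℕ → ℤ, (∀ i < c, ε i ≤ 0) → ct2 (C (mono ε) * D) =
      if Matched o c ε then X ^ ∑ i ∈ Finset.range c, (-ε i).toNat else 0) :
    ∀ (k : ℕ) (ε : ℕ → ℤ), (∀ i < c + 1, ε i ≤ 0) → ε c = -k →
      ct2 (C (mono ε) * D * geo (mono (ratioExpo c (o + c)))) = if Matched o (c + 1) ε then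
        X ^ ∑ i ∈ Finset.range (c + 1), (-ε i).toNat else 0
  | 0, ε, hε, h0 => by
    have hc0 : ε c = 0 := by simpa using h0
    rw [ct2_geo_of_zero (by omega) hD hc0, hDct ε fun i hi => hε i (by omega),
      Finset.sum_range_succ, hc0]
    simp only [matched_succ_iff hc hc0, neg_zero, Int.toNat_zero, add_zero]
  | k + 1, ε, hε, hk => by
    have happ : ∀ i, (ε + ratioExpo c (o + c)) i =
        ε i + ((if i = c then 1 else 0) - if i = o + c then 1 else 0) := fun i => by
      rw [Pi.add_apply, ratioExpo_apply]
    have hm : Matched o (c + 1) (ε + ratioExpo c (o + c)) ↔ Matched o (c + 1) ε := by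
      refine Matched.congr (fun i hi => ?_) fun i h1 h2 => ?_
      · rw [happ, happ]; split_ifs <;> omega
      · rw [happ]; split_ifs <;> omega
    have hs : ∑ i ∈ Finset.range (c + 1), (-ε i).toNat =
        ∑ i ∈ Finset.range (c + 1), (-(ε + ratioExpo c (o + c)) i).toNat + 1 := by
      rw [Finset.sum_range_succ, Finset.sum_range_succ, add_assoc]
      congr 1
      · refine Finset.sum_congr rfl fun i hi => ?_
        have := Finset.mem_range.1 hi
        rw [happ]; split_ifs <;> omega
      · rw [happ]; split_ifs <;> omega
    rw [ct2_geo_of_neg hD (by omega), ct2_kernel_succ hc hD hDct k (ε + ratioExpo c (o + c))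
      (fun i hi => by have := hε i hi; rw [happ]; split_ifs with e <;> (try subst e) <;> omega)
      (by rw [happ]; split_ifs <;> push_cast at * <;> omega), hs]
    simp only [hm]
    split_ifs
    · ring
    · ring

open Classical in
/-- The kernel reproduces monomials for the constant-term pairing. -/
lemma ct2_kernel (o : ℕ) : ∀ n ≤ o, ∀ ε : ℕ → ℤ, (∀ i < n, ε i ≤ 0) →
    ct2 (C (mono ε) * (kernel o n * C (hlDensity n))) =
      if Matched o n ε then X ^ ∑ i ∈ Finset.range n, (-ε i).toNat else 0
  | 0, _, ε, _ => by
    have : Matched o 0 ε ↔ ε = 0 := by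
      simp only [Matched]
      refine ⟨fun h => funext fun i => h.2 i (Nat.zero_le _) (by omega), ?_⟩
      rintro rfl
      simp
    simp only [kernel, hlDensity, Finset.prod_range_zero, map_one, mul_one, ct2_C_mono,
      Finset.sum_range_zero, pow_zero, this]
  | c + 1, hc, ε, hε => by
    have hD : SuppIn2 (coordZero c) (kernel o c * C (hlDensity c)) := by
      refine SuppIn2.mul (suppIn2_kernel (S := coordZero c) fun i j hij hj => ?_)
        (suppIn2_C (hlDensity_mem_suppSubring_coordZero le_rfl))
        fun a ha b hb => (coordZero c).add_mem ha hb
      rw [mem_coordZero, ratioExpo_apply]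
      split_ifs <;> omega
    have hB : SuppIn2 {ν | ν c ≤ 0} (C (mono ε) * (kernel o c * C (hlDensity c))) := by
      intro d n ν hν
      have : ν c = ε c := suppIn2_C_mono_mul hD _ d n ν hν
      exact this.trans_le (hε c (by omega))
    -- In the last column every factor of the kernel except the geometric series in x_c y_c is
    -- cancelled by the density.
    have h1 : ct2 (C (mono ε) * (kernel o (c + 1) * C (hlDensity (c + 1)))) =
        ct2 (C (mono ε) * (kernel o c * C (hlDensity c)) * geo (mono (ratioExpo c (o + c)))) := by
      rw [← ct2_prod_kerFactor (by omega) hB c le_rfl]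
      refine congrArg ct2 ?_
      rw [kernel_succ, hlDensity, Finset.prod_range_succ, ← hlDensity, Finset.prod_mul_distrib]
      simp only [map_mul, map_prod]
      ring
    rw [h1]
    exact ct2_kernel_succ (by omega) hD (fun ε => ct2_kernel o c (by omega) ε) (-ε c).toNat ε hε
      (by have := hε c (by omega); omega)

/-! ### Biorthogonality and transition matrices over compositions -/

/-- The inclusion of the power series with integer coefficients. -/
noncomputable def incl : PowerSeries ℤ →+* Ser := PowerSeries.map (Int.castRingHom Lau)

lemma coeffwise_incl_mul (φ : Lau →+ ℤ) (c : PowerSeries ℤ) (f : Ser) :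
    coeffwise φ (incl c * f) = c * coeffwise φ f := by
  ext n
  rw [coeff_coeffwise, coeff_mul, coeff_mul, map_sum]
  refine Finset.sum_congr rfl fun p _ => ?_
  rw [incl, coeff_map, coeff_coeffwise, eq_intCast, ← zsmul_eq_mul, map_zsmul, smul_eq_mul]

lemma hlFun_incl_mul (n : ℕ) (c : PowerSeries ℤ) (f : Ser) :
    hlFun n (incl c * f) = c * hlFun n f := by
  rw [hlFun, mul_assoc, nonposSum, coeffwise_incl_mul, hlFun, nonposSum]

lemma ctSer_incl_mul (c : PowerSeries ℤ) (f : Ser) : ctSer (incl c * f) = c * ctSer f :=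
  coeffwise_incl_mul _ _ _

lemma hlFun_sum {ι : Type*} (n : ℕ) (s : Finset ι) (f : ι → Ser) :
    hlFun n (∑ i ∈ s, f i) = ∑ i ∈ s, hlFun n (f i) := by
  rw [hlFun, Finset.sum_mul, map_sum]
  rfl

lemma reindex_incl (φ : (ℕ → ℤ) →+ (ℕ → ℤ)) (c : PowerSeries ℤ) :
    reindex φ (incl c) = incl c := by
  ext1 n
  simp [reindex, incl]

lemma eq_sum_incl_mul_mono {ι : Type*} [Fintype ι] {e : ι → ℕ → ℤ} (he : Function.Injective e)
    {f : Ser} (hf : SuppIn (Set.range e) f) :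
    f = ∑ i, incl (coeffwise (coefAt (e i)) f) * mono (e i) := by
  classical
  have key : ∀ (n : ℕ) (ν : ℕ → ℤ) (i : ι),
      (coeff n (incl (coeffwise (coefAt (e i)) f) * mono (e i))).coeff ν =
        if e i = ν then (coeff n f).coeff (e i) else 0 := by
    intro n ν i
    rw [mono, coeff_mul_C, incl, coeff_map, coeff_coeffwise, eq_intCast, ← zsmul_eq_mul,
      AddMonoidAlgebra.smul_single, AddMonoidAlgebra.coeff_single, Finsupp.single_apply, smul_eq_mul,
      mul_one, coefAt_apply]
  ext n ν
  rw [map_sum, AddMonoidAlgebra.coeff_sum, Finsupp.finsetSum_apply]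
  simp only [key]
  by_cases h : ∃ i, e i = ν
  · obtain ⟨i, rfl⟩ := h
    simp [he.eq_iff]
  · rw [Finset.sum_eq_zero fun i _ => if_neg fun h' => h ⟨i, h'⟩]
    by_contra h0
    exact h (hf n ν h0)

/-- The compositions of `d` into `n` nonnegative parts. -/
abbrev CompIdx (n d : ℕ) : Type := Finset.Nat.antidiagonalTuple n d

/-- The list of the parts of a composition. -/
def toList {n : ℕ} (μ : Fin n → ℕ) : List ℤ := List.ofFn fun i => (μ i : ℤ)

@[simp] lemma length_toList {n : ℕ} (μ : Fin n → ℕ) : (toList μ).length = n := by simp [toList]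

lemma toList_injective {n : ℕ} : Function.Injective (toList (n := n)) := by
  intro μ ν h
  have := List.ofFn_injective h
  funext i
  exact_mod_cast congrFun this i

lemma nonneg_of_mem_toList {n : ℕ} {μ : Fin n → ℕ} {z : ℤ} (hz : z ∈ toList μ) : 0 ≤ z := by
  obtain ⟨i, rfl⟩ := (List.mem_ofFn' _ _).1 hz
  positivity

lemma sum_toList {n d : ℕ} {μ : Fin n → ℕ} (hμ : μ ∈ Finset.Nat.antidiagonalTuple n d) :
    (toList μ).sum = d := by
  rw [Finset.Nat.mem_antidiagonalTuple] at hμ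
  rw [toList, List.sum_ofFn, ← hμ]
  push_cast
  rfl

lemma le_of_mem_toList {n d : ℕ} {μ : Fin n → ℕ} (hμ : μ ∈ Finset.Nat.antidiagonalTuple n d) {z : ℤ}
    (hz : z ∈ toList μ) : z ≤ d := by
  rw [← sum_toList hμ]
  exact List.single_le_sum (fun _ => nonneg_of_mem_toList) z hz

/-- The exponent of a composition. -/
def expo {n : ℕ} (μ : Fin n → ℕ) : ℕ → ℤ := listExpo (toList μ)

lemma expo_of_lt {n : ℕ} (μ : Fin n → ℕ) (i : Fin n) : expo μ i = μ i := by
  rw [expo, listExpo, List.getD_eq_getElem _ _ (by simp)]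
  simp [toList]

lemma expo_of_ge {n : ℕ} (μ : Fin n → ℕ) {i : ℕ} (h : n ≤ i) : expo μ i = 0 := by
  rw [expo, listExpo, List.getD_eq_default _ _ (by simpa using h)]

lemma expo_nonneg {n : ℕ} (μ : Fin n → ℕ) (i : ℕ) : 0 ≤ expo μ i := by
  rcases lt_or_ge i n with h | h
  · rw [show i = (⟨i, h⟩ : Fin n) from rfl, expo_of_lt]; positivity
  · rw [expo_of_ge μ h]

lemma expo_injective {n : ℕ} : Function.Injective (expo (n := n)) := by
  intro μ ν h
  funext i
  have := congrFun h i
  rw [expo_of_lt, expo_of_lt] at this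
  exact_mod_cast this

lemma sum_expo {n d : ℕ} {μ : Fin n → ℕ} (hμ : μ ∈ Finset.Nat.antidiagonalTuple n d) :
    ∑ i ∈ Finset.range n, expo μ i = d := by
  rw [Finset.Nat.mem_antidiagonalTuple] at hμ
  rw [Finset.sum_range, ← hμ]
  simp [expo_of_lt]

lemma exists_expo_eq {n d : ℕ} {ν : ℕ → ℤ} (h0 : ∀ i < n, 0 ≤ ν i) (h1 : ∀ i, n ≤ i → ν i = 0)
    (h2 : ∑ i ∈ Finset.range n, ν i = d) : ∃ μ : CompIdx n d, expo μ.1 = ν := by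
  have h3 : ∀ i : Fin n, ((ν i).toNat : ℤ) = ν i := fun i => Int.toNat_of_nonneg (h0 i i.2)
  refine ⟨⟨fun i => (ν i).toNat, ?_⟩, ?_⟩
  · rw [Finset.Nat.mem_antidiagonalTuple]
    zify
    rw [← h2, Finset.sum_range]
    exact Finset.sum_congr rfl fun i _ => h3 i
  · funext i
    rcases lt_or_ge i n with h | h
    · rw [show i = (⟨i, h⟩ : Fin n) from rfl, expo_of_lt]
      exact h3 ⟨i, h⟩
    · rw [expo_of_ge _ h, h1 i h]

section Cauchy

variable {n d : ℕ}

/-- The polynomial indexed by a composition. -/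
noncomputable def nsPos (b : Bool) (a : Fin n → ℕ) : Ser := nshl b (toList a)

/-- The polynomial in the inverse variables indexed by the negative of a composition. -/
noncomputable def nsNeg (b : Bool) (a : Fin n → ℕ) : Ser := nshl b ((toList a).map Neg.neg)

/-- The coefficients of `nsPos`. -/
noncomputable def matPos (n d : ℕ) (b : Bool) : Matrix (CompIdx n d) (CompIdx n d) (PowerSeries ℤ) :=
  fun a μ => coeffwise (coefAt (expo μ.1)) (nsPos b a.1)

/-- The coefficients of `nsNeg`. -/
noncomputable def matNeg (n d : ℕ) (b : Bool) : Matrix (CompIdx n d) (CompIdx n d) (PowerSeries ℤ) :=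
  fun a μ => coeffwise (coefAt (-expo μ.1)) (nsNeg b a.1)

/-- The Gram matrix of the monomials. -/
noncomputable def gram (n d : ℕ) : Matrix (CompIdx n d) (CompIdx n d) (PowerSeries ℤ) :=
  fun μ ν => hlFun n (mono (expo μ.1 - expo ν.1))

lemma suppIn_nsPos (b : Bool) (a : CompIdx n d) : SuppIn (expoBox n 0 d d) (nsPos b a.1) := by
  have := suppIn_nshl_expoBox (l := toList a.1) (lo := 0) (hi := d)
    (fun z hz => ⟨nonneg_of_mem_toList hz, le_of_mem_toList a.2 hz⟩) b
  rwa [length_toList, sum_toList a.2] at this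

lemma sum_map_neg (l : List ℤ) : (l.map Neg.neg).sum = -l.sum := by
  induction l with
  | nil => simp
  | cons x l ih => rw [List.map_cons, List.sum_cons, ih, List.sum_cons]; ring

lemma suppIn_nsNeg (b : Bool) (a : CompIdx n d) :
    SuppIn (expoBox n (-d) 0 (-d)) (nsNeg b a.1) := by
  have := suppIn_nshl_expoBox (l := (toList a.1).map Neg.neg) (lo := -d) (hi := 0)
    (fun z hz => by
      obtain ⟨w, hw, rfl⟩ := List.mem_map.1 hz
      have := nonneg_of_mem_toList hw
      have := le_of_mem_toList a.2 hw
      constructor <;> omega) b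
  rwa [List.length_map, length_toList, sum_map_neg, sum_toList a.2] at this

lemma nsPos_eq (b : Bool) (a : CompIdx n d) :
    nsPos b a.1 = ∑ μ : CompIdx n d, incl (matPos n d b a μ) * mono (expo μ.1) := by
  refine eq_sum_incl_mul_mono (e := fun μ : CompIdx n d => expo μ.1)
    (expo_injective.comp Subtype.val_injective) ((suppIn_nsPos b a).subset ?_)
  rintro ν ⟨h1, h2, h3⟩
  exact exists_expo_eq (fun i hi => (h1 i hi).1) h2 h3

lemma nsNeg_eq (b : Bool) (a : CompIdx n d) :
    nsNeg b a.1 = ∑ μ : CompIdx n d, incl (matNeg n d b a μ) * mono (-expo μ.1) := by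
  refine eq_sum_incl_mul_mono (e := fun μ : CompIdx n d => -expo μ.1)
    (neg_injective.comp (expo_injective.comp Subtype.val_injective)) ((suppIn_nsNeg b a).subset ?_)
  rintro ν ⟨h1, h2, h3⟩
  obtain ⟨μ, hμ⟩ := exists_expo_eq (n := n) (d := d) (ν := -ν)
    (fun i hi => by have := (h1 i hi).2; simp; omega) (fun i hi => by simp [h2 i hi])
    (by simp [h3])
  exact ⟨μ, by simp [hμ]⟩

lemma hlFun_nsPos_mul_nsNeg (b b' : Bool) (a c : CompIdx n d) :
    hlFun n (nsPos b a.1 * nsNeg b' c.1) =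
      (matPos n d b * gram n d * (matNeg n d b').transpose) a c := by
  rw [nsPos_eq, nsNeg_eq, Finset.sum_mul_sum, hlFun_sum, Matrix.mul_apply]
  simp only [hlFun_sum, Matrix.mul_apply, Finset.sum_mul, Matrix.transpose_apply]
  rw [Finset.sum_comm]
  refine Finset.sum_congr rfl fun ν _ => Finset.sum_congr rfl fun μ _ => ?_
  rw [mul_mul_mul_comm, ← map_mul, ← mono_add, hlFun_incl_mul, gram, sub_eq_add_neg]
  ring

lemma hlFun_nshl_mul_nshl_neg {x y : List ℤ} (h : x.length = y.length) :
    hlFun x.length (nshl true x * nshl false (y.map Neg.neg)) = rowMono (x.zip y) := by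
  have h1 : (x.zip y).map Prod.fst = x := List.map_fst_zip h.le
  have h2 : ((x.zip y).map fun r => -r.2) = y.map Neg.neg := by
    conv_rhs => rw [← List.map_snd_zip (l₁ := x) (l₂ := y) h.ge]
    rw [List.map_map]
    rfl
  rw [← rowPairing_eq, rowPairing, h1, h2]
  simp [h]

lemma eq_of_forall_zip_le : ∀ {x y : List ℤ}, x.length = y.length → x.sum = y.sum →
    (∀ r ∈ x.zip y, r.1 ≤ r.2) → x = y
  | [], [], _, _, _ => rfl
  | a :: x, c :: y, hl, hs, h => by
    have hsum : ∀ {x y : List ℤ}, x.length = y.length → (∀ r ∈ x.zip y, r.1 ≤ r.2) →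
        x.sum ≤ y.sum := by
      intro x
      induction x with
      | nil => intro y h _; rw [List.length_nil, eq_comm, List.length_eq_zero_iff] at h; simp [h]
      | cons a x ih =>
        rintro (_ | ⟨c, y⟩) h h'
        · simp at h
        · have h1 := ih (y := y) (by simpa using h) fun r hr => h' r (by simp [hr])
          have h2 := h' (a, c) (by simp)
          simp only [List.sum_cons]
          omega
    have h1 := hsum (x := x) (y := y) (by simpa using hl) fun r hr => h r (by simp [hr])
    have h2 : a ≤ c := h (a, c) (by simp)
    simp only [List.sum_cons] at hs
    obtain rfl : a = c := by omega
    rw [eq_of_forall_zip_le (x := x) (y := y) (by simpa using hl) (by omega)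
      fun r hr => h r (by simp [hr])]

lemma rowStat_zip_self (x : List ℤ) : rowStat (x.zip x) = 0 := by
  induction x with
  | nil => rfl
  | cons a x ih =>
    rw [List.zip_cons_cons, rowStat, ih, add_zero, List.sum_eq_zero]
    intro k hk
    obtain ⟨r, hr, rfl⟩ := List.mem_map.1 hk
    have : r.1 = r.2 := by
      rw [List.zip_eq_zipWith, List.zipWith_self] at hr
      obtain ⟨z, -, rfl⟩ := List.mem_map.1 hr
      rfl
    simp only [rowPair]
    split_ifs <;> omega

-- If the ends have equal sums and no row is reversed, all rows are empty, and empty rows with equal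
-- ends have statistic 0. This makes the two families biorthogonal.
open Classical in
lemma rowMono_zip {x y : List ℤ} (h : x.length = y.length) (hs : x.sum = y.sum) :
    rowMono (x.zip y) = if x = y then 1 else 0 := by
  by_cases hxy : x = y
  · subst hxy
    rw [if_pos rfl, rowMono, rowStat_zip_self, if_pos, pow_zero]
    intro r hr
    rw [List.zip_eq_zipWith, List.zipWith_self] at hr
    obtain ⟨z, -, rfl⟩ := List.mem_map.1 hr
    exact le_rfl
  · rw [if_neg hxy, rowMono, if_neg fun h' => hxy (eq_of_forall_zip_le h hs h')]

/-- For `b = true` the rows run from `a` to `c`; for `b = false` the factors change places and the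
rows run from `-c` to `-a`. -/
lemma matPos_gram_matNeg (b : Bool) :
    matPos n d b * gram n d * (matNeg n d !b).transpose = 1 := by
  ext1 a c
  rw [← hlFun_nsPos_mul_nsNeg, Matrix.one_apply]
  cases b
  · have h := hlFun_nshl_mul_nshl_neg (x := (toList c.1).map Neg.neg)
      (y := (toList a.1).map Neg.neg) (by simp)
    rw [rowMono_zip (by simp) (by rw [sum_map_neg, sum_map_neg, sum_toList a.2, sum_toList c.2]),
      List.map_map, show (Neg.neg ∘ Neg.neg : ℤ → ℤ) = id by funext z; simp, List.map_id,
      List.length_map, length_toList] at h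
    rw [nsPos, nsNeg, mul_comm, Bool.not_false, h]
    have : (toList c.1).map Neg.neg = (toList a.1).map Neg.neg ↔ a = c := by
      rw [(List.map_injective_iff.2 neg_injective).eq_iff, toList_injective.eq_iff,
        Subtype.val_injective.eq_iff, eq_comm]
    simp only [this]
  · have h := hlFun_nshl_mul_nshl_neg (x := toList a.1) (y := toList c.1) (by simp)
    rw [rowMono_zip (by simp) (by rw [sum_toList a.2, sum_toList c.2]), length_toList] at h
    rw [nsPos, nsNeg, Bool.not_true, h]
    simp only [toList_injective.eq_iff, Subtype.val_injective.eq_iff]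

/-- For decreasing `x` the families coincide at `x`, so the vanishing is biorthogonality. An
exchange in `x` passes to `y` by self-adjointness, and there the operator stays in the span of the
polynomials indexed by rearrangements of `y`. -/
lemma hlFun_nshl_true_mul_nshl_true_eq_zero (x : List ℤ) : ∀ y : List ℤ, y.length = x.length →
    x.sum + y.sum = 0 → ¬ x.Perm (y.map Neg.neg) →
    hlFun x.length (nshl true x * nshl true y) = 0 := by
  induction x using list_swap_induction with
  | hs x hx =>
    intro y hl hs hp
    have h := hlFun_nshl_mul_nshl_neg (x := y) (y := x.map Neg.neg) (by simpa using hl)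
    rw [rowMono_zip (by simpa using hl) (by rw [sum_map_neg]; omega), if_neg, List.map_map,
      show (Neg.neg ∘ Neg.neg : ℤ → ℤ) = id by funext z; simp, List.map_id, hl] at h
    · rw [nshl_of_pairwise true hx, ← nshl_of_pairwise false hx, mul_comm, h]
    · rintro rfl
      refine hp ?_
      rw [List.map_map, show (Neg.neg ∘ Neg.neg : ℤ → ℤ) = id by funext z; simp, List.map_id]
  | hQ l c e s hec ih =>
    intro y hl hs hp
    have hperm : (l ++ c :: e :: s).Perm (l ++ e :: c :: s) :=
      (List.Perm.swap e c s).append_left l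
    rw [← hperm.length_eq] at hl ⊢
    rw [← hperm.sum_eq] at hs
    have hp' : ∀ y' : List ℤ, y'.Perm y → ¬ (l ++ c :: e :: s).Perm (y'.map Neg.neg) :=
      fun y' hy h => hp (hperm.symm.trans (h.trans (hy.map _)))
    rw [← nshl_swap_of_lt true hec, hlFun_hecke_mul (by simp)]
    obtain ⟨p, u, v, r, rfl, hpl⟩ : ∃ p u v r, y = p ++ u :: v :: r ∧ p.length = l.length := by
      have h1 : l.length + 1 < y.length := by rw [hl]; simp
      refine ⟨y.take l.length, y[l.length], y[l.length + 1], y.drop (l.length + 2), ?_, ?_⟩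
      · rw [List.getElem_cons_drop, List.getElem_cons_drop, List.take_append_drop]
      · simp; omega
    have hyp : (p ++ v :: u :: r).Perm (p ++ u :: v :: r) :=
      (List.Perm.swap u v r).append_left p
    have i1 := ih _ hl hs (hp' _ (List.Perm.refl _))
    have i2 := ih _ (hyp.length_eq.trans hl) (by rw [hyp.sum_eq, hs]) (hp' _ hyp)
    rw [← hpl]
    rcases lt_trichotomy u v with huv | rfl | huv
    · have h1 := nshl_swap_of_lt true huv p r
      rw [← h1, hecke_true _ (hecke true _ _), hecke_false_true, h1, mul_add, hlFun_add, sub_mul,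
        one_mul, mul_sub, hlFun_sub, mul_left_comm, hlFun_X_mul, mul_left_comm, hlFun_X_mul, i1, i2]
      simp
    · rw [nshl_repeat, heckeEig, cond_true, mul_left_comm, hlFun_X_mul, i1, mul_zero]
    · rw [nshl_swap_of_lt true huv, i2]

lemma matPos_gram_matNeg_true (a c : CompIdx n d) (h : ¬ (toList a.1).Perm (toList c.1)) :
    (matPos n d true * gram n d * (matNeg n d true).transpose) a c = 0 := by
  rw [← hlFun_nsPos_mul_nsNeg, nsPos, nsNeg]
  have := hlFun_nshl_true_mul_nshl_true_eq_zero (toList a.1) ((toList c.1).map Neg.neg) (by simp)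
    (by rw [sum_map_neg, sum_toList a.2, sum_toList c.2]; ring) (by
      rwa [List.map_map, show (Neg.neg ∘ Neg.neg : ℤ → ℤ) = id by funext z; simp, List.map_id])
  rwa [length_toList] at this

lemma sum_nsPos_mul_nsNeg (b b' : Bool) (ω : CompIdx n d → PowerSeries ℤ) :
    ∑ a : CompIdx n d, incl (ω a) * (nsPos b a.1 * shiftVar n (nsNeg b' a.1)) =
      ∑ μ : CompIdx n d, ∑ ν : CompIdx n d,
        incl (((matPos n d b).transpose * Matrix.diagonal ω * matNeg n d b') μ ν) *
          mono (expo μ.1 - shiftExpo n (expo ν.1)) := by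
  have h1 : ∀ a : CompIdx n d, incl (ω a) * (nsPos b a.1 * shiftVar n (nsNeg b' a.1)) =
      ∑ μ : CompIdx n d, ∑ ν : CompIdx n d, incl (matPos n d b a μ * ω a * matNeg n d b' a ν) *
        mono (expo μ.1 - shiftExpo n (expo ν.1)) := by
    intro a
    rw [nsPos_eq, nsNeg_eq, map_sum, Finset.sum_mul_sum, Finset.mul_sum]
    refine Finset.sum_congr rfl fun μ _ => ?_
    rw [Finset.mul_sum]
    refine Finset.sum_congr rfl fun ν _ => ?_
    rw [map_mul (shiftVar n), shiftVar, reindex_incl, reindex_mono, sub_eq_add_neg, mono_add,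
      map_neg, map_mul, map_mul]
    ring
  have h2 : ∀ μ ν, ((matPos n d b).transpose * Matrix.diagonal ω * matNeg n d b') μ ν =
      ∑ a, matPos n d b a μ * ω a * matNeg n d b' a ν := by
    intro μ ν
    rw [Matrix.mul_apply]
    simp only [Matrix.mul_diagonal, Matrix.transpose_apply]
  simp only [h1, h2, map_sum, Finset.sum_mul]
  rw [Finset.sum_comm]
  refine Finset.sum_congr rfl fun μ _ => ?_
  rw [Finset.sum_comm]

/-- Square matrices over a commutative ring have two-sided inverses, so the transpose of K and the
product of the transpose of N with M are both the inverse of P. -/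
lemma matrix_cauchy {ι R : Type*} [Fintype ι] [DecidableEq ι] [CommRing R] {M P N K : Matrix ι ι R}
    (h : M * P * N.transpose = 1) (hK : K.transpose * P = 1) : K = M.transpose * N := by
  have h1 := mul_eq_one_comm.1 h
  rw [← mul_assoc] at h1
  have h2 := mul_eq_one_comm.1 h1
  have h3 : K.transpose = N.transpose * M := by
    calc K.transpose = K.transpose * (P * (N.transpose * M)) := by rw [h2, mul_one]
      _ = N.transpose * M := by rw [← mul_assoc, hK, one_mul]
  rw [← Matrix.transpose_transpose K, h3, Matrix.transpose_mul, Matrix.transpose_transpose]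

/-- The matrix U = M P N'^T is the transition matrix: M = U M' and N'^T = N^T U. By `hω` it respects
the level sets of ω, so it commutes with the diagonal matrix and can be moved from one factor to the
other. -/
lemma matrix_transfer {ι R : Type*} [Fintype ι] [DecidableEq ι] [CommRing R]
    {M P N M' N' : Matrix ι ι R} {ω : ι → R} (h : M * P * N.transpose = 1)
    (h' : M' * P * N'.transpose = 1)
    (hω : ∀ a c, ω a ≠ ω c → (M * P * N'.transpose) a c = 0) :
    M.transpose * Matrix.diagonal ω * N = M'.transpose * Matrix.diagonal ω * N' := by
  have h1 := mul_eq_one_comm.1 h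
  have h2 := mul_eq_one_comm.1 h'
  rw [← mul_assoc] at h1 h2
  have h3 := mul_eq_one_comm.1 h2
  have hM : M * P * N'.transpose * M' = M := by
    rw [mul_assoc, mul_assoc, h3, mul_one]
  have hN : N.transpose * (M * P * N'.transpose) = N'.transpose := by
    rw [← mul_assoc, ← mul_assoc, h1, one_mul]
  have hU : Matrix.diagonal ω * (M * P * N'.transpose) =
      M * P * N'.transpose * Matrix.diagonal ω := by
    ext a c
    rw [Matrix.diagonal_mul, Matrix.mul_diagonal]
    by_cases hac : ω a = ω c
    · rw [hac, mul_comm]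
    · rw [hω a c hac, zero_mul, mul_zero]
  have key : N.transpose * Matrix.diagonal ω * M = N'.transpose * Matrix.diagonal ω * M' := by
    calc N.transpose * Matrix.diagonal ω * M
        = N.transpose * (Matrix.diagonal ω * (M * P * N'.transpose)) * M' := by
          conv_lhs => rw [← hM]
          simp only [mul_assoc]
      _ = N.transpose * (M * P * N'.transpose) * Matrix.diagonal ω * M' := by
          rw [hU]; simp only [mul_assoc]
      _ = N'.transpose * Matrix.diagonal ω * M' := by rw [hN]
  have := congrArg Matrix.transpose key
  simpa only [Matrix.transpose_mul, Matrix.transpose_transpose, Matrix.diagonal_transpose,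
    mul_assoc] using this

/-- A weight that is invariant under permutations can be transferred between the two families. -/
lemma sum_nsPos_mul_nsNeg_transfer {ω : CompIdx n d → PowerSeries ℤ}
    (hω : ∀ a c : CompIdx n d, (toList a.1).Perm (toList c.1) → ω a = ω c) :
    ∑ a : CompIdx n d, incl (ω a) * (nsPos true a.1 * shiftVar n (nsNeg false a.1)) =
      ∑ a : CompIdx n d, incl (ω a) * (nsPos false a.1 * shiftVar n (nsNeg true a.1)) := by
  have h := matrix_transfer (ω := ω) (matPos_gram_matNeg (n := n) (d := d) true)
    (matPos_gram_matNeg (n := n) (d := d) false)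
    fun a c hac => matPos_gram_matNeg_true a c fun h => hac (hω a c h)
  simp only [Bool.not_true, Bool.not_false] at h
  rw [sum_nsPos_mul_nsNeg, sum_nsPos_mul_nsNeg, h]

end Cauchy

/-! ### The Cauchy identity -/

/-- The exponents of bidegree `(d, -d)` in `x_i = z_i` and `1 / y_i = z_{n+i}` that are nonnegative
in the `x_i` and nonpositive in the `1 / y_i`. -/
def pairBox (n : ℕ) (d : ℤ) : Set (ℕ → ℤ) :=
  {ν | (∀ i < n, 0 ≤ ν i ∧ ν (n + i) ≤ 0) ∧ (∀ i, n + n ≤ i → ν i = 0) ∧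
    ∑ i ∈ Finset.range n, ν i = d ∧ ∑ i ∈ Finset.range n, ν (n + i) = -d}

lemma pairBox_add {n : ℕ} {d d' : ℤ} {ν μ : ℕ → ℤ} (hν : ν ∈ pairBox n d) (hμ : μ ∈ pairBox n d') :
    ν + μ ∈ pairBox n (d + d') := by
  obtain ⟨h1, h2, h3, h4⟩ := hν
  obtain ⟨k1, k2, k3, k4⟩ := hμ
  refine ⟨fun i hi => ?_, fun i hi => ?_, ?_, ?_⟩
  · have := h1 i hi
    have := k1 i hi
    simp only [Pi.add_apply]
    omega
  · simp [h2 i hi, k2 i hi]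
  · simp only [Pi.add_apply, Finset.sum_add_distrib, h3, k3]
  · simp only [Pi.add_apply, Finset.sum_add_distrib, h4, k4]; ring

lemma zero_mem_pairBox (n : ℕ) : (0 : ℕ → ℤ) ∈ pairBox n 0 := by
  simp [pairBox]

lemma ratioExpo_mem_pairBox {n i j : ℕ} (hi : i < n) (hj : j < n) :
    ratioExpo i (n + j) ∈ pairBox n 1 := by
  refine ⟨fun k hk => ?_, fun k hk => ?_, ?_, ?_⟩
  · simp only [ratioExpo_apply]; split_ifs <;> omega
  · rw [ratioExpo_apply]; split_ifs <;> omega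
  · rw [Finset.sum_eq_single_of_mem i (Finset.mem_range.2 hi)]
    · rw [ratioExpo_apply]; split_ifs <;> omega
    · intro k hk hki
      have := Finset.mem_range.1 hk
      rw [ratioExpo_apply]; split_ifs <;> omega
  · rw [Finset.sum_eq_single_of_mem j (Finset.mem_range.2 hj)]
    · rw [ratioExpo_apply]; split_ifs <;> omega
    · intro k hk hki
      have := Finset.mem_range.1 hk
      rw [ratioExpo_apply]; split_ifs <;> omega

/-- The coefficient of `t^d` has bidegree `(d, -d)`. -/
def Graded (n : ℕ) (f : Ser2) : Prop := ∀ d : ℕ, SuppIn (pairBox n d) (coeff d f)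

lemma Graded.mul {n : ℕ} {f g : Ser2} (hf : Graded n f) (hg : Graded n g) : Graded n (f * g) := by
  intro d
  rw [coeff_mul]
  refine suppIn_sum fun p hp => SuppIn.mul (hf p.1) (hg p.2) fun a ha b hb => ?_
  have := pairBox_add ha hb
  rw [← Finset.HasAntidiagonal.mem_antidiagonal.1 hp]
  exact_mod_cast this

lemma graded_one (n : ℕ) : Graded n 1 := by
  intro d
  rw [coeff_one]
  split_ifs with h
  · rw [h]; exact suppIn_one (zero_mem_pairBox n)
  · exact suppIn_zero _

lemma graded_geo {n i j : ℕ} (hi : i < n) (hj : j < n) : Graded n (geo (mono (ratioExpo i (n + j)))) := by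
  intro d
  rw [geo, coeff_mk, mono_pow]
  refine suppIn_mono ?_
  induction d with
  | zero => rw [zero_smul]; exact zero_mem_pairBox n
  | succ d ih =>
    rw [succ_nsmul]
    exact_mod_cast pairBox_add ih (ratioExpo_mem_pairBox hi hj)

lemma graded_kerFactor {n i j : ℕ} (hi : i < n) (hj : j < n) : Graded n (kerFactor n i j) := by
  refine Graded.mul (fun d => ?_) (graded_geo hi hj)
  rw [map_sub]
  refine SuppIn.sub (graded_one n d) ?_
  cases d with
  | zero => simpa using suppIn_zero _
  | succ d =>
    rw [coeff_succ_X_mul, coeff_C]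
    split_ifs with h
    · rw [h]
      exact SuppIn.X_mul (suppIn_mono (by simpa using ratioExpo_mem_pairBox hi hj))
    · exact suppIn_zero _

lemma graded_prod {ι : Type*} {n : ℕ} {s : Finset ι} {f : ι → Ser2} (h : ∀ i ∈ s, Graded n (f i)) :
    Graded n (∏ i ∈ s, f i) :=
  Finset.prod_induction _ (Graded n) (fun _ _ => Graded.mul) (graded_one n) h

lemma graded_kernel (n : ℕ) : Graded n (kernel n n) := by
  refine graded_prod fun j hj => ?_
  rw [Finset.mem_range] at hj
  refine Graded.mul (graded_geo hj hj) (graded_prod fun i hi => ?_)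
  rw [Finset.mem_range] at hi
  exact graded_kerFactor (by omega) hj

section

variable {n d : ℕ}

/-- The exponents of the monomials in the kernel. -/
def pairExpo (p : CompIdx n d × CompIdx n d) : ℕ → ℤ := expo p.1.1 - shiftExpo n (expo p.2.1)

lemma pairExpo_left (p : CompIdx n d × CompIdx n d) {i : ℕ} (hi : i < n) :
    pairExpo p i = expo p.1.1 i := by
  simp [pairExpo, shiftExpo_apply, not_le.2 hi]

lemma pairExpo_right (p : CompIdx n d × CompIdx n d) (i : ℕ) :
    pairExpo p (n + i) = -expo p.2.1 i := by
  simp [pairExpo, shiftExpo_apply, expo_of_ge p.1.1 (Nat.le_add_right n i)]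

lemma expo_ext {μ ν : CompIdx n d} (h : ∀ i < n, expo μ.1 i = expo ν.1 i) : μ = ν := by
  apply Subtype.val_injective
  apply expo_injective
  funext i
  rcases lt_or_ge i n with hi | hi
  · exact h i hi
  · rw [expo_of_ge _ hi, expo_of_ge _ hi]

lemma pairExpo_injective : Function.Injective (pairExpo (n := n) (d := d)) := by
  intro p p' h
  refine Prod.ext (expo_ext fun i hi => ?_) (expo_ext fun i hi => ?_)
  · rw [← pairExpo_left p hi, h, pairExpo_left p' hi]
  · have := congrFun h (n + i)
    rw [pairExpo_right, pairExpo_right] at this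
    omega

lemma pairBox_subset : pairBox n (d : ℤ) ⊆ Set.range (pairExpo (n := n) (d := d)) := by
  rintro ν ⟨h1, h2, h3, h4⟩
  obtain ⟨μ, hμ⟩ := exists_expo_eq (n := n) (d := d) (ν := fun i => if i < n then ν i else 0)
    (fun i hi => by simpa [hi] using (h1 i hi).1) (fun i hi => by simp [not_lt.2 hi])
    (by rw [← h3]; exact Finset.sum_congr rfl fun i hi => by simp [Finset.mem_range.1 hi])
  obtain ⟨κ, hκ⟩ := exists_expo_eq (n := n) (d := d) (ν := fun i => -ν (n + i))
    (fun i hi => by simpa using (h1 i hi).2) (fun i hi => by simp [h2 (n + i) (by omega)])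
    (by rw [Finset.sum_neg_distrib, h4, neg_neg])
  refine ⟨(μ, κ), funext fun i => ?_⟩
  rcases lt_or_ge i n with hi | hi
  · rw [pairExpo_left _ hi, hμ]; simp [hi]
  · obtain ⟨j, rfl⟩ := Nat.exists_eq_add_of_le hi
    rw [pairExpo_right, hκ]; simp

/-- The exponents in the first `n` variables of total degree zero. -/
def degZero (n : ℕ) : AddSubmonoid (ℕ → ℤ) where
  carrier := {ν | (∀ i, n ≤ i → ν i = 0) ∧ ∑ i ∈ Finset.range n, ν i = 0}
  zero_mem' := by simp
  add_mem' {a b} ha hb := by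
    refine ⟨fun i hi => ?_, ?_⟩
    · rw [Pi.add_apply, ha.1 i hi, hb.1 i hi, add_zero]
    · simp only [Pi.add_apply, Finset.sum_add_distrib, ha.2, hb.2, add_zero]

lemma hlDensity_mem_suppSubring_degZero (n : ℕ) : hlDensity n ∈ suppSubring (degZero n) := by
  refine prod_mem fun k hk => prod_mem fun j hj => hlFactor_mem_suppSubring ?_
  have hk := Finset.mem_range.1 hk
  have hj := Finset.mem_range.1 hj
  refine ⟨fun i hi => ?_, ?_⟩
  · change ratioExpo j k i = 0
    rw [ratioExpo_apply]; split_ifs <;> omega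
  · simp only [Pi.sub_apply, Finset.sum_sub_distrib, Pi.single_apply, Finset.sum_ite_eq',
      Finset.mem_range]
    rw [if_pos (by omega), if_pos hk, sub_self]

/-- In total degree 0 the only exponent without positive entries is 0, so the functional is a
constant term. -/
lemma hlFun_eq_ctSer {f : Ser} (hf : SuppIn (degZero n) f) :
    hlFun n f = ctSer (f * hlDensity n) := by
  have h1 : SuppIn (degZero n) (f * hlDensity n) :=
    SuppIn.mul hf (hlDensity_mem_suppSubring_degZero n) fun a ha b hb => (degZero n).add_mem ha hb
  rw [hlFun, nonposSum, ctSer, ← sub_eq_zero]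
  have h2 : coeffwise (lin nonposInd) (f * hlDensity n) - coeffwise (coefAt 0) (f * hlDensity n) =
      coeffwise (lin nonposInd - coefAt 0) (f * hlDensity n) := by
    ext k; simp
  rw [h2]
  refine coeffwise_eq_zero h1 fun ν hν => ?_
  rw [AddMonoidHom.sub_apply, lin_single, one_smul, coefAt_single, nonposInd]
  have : (∀ i, ν i ≤ 0) ↔ ν = 0 := by
    constructor
    · intro h
      funext i
      rcases lt_or_ge i n with hi | hi
      · have := (Finset.sum_eq_zero_iff_of_nonpos fun i _ => h i).1 hν.2
        exact this i (Finset.mem_range.2 hi)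
      · exact hν.1 i hi
    · rintro rfl
      simp
  by_cases h0 : ν = 0
  · rw [if_pos (this.2 h0), if_pos h0, sub_self]
  · rw [if_neg (mt this.1 h0), if_neg h0, sub_self]

lemma gram_eq (μ ν : CompIdx n d) :
    gram n d μ ν = ctSer (mono (expo μ.1 - expo ν.1) * hlDensity n) := by
  refine hlFun_eq_ctSer (suppIn_mono ⟨fun i hi => ?_, ?_⟩)
  · simp [expo_of_ge _ hi]
  · simp only [Pi.sub_apply, Finset.sum_sub_distrib, sum_expo μ.2, sum_expo ν.2, sub_self]

lemma ctSer_mono_mul_hlDensity_eq_zero {ε : ℕ → ℤ} {i : ℕ} (hi : n ≤ i) (h : ε i ≠ 0) :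
    ctSer (mono ε * hlDensity n) = 0 := by
  refine ctSer_eq_zero (SuppIn.mul (suppIn_mono (S := {ε}) rfl)
    (hlDensity_mem_suppSubring_degZero n) (S'' := {ν | ν i = ε i}) ?_) fun h0 => h h0.symm
  rintro a rfl b hb
  have : b i = 0 := hb.1 i hi
  change a i + b i = a i
  omega

/-- The coefficients of the kernel. -/
noncomputable def kerMat (n d : ℕ) : Matrix (CompIdx n d) (CompIdx n d) (PowerSeries ℤ) :=
  fun μ ν => coeffwise (coefAt (pairExpo (μ, ν))) (coeff d (kernel n n))

lemma coeff_kernel_eq : coeff d (kernel n n) =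
    ∑ μ : CompIdx n d, ∑ ν : CompIdx n d, incl (kerMat n d μ ν) * mono (pairExpo (μ, ν)) := by
  rw [← Fintype.sum_prod_type']
  exact eq_sum_incl_mul_mono pairExpo_injective ((graded_kernel n d).subset pairBox_subset)

/-- This is the coefficient of t^d in `ct2_kernel`, for the exponent dual to (μ, κ). Kernel terms
whose y-part differs from κ have no constant term, since the density involves only the x-variables.
-/
lemma kerMat_transpose_mul_gram : (kerMat n d).transpose * gram n d = 1 := by
  ext1 κ μ
  rw [Matrix.mul_apply, Matrix.one_apply]
  set ε : ℕ → ℤ := -pairExpo (μ, κ) with hε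
  have h1 := ct2_kernel n n le_rfl ε fun i hi => by
    rw [hε, Pi.neg_apply, pairExpo_left _ hi]
    simpa using expo_nonneg μ.1 i
  have hm : Matched n n ε ↔ κ = μ := by
    constructor
    · rintro ⟨m1, -⟩
      refine expo_ext fun i hi => ?_
      have := m1 i hi
      rw [hε, Pi.neg_apply, Pi.neg_apply, pairExpo_left _ hi, pairExpo_right] at this
      dsimp only at this
      omega
    · rintro rfl
      refine ⟨fun i hi => ?_, fun i h2 h3 => ?_⟩
      · rw [hε, Pi.neg_apply, Pi.neg_apply, pairExpo_left _ hi, pairExpo_right]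
      · obtain ⟨j, rfl⟩ := Nat.exists_eq_add_of_le h2
        rw [hε, Pi.neg_apply, pairExpo_right, expo_of_ge _ (by omega)]
        simp
  have h2 := congrArg (coeff d) h1
  have hs : ∑ i ∈ Finset.range n, (-ε i).toNat = d := by
    zify
    rw [← sum_expo μ.2]
    refine Finset.sum_congr rfl fun i hi => ?_
    rw [hε, Pi.neg_apply, pairExpo_left _ (Finset.mem_range.1 hi), neg_neg]
    exact Int.toNat_of_nonneg (expo_nonneg _ _)
  rw [hs] at h2
  simp only [hm] at h2
  have h3 : coeff d (if κ = μ then (X : PowerSeries (PowerSeries ℤ)) ^ d else 0) =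
      if κ = μ then 1 else 0 := by
    split_ifs <;> simp [coeff_X_pow]
  rw [h3, ct2, coeff_coeffwise, coeff_C_mul, coeff_mul_C, coeff_kernel_eq, Finset.sum_mul,
    Finset.mul_sum, map_sum] at h2
  rw [← h2]
  refine Finset.sum_congr rfl fun μ' _ => ?_
  rw [Finset.sum_mul, Finset.mul_sum, map_sum, Finset.sum_eq_single κ]
  · have he : expo μ'.1 - expo μ.1 = pairExpo (μ', κ) + ε := by
      rw [hε, pairExpo, pairExpo]; abel
    rw [Matrix.transpose_apply, gram_eq, ← ctSer_incl_mul, he, mono_add]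
    refine congrArg ctSer ?_
    generalize incl (kerMat n d μ' κ) = c
    ring
  · intro ν _ hν
    rw [mul_assoc, mul_left_comm, ctSer_incl_mul, ← mul_assoc, ← mono_add]
    obtain ⟨i, hi, hne⟩ : ∃ i < n, expo κ.1 i ≠ expo ν.1 i := by
      by_contra hc
      push Not at hc
      exact hν (expo_ext hc).symm
    rw [ctSer_mono_mul_hlDensity_eq_zero (i := n + i) (by omega), mul_zero]
    rw [hε, Pi.add_apply, Pi.neg_apply, pairExpo_right, pairExpo_right]
    dsimp only
    omega
  · intro h
    exact absurd (Finset.mem_univ _) h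

/-- The Cauchy identity for the nonsymmetric Hall–Littlewood polynomials. -/
theorem coeff_kernel : coeff d (kernel n n) =
    ∑ a : CompIdx n d, nsPos true a.1 * shiftVar n (nsNeg false a.1) := by
  have h := matrix_cauchy (matPos_gram_matNeg (n := n) (d := d) true) kerMat_transpose_mul_gram
  have h1 := sum_nsPos_mul_nsNeg (n := n) (d := d) true false fun _ => 1
  simp only [map_one, one_mul] at h1
  rw [h1, coeff_kernel_eq, h]
  have h2 : Matrix.diagonal (fun _ : CompIdx n d => (1 : PowerSeries ℤ)) = 1 := Matrix.diagonal_one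
  rw [h2, mul_one]
  rfl

end

/-! ### Symmetry of the specialised kernel in q and t -/

/-- The exchange of `q` and `t`. -/
noncomputable def swapQT {A : Type*} [CommRing A] :
    PowerSeries (PowerSeries A) →+* PowerSeries (PowerSeries A) where
  toFun f := PowerSeries.mk fun d => PowerSeries.mk fun k => coeff d (coeff k f)
  map_zero' := by ext d k; simp
  map_one' := by
    ext d k
    simp only [coeff_mk, coeff_one]
    split_ifs <;> simp_all [coeff_one]
  map_add' f g := by ext d k; simp
  map_mul' f g := by
    ext d k
    simp only [coeff_mk, coeff_mul, map_sum]
    rw [Finset.sum_comm]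

lemma coeff_coeff_swapQT {A : Type*} [CommRing A] (f : PowerSeries (PowerSeries A)) (d k : ℕ) :
    coeff k (coeff d (swapQT f)) = coeff d (coeff k f) := by
  simp [swapQT]

lemma swapQT_C_C {A : Type*} [CommRing A] (a : A) : swapQT (C (C a)) = C (C a) := by
  ext d k
  rw [coeff_coeff_swapQT, coeff_C, coeff_C]
  by_cases hd : d = 0 <;> by_cases hk : k = 0 <;> simp [hd, hk, coeff_C]

lemma swapQT_X {A : Type*} [CommRing A] : swapQT (X : PowerSeries (PowerSeries A)) = C X := by
  ext d k
  rw [coeff_coeff_swapQT, coeff_C, coeff_X]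
  by_cases hd : d = 0 <;> by_cases hk : k = 1 <;> simp [hd, hk, coeff_X, coeff_one]

lemma swapQT_C_X {A : Type*} [CommRing A] : swapQT (C X : PowerSeries (PowerSeries A)) = X := by
  ext d k
  rw [coeff_coeff_swapQT, coeff_C, coeff_X]
  by_cases hd : d = 1 <;> by_cases hk : k = 0 <;> simp [hd, hk, coeff_X, coeff_one]

lemma swapQT_geo {A : Type*} [CommRing A] (a : A) : swapQT (geo (C a)) = C (geo a) := by
  ext d k
  rw [coeff_coeff_swapQT, geo, coeff_mk, ← map_pow, coeff_C, coeff_C]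
  split_ifs <;> simp [geo]

lemma swapQT_C_geo {A : Type*} [CommRing A] (a : A) : swapQT (C (geo a)) = geo (C a) := by
  ext d k
  rw [coeff_coeff_swapQT, coeff_C, geo, geo, coeff_mk, ← map_pow, coeff_C]
  split_ifs <;> simp

/-- The substitution `x_i ↦ z_i`, `y_i ↦ 1 / z_{i+1}` on exponents. -/
def specExpo (n : ℕ) : (ℕ → ℤ) →+ (ℕ → ℤ) where
  toFun ν k := (if k < n then ν k else 0) + if 1 ≤ k then ν (n + (k - 1)) else 0
  map_zero' := by ext k; simp
  map_add' ν μ := by ext k; simp only [Pi.add_apply]; split_ifs <;> ring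

lemma specExpo_apply (n : ℕ) (ν : ℕ → ℤ) (k : ℕ) : specExpo n ν k =
    (if k < n then ν k else 0) + if 1 ≤ k then ν (n + (k - 1)) else 0 := rfl

/-- The substitution `x_i ↦ z_i`, `y_i ↦ 1 / z_{i+1}`. -/
noncomputable def spec (n : ℕ) : Ser →+* Ser := reindex (specExpo n)

lemma specExpo_ratioExpo {n i j : ℕ} (hi : i < n) :
    specExpo n (ratioExpo i (n + j)) = ratioExpo i (j + 1) := by
  funext k
  simp only [specExpo_apply, ratioExpo_apply]
  split_ifs <;> omega

lemma spec_shiftVar (n : ℕ) (f : Ser) : spec n (shiftVar n f) = shiftVar 1 f := by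
  simp only [spec, shiftVar, reindex_comp]
  congr 2
  ext ν k
  simp only [AddMonoidHom.comp_apply, specExpo_apply, shiftExpo_apply]
  split_ifs <;> first | omega | simp

lemma reindex_eq_self {φ : (ℕ → ℤ) →+ (ℕ → ℤ)} {f : Ser} (h : SuppIn {ν | φ ν = ν} f) :
    reindex φ f = f := by
  ext1 k
  rw [reindex, coeff_map]
  have := lau_hom_eq_zero (((AddMonoidAlgebra.mapDomainRingHom ℤ φ : Lau →+* Lau) : Lau →+ Lau) -
    AddMonoidHom.id Lau) (coeff k f) fun ν hν => by
      have h1 : φ ν = ν := h k ν hν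
      simp [h1]
  exact sub_eq_zero.1 this

lemma spec_nsPos {n d : ℕ} (b : Bool) (a : CompIdx n d) : spec n (nsPos b a.1) = nsPos b a.1 := by
  refine reindex_eq_self ((suppIn_nsPos b a).subset ?_)
  rintro ν ⟨-, h, -⟩
  funext k
  rw [specExpo_apply]
  rw [h (n + (k - 1)) (by omega)]
  split_ifs with h1
  · simp
  · simp
  · simp [h k (by omega)]
  · simp [h k (by omega)]

lemma map_spec_geo {n i j : ℕ} (hi : i < n) :
    PowerSeries.map (spec n) (geo (mono (ratioExpo i (n + j)))) = geo (C (lauRatio i (j + 1))) := by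
  rw [map_geo, spec, reindex_mono, specExpo_ratioExpo hi, C_lauRatio]

lemma map_spec_kerFactor {n i j : ℕ} (hi : i < n) :
    PowerSeries.map (spec n) (kerFactor n i j) =
      (1 - X * (C X * C (C (lauRatio i (j + 1))))) * geo (C (lauRatio i (j + 1))) := by
  rw [kerFactor, map_mul, map_spec_geo hi, map_sub, map_one, map_mul, PowerSeries.map_X,
    PowerSeries.map_C, map_mul, spec, reindex_X, reindex_mono, specExpo_ratioExpo hi, C_lauRatio,
    RingHom.map_mul]

/-- Under the specialisation x_i y_j becomes z_i/z_{j+1}, so the pairs i ≤ j < n of the kernel match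
the pairs i < k ≤ n of the density in n + 1 variables. -/
lemma map_spec_kernel_mul_hlDensity (n : ℕ) :
    PowerSeries.map (spec n) (kernel n n) * C (hlDensity (n + 1)) =
      ∏ j ∈ Finset.range n, ((geo (C (lauRatio j (j + 1))) * C (hlFactor j (j + 1))) *
        ∏ i ∈ Finset.range j, ((1 - X * (C X * C (C (lauRatio i (j + 1))))) *
          (geo (C (lauRatio i (j + 1))) * C (hlFactor i (j + 1))))) := by
  rw [kernel, hlDensity, Finset.prod_range_succ', Finset.prod_range_zero, mul_one, map_prod, map_prod,
    ← Finset.prod_mul_distrib]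
  refine Finset.prod_congr rfl fun j hj => ?_
  have hj := Finset.mem_range.1 hj
  rw [map_mul, map_spec_geo hj, map_prod, map_prod, Finset.prod_range_succ, Finset.prod_mul_distrib,
    Finset.prod_mul_distrib]
  rw [Finset.prod_congr rfl fun i hi => map_spec_kerFactor (n := n) (j := j)
    (show i < n by have := Finset.mem_range.1 hi; omega), Finset.prod_mul_distrib]
  ring

lemma swapQT_geo_mul_hlFactor (i j : ℕ) : swapQT (geo (C (lauRatio i j)) * C (hlFactor i j)) =
    geo (C (lauRatio i j)) * C (hlFactor i j) := by
  have h : (C (hlFactor i j) : Ser2) = (1 - C (C (lauRatio i j))) * C (geo (lauRatio i j)) := by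
    rw [hlFactor, RingHom.map_mul, RingHom.map_sub, RingHom.map_one]
  rw [h, map_mul, map_mul, map_sub, map_one, swapQT_geo, swapQT_C_geo, swapQT_C_C]
  ring

/-- With u = z_i/z_{j+1}, the factor for i = j is (1 - u)/((1 - qu)(1 - tu)), and for i < j it is
further multiplied by 1 - qtu. Each factor is symmetric by itself. -/
lemma swapQT_map_spec_kernel (n : ℕ) :
    swapQT (PowerSeries.map (spec n) (kernel n n) * C (hlDensity (n + 1))) =
      PowerSeries.map (spec n) (kernel n n) * C (hlDensity (n + 1)) := by
  rw [map_spec_kernel_mul_hlDensity, map_prod]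
  refine Finset.prod_congr rfl fun j _ => ?_
  rw [map_mul, swapQT_geo_mul_hlFactor, map_prod]
  congr 1
  refine Finset.prod_congr rfl fun i _ => ?_
  rw [map_mul, swapQT_geo_mul_hlFactor, map_sub, map_one, map_mul, map_mul, swapQT_X, swapQT_C_X,
    swapQT_C_C]
  ring

/-- The symmetry between `q` and `t` of the functional applied to the kernel. -/
theorem coeff_hlFun_kernel_symm (n : ℕ) (ε : ℕ → ℤ) (i j : ℕ) :
    coeff j (hlFun (n + 1) (mono ε * spec n (coeff i (kernel n n)))) =
      coeff i (hlFun (n + 1) (mono ε * spec n (coeff j (kernel n n)))) := by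
  have key : ∀ i j, coeff j (hlFun (n + 1) (mono ε * spec n (coeff i (kernel n n)))) =
      lin nonposInd (coeff j (coeff i (C (mono ε) * (PowerSeries.map (spec n) (kernel n n) *
        C (hlDensity (n + 1)))))) := by
    intro i j
    rw [hlFun, nonposSum, coeff_coeffwise, coeff_C_mul, coeff_mul_C, coeff_map, mul_assoc]
  rw [key, key, ← coeff_coeff_swapQT, map_mul, swapQT_map_spec_kernel, mono, swapQT_C_C]

/-! ### Generating functions of area sequences -/

/-- The rows attached to the sequence of the area coordinates of a path. -/
def dyckRows (m : ℕ) (l : List ℤ) : List (ℤ × ℤ) :=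
  ((0 : ℤ) :: l.map Neg.neg).zip ((l ++ [0]).map (m - ·))

/-- The generating monomial of the area coordinates of a path. -/
noncomputable def dyckMono (m : ℕ) (l : List ℤ) : PowerSeries ℤ := rowMono (dyckRows m l)

lemma neg_nonpos_of_mem {n : ℕ} {a : Fin n → ℕ} {z : ℤ} (hz : z ∈ (toList a).map Neg.neg) :
    z ≤ 0 := by
  obtain ⟨w, hw, rfl⟩ := List.mem_map.1 hz
  have := nonneg_of_mem_toList hw
  omega

lemma nsPos_eq_append (b : Bool) {n : ℕ} (a : Fin n → ℕ) :
    nsPos b a = nshl b (toList a ++ [0]) :=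
  (nshl_append_zero b fun _ => nonneg_of_mem_toList).symm

lemma shiftVar_nsNeg (b : Bool) {n : ℕ} (a : Fin n → ℕ) :
    shiftVar 1 (nsNeg b a) = nshl b (0 :: (toList a).map Neg.neg) :=
  (nshl_cons_zero b fun _ => neg_nonpos_of_mem).symm

lemma hlFun_mono_mul_false_true {n : ℕ} (m : ℕ) (a : Fin n → ℕ) :
    hlFun (n + 1) (mono (constExpo (n + 1) (-m)) * (nsPos false a * shiftVar 1 (nsNeg true a))) =
      dyckMono m (toList a) := by
  have h1 := nshl_map_add false (-m) (toList a ++ [0])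
  have h2 := hlFun_nshl_mul_nshl_neg (x := (0 : ℤ) :: (toList a).map Neg.neg)
    (y := (toList a ++ [0]).map ((m : ℤ) - ·)) (by simp)
  have h3 : ((toList a ++ [0]).map ((m : ℤ) - ·)).map Neg.neg =
      (toList a ++ [0]).map (· + -(m : ℤ)) := by
    rw [List.map_map]
    refine List.map_congr_left fun z _ => ?_
    simp; ring
  simp only [List.length_append, length_toList, List.length_cons, List.length_nil,
    List.length_map, Nat.zero_add] at h1 h2
  rw [dyckMono, dyckRows, ← h2, h3, h1, shiftVar_nsNeg, nsPos_eq_append, ← mul_assoc, mul_comm]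

/-- The case of constant weight of the transfer. The rows of an area sequence have left ends coming
from the y-variables, so there the family `true` must stand in y. -/
lemma coeff_kernel_false_true (n d : ℕ) : coeff d (kernel n n) =
    ∑ a : CompIdx n d, nsPos false a.1 * shiftVar n (nsNeg true a.1) := by
  have := sum_nsPos_mul_nsNeg_transfer (n := n) (d := d) (ω := fun _ => 1) fun _ _ _ => rfl
  simp only [map_one, one_mul] at this
  rw [coeff_kernel, this]

lemma spec_incl (n : ℕ) (c : PowerSeries ℤ) : spec n (incl c) = incl c := reindex_incl _ c

/-- The generating function of all paths. -/
lemma hlFun_kernel (n m d : ℕ) :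
    hlFun (n + 1) (mono (constExpo (n + 1) (-m)) * spec n (coeff d (kernel n n))) =
      ∑ a : CompIdx n d, dyckMono m (toList a.1) := by
  rw [coeff_kernel_false_true, map_sum, Finset.mul_sum, hlFun_sum]
  refine Finset.sum_congr rfl fun a _ => ?_
  rw [map_mul, spec_shiftVar, spec_nsPos, hlFun_mono_mul_false_true]

/-- The weight of the additional row of a maximal path. -/
def firstWeight (m : ℕ) (l : List ℤ) : ℕ := (l.map fun z => ((m : ℤ) - z).toNat).sum + m

/-- A leading 0 puts the row [0, m) in front. It meets a row [u, v) with u ≤ 0 and v ≤ m in max(v,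
0) points, so the new factor depends only on the multiset of entries; this permits a transfer
between the families. -/
lemma dyckMono_cons_zero (m : ℕ) {l : List ℤ} (hl : ∀ z ∈ l, 0 ≤ z) :
    dyckMono m (0 :: l) = X ^ firstWeight m l * dyckMono m l := by
  have h1 : dyckRows m (0 :: l) = (0, (m : ℤ)) :: dyckRows m l := by
    simp [dyckRows]
  have h2 : (∀ r ∈ (0, (m : ℤ)) :: dyckRows m l, r.1 ≤ r.2) ↔ ∀ r ∈ dyckRows m l, r.1 ≤ r.2 := by
    simp
  have h3 : ((dyckRows m l).map (rowPair (0, (m : ℤ)))).sum = firstWeight m l := by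
    have e : ∀ x y : List ℤ, x.length = y.length → (∀ z ∈ x, z ≤ 0) → (∀ z ∈ y, z ≤ m) →
        ((x.zip y).map (rowPair (0, (m : ℤ)))).sum = (y.map Int.toNat).sum := by
      intro x
      induction x with
      | nil => intro y h _ _; rw [List.length_nil, eq_comm, List.length_eq_zero_iff] at h; simp [h]
      | cons u x ih =>
        rintro (_ | ⟨v, y⟩) h hx hy
        · simp at h
        · have i1 := ih y (by simpa using h) (fun z hz => hx z (by simp [hz]))
            fun z hz => hy z (by simp [hz])
          have i2 := hx u (by simp)
          have i3 := hy v (by simp)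
          have i4 : rowPair (0, (m : ℤ)) (u, v) = v.toNat := by
            simp only [rowPair]; split_ifs <;> omega
          simp only [List.zip_cons_cons, List.map_cons, List.sum_cons, i1, i4]
    rw [dyckRows, e]
    · rw [firstWeight, List.map_map, List.map_append, List.sum_append]
      simp [Function.comp_def]
    · simp
    · intro z hz
      rcases List.mem_cons.1 hz with rfl | hz
      · exact le_rfl
      · obtain ⟨w, hw, rfl⟩ := List.mem_map.1 hz
        have := hl w hw
        omega
    · intro z hz
      obtain ⟨w, hw, rfl⟩ := List.mem_map.1 hz
      have : 0 ≤ w := by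
        rcases List.mem_append.1 hw with hw | hw
        · exact hl w hw
        · simp at hw; omega
      omega
  rw [dyckMono, dyckMono, rowMono, rowMono, h1]
  simp only [h2, rowStat, h3]
  split_ifs
  · rw [pow_add]
  · rw [mul_zero]

lemma firstWeight_perm (m : ℕ) {l l' : List ℤ} (h : l.Perm l') :
    firstWeight m l = firstWeight m l' := by
  rw [firstWeight, firstWeight, (h.map _).sum_eq]

/-- For the rows with the families interchanged, appending [0, m) at the end produces the same
factor: a row [u, v) with 0 ≤ u and m ≤ v contributes max(m - u, 0). -/
lemma rowMono_append_last (m : ℕ) {l : List ℤ} (hl : ∀ z ∈ l, 0 ≤ z) :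
    rowMono ((l ++ [0, 0]).zip ((0 :: (l ++ [0])).map (· + (m : ℤ)))) =
      X ^ firstWeight m l * rowMono ((l ++ [0]).zip ((0 :: l).map (· + (m : ℤ)))) := by
  have h1 : (l ++ [0, 0]).zip ((0 :: (l ++ [0])).map (· + (m : ℤ))) =
      (l ++ [0]).zip ((0 :: l).map (· + (m : ℤ))) ++ [(0, (m : ℤ))] := by
    rw [show l ++ [(0 : ℤ), 0] = (l ++ [0]) ++ [0] by simp,
      show (0 :: (l ++ [0])).map (· + (m : ℤ)) = (0 :: l).map (· + (m : ℤ)) ++ [(m : ℤ)] by simp,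
      List.zip_append (by simp)]
    rfl
  set R := (l ++ [0]).zip ((0 :: l).map (· + (m : ℤ))) with hR
  have h2 : (∀ r ∈ R ++ [(0, (m : ℤ))], r.1 ≤ r.2) ↔ ∀ r ∈ R, r.1 ≤ r.2 := by
    simp [or_imp, forall_and]
  have h3 : (R.map fun r => ([(0, (m : ℤ))].map (rowPair r)).sum).sum = firstWeight m l := by
    have e : ∀ x y : List ℤ, x.length = y.length → (∀ z ∈ x, 0 ≤ z) → (∀ z ∈ y, (m : ℤ) ≤ z) →
        ((x.zip y).map fun r => ([(0, (m : ℤ))].map (rowPair r)).sum).sum =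
          (x.map fun z => ((m : ℤ) - z).toNat).sum := by
      intro x
      induction x with
      | nil => intro y _ _ _; simp
      | cons u x ih =>
        rintro (_ | ⟨v, y⟩) h hx hy
        · simp at h
        · have i1 := ih y (by simpa using h) (fun z hz => hx z (by simp [hz]))
            fun z hz => hy z (by simp [hz])
          have i2 := hx u (by simp)
          have i3 := hy v (by simp)
          have i4 : rowPair (u, v) (0, (m : ℤ)) = ((m : ℤ) - u).toNat := by
            simp only [rowPair]; split_ifs <;> omega
          simp only [List.zip_cons_cons, List.map_cons, List.sum_cons, i4, List.map_nil,
            List.sum_nil, add_zero] at i1 ⊢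
          rw [i1]
    rw [hR, e]
    · rw [firstWeight, List.map_append, List.sum_append]
      simp
    · simp
    · intro z hz
      rcases List.mem_append.1 hz with hz | hz
      · exact hl z hz
      · simp at hz; omega
    · intro z hz
      obtain ⟨w, hw, rfl⟩ := List.mem_map.1 hz
      have : 0 ≤ w := by
        rcases List.mem_cons.1 hw with rfl | hw
        · exact le_rfl
        · exact hl w hw
      omega
  rw [h1, rowMono, rowMono]
  simp only [h2, rowStat_append, h3, rowStat, List.map_nil, List.sum_nil, add_zero]
  split_ifs
  · rw [pow_add, mul_comm]
  · rw [mul_zero]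

lemma hlFun_mono_mul_true_false {x y : List ℤ} (m n : ℕ) (hx : x.length = n) (hy : y.length = n) :
    hlFun n (mono (constExpo n (-m)) * (nshl true x * nshl false (y.map Neg.neg))) =
      rowMono (x.zip (y.map (· + (m : ℤ)))) := by
  have h1 := nshl_map_add false (-m) (y.map Neg.neg)
  have h2 := hlFun_nshl_mul_nshl_neg (x := x) (y := y.map (· + (m : ℤ))) (by simp [hx, hy])
  have h3 : (y.map (· + (m : ℤ))).map Neg.neg = (y.map Neg.neg).map (· + -(m : ℤ)) := by
    rw [List.map_map, List.map_map]
    refine List.map_congr_left fun z _ => ?_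
    simp [add_comm]
  rw [← h2, hx, h3, h1, List.length_map, hy, mul_left_comm]

lemma eq_zero_of_suppIn {S S' : Set (ℕ → ℤ)} {f : Ser} (h : SuppIn S f) (h' : SuppIn S' f)
    (hS : ∀ ν ∈ S, ν ∉ S') : f = 0 := by
  ext k ν
  by_contra h0
  exact hS ν (h k ν h0) (h' k ν h0)

lemma suppIn_shiftVar {n p : ℕ} (hp : p < n) (f : Ser) : SuppIn (coordZero p) (shiftVar n f) := by
  intro k ν hν
  rw [shiftVar, reindex, coeff_map, AddMonoidAlgebra.mapDomainRingHom_apply,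
    AddMonoidAlgebra.coeff_mapDomain] at hν
  have : ν ∈ Set.range (shiftExpo n) := by
    by_contra h0
    refine hν ?_
    erw [Finsupp.mapDomain_of_notMem_range _ _ h0]
  obtain ⟨μ, rfl⟩ := this
  change shiftExpo n μ p = 0
  rw [shiftExpo_apply, if_neg (by omega)]

lemma toList_succ {p : ℕ} (a : Fin (p + 1) → ℕ) :
    toList a = toList (fun i : Fin p => a i.castSucc) ++ [(a (Fin.last p) : ℤ)] := by
  rw [toList, List.ofFn_succ', List.concat_eq_append, toList]

/-- The kernel at `x_{n-1} = 0`. -/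
lemma coeff_one_sub_mul_kernel (p d : ℕ) :
    coeff d ((1 - X * C (mono (ratioExpo p (p + 1 + p)))) * kernel (p + 1) (p + 1)) =
      ∑ a : CompIdx (p + 1) d with a.1 (Fin.last p) = 0,
        nsPos true a.1 * shiftVar (p + 1) (nsNeg false a.1) := by
  set u := mono (ratioExpo p (p + 1 + p)) with hu
  set K := kernel (p + 1) (p + 1) with hK
  have h1 : (1 - X * C u) * K =
      kernel (p + 1) p * ∏ i ∈ Finset.range p, kerFactor (p + 1) i p := by
    rw [hK, kernel_succ]
    linear_combination (kernel (p + 1) p * ∏ i ∈ Finset.range p, kerFactor (p + 1) i p) *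
      one_sub_mul_geo u
  have h2 : SuppIn (coordZero p) (coeff d ((1 - X * C u) * K)) := by
    rw [h1]
    refine SuppIn2.mul (S := coordZero p) (S' := coordZero p)
      (suppIn2_kernel fun i j hij hj => ?_) (suppIn2_prod fun i hi => suppIn2_kerFactor ?_)
      (fun a ha b hb => (coordZero p).add_mem ha hb) d
    · rw [mem_coordZero, ratioExpo_apply]; split_ifs <;> omega
    · have := Finset.mem_range.1 hi
      rw [mem_coordZero, ratioExpo_apply]; split_ifs <;> omega
  have h3 : SuppIn (coordZero p) (∑ a : CompIdx (p + 1) d with a.1 (Fin.last p) = 0,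
      nsPos true a.1 * shiftVar (p + 1) (nsNeg false a.1)) := by
    refine suppIn_sum fun a ha => SuppIn.mul (S := coordZero p) (S' := coordZero p) ?_
      (suppIn_shiftVar (Nat.lt_succ_self p) _) fun a ha b hb => (coordZero p).add_mem ha hb
    have h0 : a.1 (Fin.last p) = 0 := (Finset.mem_filter.1 ha).2
    rw [nsPos, toList_succ, h0, Nat.cast_zero, nshl_append_zero _ fun _ => nonneg_of_mem_toList]
    have := suppIn_nshl_expoBox (l := toList fun i : Fin p => a.1 i.castSucc) (lo := 0)
      (hi := (toList fun i : Fin p => a.1 i.castSucc).sum)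
      (fun z hz => ⟨nonneg_of_mem_toList hz,
        List.single_le_sum (fun _ => nonneg_of_mem_toList) z hz⟩) true
    refine this.subset ?_
    rintro ν ⟨-, h, -⟩
    exact h p (by simp)
  have h4 : SuppIn {ν | 1 ≤ ν p} (∑ a : CompIdx (p + 1) d with ¬ a.1 (Fin.last p) = 0,
      nsPos true a.1 * shiftVar (p + 1) (nsNeg false a.1)) := by
    refine suppIn_sum fun a ha => SuppIn.mul (S := {ν | 1 ≤ ν p}) (S' := coordZero p) ?_
      (suppIn_shiftVar (Nat.lt_succ_self p) _) fun a ha b hb => ?_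
    · have h0 : a.1 (Fin.last p) ≠ 0 := (Finset.mem_filter.1 ha).2
      rw [nsPos, toList_succ]
      have := suppIn_nshl_true_last (r := toList fun i : Fin p => a.1 i.castSucc)
        (x := (a.1 (Fin.last p) : ℤ)) (fun _ => nonneg_of_mem_toList) (by omega)
      rwa [length_toList] at this
    · have e1 : 1 ≤ a p := ha
      have e2 : b p = 0 := hb
      change 1 ≤ a p + b p
      omega
  have h5 : SuppIn {ν | 1 ≤ ν p} (coeff d (X * C u * K)) := by
    rw [mul_assoc]
    cases d with
    | zero => simpa using suppIn_zero _
    | succ d =>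
      rw [coeff_succ_X_mul, coeff_C_mul]
      refine SuppIn.mul (suppIn_mono (S := {ratioExpo p (p + 1 + p)}) rfl) (graded_kernel (p + 1) d) ?_
      rintro _ rfl ν ⟨hν, -⟩
      have e1 := (hν p (by omega)).1
      change 1 ≤ ratioExpo p (p + 1 + p) p + ν p
      rw [ratioExpo_apply]; split_ifs <;> omega
  have h6 := coeff_kernel (n := p + 1) (d := d)
  rw [← Finset.sum_filter_add_sum_filter_not _ fun a : CompIdx (p + 1) d => a.1 (Fin.last p) = 0]
    at h6
  rw [← sub_eq_zero]
  -- Both sides have exponent 0 at `p`, while by the Cauchy identity their difference consists of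
  -- terms with exponent at least 1 there.
  refine eq_zero_of_suppIn (h2.sub h3) (S' := {ν | 1 ≤ ν p}) ?_ fun ν h7 h8 => ?_
  · have : coeff d ((1 - X * C u) * K) - ∑ a : CompIdx (p + 1) d with a.1 (Fin.last p) = 0,
        nsPos true a.1 * shiftVar (p + 1) (nsNeg false a.1) =
        ∑ a : CompIdx (p + 1) d with ¬ a.1 (Fin.last p) = 0,
          nsPos true a.1 * shiftVar (p + 1) (nsNeg false a.1) - coeff d (X * C u * K) := by
      rw [sub_mul, one_mul, map_sub, hK, h6]
      ring
    rw [this]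
    exact h4.sub h5
  · have e1 : ν p = 0 := h7
    have e2 : 1 ≤ ν p := h8
    omega

/-- The generating function of the maximal paths. -/
lemma hlFun_one_sub_mul_kernel (p m d : ℕ) :
    hlFun (p + 1 + 1) (mono (constExpo (p + 1 + 1) (-m)) * spec (p + 1)
      (coeff d ((1 - X * C (mono (ratioExpo p (p + 1 + p)))) * kernel (p + 1) (p + 1)))) =
      ∑ a : CompIdx p d, dyckMono m (0 :: toList a.1) := by
  rw [coeff_one_sub_mul_kernel, map_sum, Finset.mul_sum, hlFun_sum]
  have h1 : ∀ a : CompIdx (p + 1) d, hlFun (p + 1 + 1) (mono (constExpo (p + 1 + 1) (-m)) *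
      spec (p + 1) (nsPos true a.1 * shiftVar (p + 1) (nsNeg false a.1))) =
      rowMono ((toList a.1 ++ [0]).zip ((0 :: toList a.1).map (· + (m : ℤ)))) := by
    intro a
    rw [map_mul, spec_shiftVar, spec_nsPos, shiftVar_nsNeg, nsPos_eq_append,
      ← hlFun_mono_mul_true_false m (p + 1 + 1) (by simp) (by simp)]
    simp
  have h2 : ∀ a : CompIdx p d, rowMono ((toList a.1 ++ [0]).zip ((0 :: toList a.1).map
      (· + (m : ℤ)))) = hlFun (p + 1) (mono (constExpo (p + 1) (-m)) *
        (nsPos true a.1 * shiftVar 1 (nsNeg false a.1))) := by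
    intro a
    rw [← hlFun_mono_mul_true_false m (p + 1) (by simp) (by simp), shiftVar_nsNeg, nsPos_eq_append]
    simp
  -- The weight stands for the extra row [0, m). Before the transfer this row closes the rows of the
  -- family `true` in x; after it, the same row opens the rows of an area sequence.
  have h3 := congrArg (fun f => hlFun (p + 1) (mono (constExpo (p + 1) (-m)) * spec p f))
    (sum_nsPos_mul_nsNeg_transfer (n := p) (d := d)
      (ω := fun a => X ^ firstWeight m (toList a.1)) fun a c h => by rw [firstWeight_perm m h])
  simp only [map_sum, Finset.mul_sum, hlFun_sum, map_mul, spec_shiftVar, spec_nsPos, spec_incl,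
    mul_left_comm _ (incl _), hlFun_incl_mul] at h3
  have h4 : ∀ a : CompIdx p d, dyckMono m (0 :: toList a.1) = X ^ firstWeight m (toList a.1) *
      hlFun (p + 1) (mono (constExpo (p + 1) (-m)) *
        (nsPos false a.1 * shiftVar 1 (nsNeg true a.1))) := fun a => by
    rw [dyckMono_cons_zero m fun _ => nonneg_of_mem_toList, hlFun_mono_mul_false_true]
  simp only [h1, h4]
  rw [← h3]
  symm
  have hmem : ∀ a : CompIdx p d,
      (Fin.snoc a.1 0 : Fin (p + 1) → ℕ) ∈ Finset.Nat.antidiagonalTuple (p + 1) d := by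
    intro a
    have := Finset.Nat.mem_antidiagonalTuple.1 a.2
    rw [Finset.Nat.mem_antidiagonalTuple, Fin.sum_univ_castSucc]
    simpa using this
  refine Finset.sum_bij (fun a _ => ⟨Fin.snoc a.1 0, hmem a⟩) (fun a _ => ?_)
    (fun a _ c _ h => ?_) (fun c hc => ?_) (fun a _ => ?_)
  · simp
  · have := congrArg Subtype.val h
    apply Subtype.ext
    funext i
    simpa using congrFun this i.castSucc
  · have h0 : c.1 (Fin.last p) = 0 := (Finset.mem_filter.1 hc).2
    have hc' : (fun i : Fin p => c.1 i.castSucc) ∈ Finset.Nat.antidiagonalTuple p d := by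
      have := Finset.Nat.mem_antidiagonalTuple.1 c.2
      rw [Fin.sum_univ_castSucc, h0, add_zero] at this
      exact Finset.Nat.mem_antidiagonalTuple.2 this
    refine ⟨⟨_, hc'⟩, Finset.mem_univ _, Subtype.ext (funext fun i => ?_)⟩
    refine Fin.lastCases ?_ (fun i => ?_) i
    · simp [h0]
    · simp
  · have h5 : toList (Fin.snoc a.1 0 : Fin (p + 1) → ℕ) = toList a.1 ++ [0] := by
      rw [toList_succ]
      simp
    rw [← h2]
    dsimp only
    rw [h5, ← rowMono_append_last m fun _ => nonneg_of_mem_toList]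
    simp

/-! ### Symmetry of the path counts and passage to generating functions -/

/-- The number of area sequences with given area and given row statistic. -/
noncomputable def pathCount (m p i j : ℕ) : ℤ :=
  coeff j (∑ a : CompIdx (p + 1) i, dyckMono m (toList a.1))

/-- The number of area sequences of maximal paths with given area and given row statistic. -/
noncomputable def maximalCount (m p i j : ℕ) : ℤ :=
  coeff j (∑ a : CompIdx (p + 1) i with a.1 0 = 0, dyckMono m (toList a.1))

lemma toList_cons {p : ℕ} (a : Fin (p + 1) → ℕ) :
    toList a = (a 0 : ℤ) :: toList (fun i : Fin p => a i.succ) := by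
  rw [toList, List.ofFn_succ, toList]

lemma sum_dyckMono_filter (m p i : ℕ) :
    ∑ a : CompIdx (p + 1) i with a.1 0 = 0, dyckMono m (toList a.1) =
      ∑ a : CompIdx p i, dyckMono m (0 :: toList a.1) := by
  symm
  have hmem : ∀ a : CompIdx p i,
      (Fin.cons 0 a.1 : Fin (p + 1) → ℕ) ∈ Finset.Nat.antidiagonalTuple (p + 1) i := by
    intro a
    have := Finset.Nat.mem_antidiagonalTuple.1 a.2
    rw [Finset.Nat.mem_antidiagonalTuple, Fin.sum_univ_succ]
    simpa using this
  refine Finset.sum_bij (fun a _ => ⟨Fin.cons 0 a.1, hmem a⟩) (fun a _ => ?_)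
    (fun a _ c _ h => ?_) (fun c hc => ?_) (fun a _ => ?_)
  · simp
  · have := congrArg Subtype.val h
    apply Subtype.ext
    funext i
    simpa using congrFun this i.succ
  · have h0 : c.1 0 = 0 := (Finset.mem_filter.1 hc).2
    have hc' : (fun i : Fin p => c.1 i.succ) ∈ Finset.Nat.antidiagonalTuple p i := by
      have := Finset.Nat.mem_antidiagonalTuple.1 c.2
      rw [Fin.sum_univ_succ, h0, zero_add] at this
      exact Finset.Nat.mem_antidiagonalTuple.2 this
    refine ⟨⟨_, hc'⟩, Finset.mem_univ _, Subtype.ext (funext fun i => ?_)⟩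
    refine Fin.cases ?_ (fun i => ?_) i
    · simp [h0]
    · simp
  · dsimp only
    rw [toList_cons (Fin.cons 0 a.1)]
    simp

lemma pathCount_symm (m p i j : ℕ) : pathCount m p i j = pathCount m p j i := by
  rw [pathCount, pathCount, ← hlFun_kernel, ← hlFun_kernel]
  exact coeff_hlFun_kernel_symm _ _ _ _

/-- The differences of the numbers of all paths and of maximal paths are symmetric up to a shift. -/
lemma exists_symm_difference (m p : ℕ) : ∃ N : ℕ → ℕ → ℤ, (∀ i j, N i j = N j i) ∧
    (∀ j, pathCount m p 0 j = maximalCount m p 0 j) ∧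
    ∀ i j, pathCount m p (i + 1) j = maximalCount m p (i + 1) j + N i j := by
  set u := ratioExpo p (p + 1 + p) with hu
  -- The witness comes from the term t x_p y_p times the kernel. The monomial only changes the
  -- exponent in `coeff_hlFun_kernel_symm`, and the factor t shifts the area by one.
  refine ⟨fun i j => coeff j (hlFun (p + 1 + 1) (mono (constExpo (p + 1 + 1) (-m) +
    specExpo (p + 1) u) * spec (p + 1) (coeff i (kernel (p + 1) (p + 1))))),
    fun i j => coeff_hlFun_kernel_symm _ _ _ _, fun j => ?_, fun i j => ?_⟩
  · rw [pathCount, maximalCount, sum_dyckMono_filter, ← hlFun_kernel, ← hlFun_one_sub_mul_kernel,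
      sub_mul, one_mul, map_sub, mul_assoc X, coeff_zero_X_mul, sub_zero]
  · rw [pathCount, maximalCount, sum_dyckMono_filter, ← hlFun_kernel, ← hlFun_one_sub_mul_kernel,
      sub_mul, one_mul, map_sub, mul_assoc X, coeff_succ_X_mul, coeff_C_mul, map_sub, mul_sub,
      hlFun_sub, map_sub, map_mul (spec (p + 1))]
    have e : spec (p + 1) (mono (ratioExpo p (p + 1 + p))) = mono (specExpo (p + 1) u) := by
      rw [spec, reindex_mono]
    dsimp only
    rw [e, mono_add, mul_assoc (mono (constExpo _ _)) (mono _), sub_add_cancel]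

/-- The passage from the symmetric differences to the generating functions. -/
lemma sum_symm_difference {K : Type*} [Field K] {q t : K} (h : q - t ≠ 0) {A T N : ℕ → ℕ → ℤ}
    (hA : ∀ i j, A i j = A j i) (hN : ∀ i j, N i j = N j i) (h0 : ∀ j, A 0 j = T 0 j)
    (h1 : ∀ i j, A (i + 1) j = T (i + 1) j + N i j) (D : ℕ) :
    ∑ x ∈ Finset.HasAntidiagonal.antidiagonal D, (A x.1 x.2 : K) * (q ^ x.1 * t ^ x.2) =
      ∑ x ∈ Finset.HasAntidiagonal.antidiagonal D,
        (T x.1 x.2 : K) * ((q ^ (x.2 + 1) * t ^ x.1 - q ^ x.1 * t ^ (x.2 + 1)) / (q - t)) := by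
  have e1 : ∑ x ∈ Finset.HasAntidiagonal.antidiagonal D, (A x.1 x.2 : K) * (q ^ x.1 * t ^ x.2) * q =
      ∑ x ∈ Finset.HasAntidiagonal.antidiagonal D, (A x.1 x.2 : K) * (q ^ (x.2 + 1) * t ^ x.1) := by
    rw [← Finset.Nat.sum_antidiagonal_swap]
    refine Finset.sum_congr rfl fun x _ => ?_
    simp only [Prod.fst_swap, Prod.snd_swap]
    rw [hA]
    ring
  -- The difference A - T is N shifted by one, with no part at i = 0, so the antisymmetrised
  -- monomials cancel by the symmetry of N.
  have e2 : ∑ x ∈ Finset.HasAntidiagonal.antidiagonal D,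
      ((A x.1 x.2 : K) - T x.1 x.2) * (q ^ (x.2 + 1) * t ^ x.1 - q ^ x.1 * t ^ (x.2 + 1)) = 0 := by
    cases D with
    | zero => simp [h0]
    | succ D =>
      rw [Finset.Nat.sum_antidiagonal_succ]
      simp only [h0, h1, sub_self, zero_mul, zero_add, Int.cast_add, add_sub_cancel_left, mul_sub,
        Finset.sum_sub_distrib]
      rw [sub_eq_zero]
      conv_rhs => rw [← Finset.Nat.sum_antidiagonal_swap]
      refine Finset.sum_congr rfl fun x _ => ?_
      simp only [Prod.fst_swap, Prod.snd_swap]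
      rw [hN]
  apply mul_right_cancel₀ h
  rw [mul_sub, Finset.sum_mul, e1, Finset.sum_mul, Finset.sum_mul, ← Finset.sum_sub_distrib,
    ← sub_eq_zero, ← Finset.sum_sub_distrib, ← e2]
  refine Finset.sum_congr rfl fun x _ => ?_
  field_simp
  ring

/-! ### The coefficients as cardinalities of sets of area sequences -/

lemma dyckRows_eq_map_range (m : ℕ) (l : List ℤ) : dyckRows m l =
    (List.range (l.length + 1)).map fun k =>
      (-listExpo (0 :: l) k, m - listExpo (0 :: l) (k + 1)) := by
  refine List.ext_getElem (by simp [dyckRows]) fun k h1 h2 => ?_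
  have hk : k < l.length + 1 := by simpa using h2
  simp only [dyckRows, List.getElem_zip, List.getElem_map, List.getElem_range, listExpo]
  congr 1
  · rcases k with _ | k
    · simp
    · have : k < l.length := by omega
      simp [this]
  · rcases Nat.lt_succ_iff_lt_or_eq.1 hk with h | rfl
    · rw [List.getElem_append_left h]
      simp [h]
    · simp

lemma rowStat_map_range (f : ℕ → ℤ × ℤ) : ∀ n : ℕ, rowStat ((List.range n).map f) =
    ∑ s ∈ Finset.range n, ∑ r ∈ Finset.range s, rowPair (f r) (f s)
  | 0 => rfl
  | n + 1 => by
    rw [List.range_succ, List.map_append, rowStat_append, rowStat_map_range f n,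
      Finset.sum_range_succ]
    simp only [List.map_cons, List.map_nil, rowStat, List.sum_cons, List.sum_nil, add_zero,
      List.map_map]
    congr 1

lemma coeff_rowMono (j : ℕ) (R : List (ℤ × ℤ)) :
    coeff j (rowMono R) = if (∀ r ∈ R, r.1 ≤ r.2) ∧ rowStat R = j then 1 else 0 := by
  rw [rowMono]
  by_cases h : ∀ r ∈ R, r.1 ≤ r.2
  · rw [if_pos h, coeff_X_pow]
    exact if_congr ⟨fun e => ⟨h, e.symm⟩, fun h' => h'.2.symm⟩ rfl rfl
  · rw [if_neg h, if_neg fun h' => h h'.1, map_zero]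

/-- The lists of rows that are not reversed and have a given statistic. -/
def IsDyckSeq (m j : ℕ) (l : List ℤ) : Prop :=
  (∀ r ∈ dyckRows m l, r.1 ≤ r.2) ∧ rowStat (dyckRows m l) = j

instance (m j : ℕ) (l : List ℤ) : Decidable (IsDyckSeq m j l) :=
  inferInstanceAs (Decidable (_ ∧ _))

lemma pathCount_eq (m p i j : ℕ) : pathCount m p i j =
    ((Finset.Nat.antidiagonalTuple (p + 1) i).filter fun a => IsDyckSeq m j (toList a)).card := by
  rw [pathCount, map_sum, Finset.sum_coe_sort (Finset.Nat.antidiagonalTuple (p + 1) i)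
    fun a => coeff j (dyckMono m (toList a)), Finset.card_filter]
  push_cast
  refine Finset.sum_congr rfl fun a _ => ?_
  rw [dyckMono, coeff_rowMono]
  rfl

lemma maximalCount_eq (m p i j : ℕ) : maximalCount m p i j =
    ((Finset.Nat.antidiagonalTuple (p + 1) i).filter fun a =>
      IsDyckSeq m j (toList a) ∧ a 0 = 0).card := by
  rw [maximalCount, map_sum, Finset.sum_filter,
    Finset.sum_coe_sort (Finset.Nat.antidiagonalTuple (p + 1) i)
      fun a => if a 0 = 0 then coeff j (dyckMono m (toList a)) else 0, Finset.card_filter]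
  push_cast
  refine Finset.sum_congr rfl fun a _ => ?_
  rw [dyckMono, coeff_rowMono]
  by_cases h : a 0 = 0
  · simp only [h, if_true, and_true]
    rfl
  · simp [h]

end RationalCatalan

namespace RationalCatalan

/-! ### The degree of a path and the row statistic -/

/-- The part of the row `[A, B)` strictly below `C - 1`. -/
def rowLow (A B C : ℤ) : ℤ := max 0 (min B (C - 1) - A)

/-- The part of the row `[A, B)` from `D` on. -/
def rowHigh (A B D : ℤ) : ℤ := max 0 (B - max A D)

/-- The interaction counts the points of [A, B) lying in [C - 1, D): the overlap with [C, D), and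
one more when C - 1 belongs to the row. The two corrections are the points missed below and above.
-/
lemma rowPair_eq {A B C D : ℤ} (h : A ≤ B) (h' : C ≤ D) :
    (rowPair (A, B) (C, D) : ℤ) = (B - A) - rowLow A B C - rowHigh A B D := by
  simp only [rowPair, rowLow, rowHigh]
  split_ifs <;> push_cast <;> omega

lemma sum_range_mul_sub (f : ℕ → ℤ) (l : ℕ) :
    ∑ k ∈ Finset.range (l + 1), f k * ((l : ℤ) - k) =
      ∑ s ∈ Finset.range (l + 1), ∑ r ∈ Finset.range s, f r := by
  induction l with
  | zero => simp
  | succ l ih =>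
    rw [Finset.sum_range_succ _ (l + 1), Finset.sum_range_succ _ (l + 1), ← ih,
      ← Finset.sum_add_distrib, sub_self, mul_zero, add_zero]
    refine Finset.sum_congr rfl fun k _ => ?_
    push_cast
    ring

/-- The two summands are indexed by pairs of rows shifted against each other. The hypotheses supply
the boundary pairs left out: those with first row 0 for `F` and those with second row `l` for `G`.
-/
lemma sum_Ico_Ico_eq_sum_range {l : ℕ} {F G : ℕ → ℕ → ℤ} (hF : ∀ s, F 0 s = 0)
    (hG : ∀ r, G r (l + 1) = 0) :
    ∑ i ∈ Finset.Ico 1 l, ∑ j ∈ Finset.Ico i l, (G (i - 1) (j + 1) + F i (j + 1)) =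
      ∑ s ∈ Finset.range (l + 1), ∑ r ∈ Finset.range s, (F r s + G r (s + 1)) := by
  rw [Finset.sum_Ico_Ico_comm]
  simp only [Finset.sum_add_distrib]
  rw [add_comm, Finset.sum_range_succ' (fun s => ∑ r ∈ Finset.range s, F r s),
    Finset.sum_range_succ (fun s => ∑ r ∈ Finset.range s, G r (s + 1)),
    Finset.sum_eq_zero (s := Finset.range l) (fun r _ => hG r), Finset.range_zero,
    Finset.sum_empty, add_zero, add_zero]
  have key : ∀ H : ℕ → ℕ → ℤ, ∑ j ∈ Finset.Ico 1 l, ∑ i ∈ Finset.Ico 1 (j + 1), H i j =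
      ∑ j ∈ Finset.range l, ∑ i ∈ Finset.range j, H (i + 1) j := by
    intro H
    simp only [Finset.sum_Ico_eq_sum_range _ 1, Nat.add_sub_cancel]
    rcases l with _ | l
    · simp
    · rw [Finset.sum_range_succ']
      simp [add_comm 1]
  rw [key fun i j => F i (j + 1), key fun i j => G (i - 1) (j + 1)]
  congr 1
  refine Finset.sum_congr rfl fun s _ => ?_
  rw [Finset.sum_range_succ', hF, add_zero]

section AreaSeq

/-- `c` is the area sequence of the path `x`. -/
structure IsAreaSeq {ℓ : ℕ} (m : ℕ) (x : Fin (ℓ + 1) → ℕ) (c : ℕ → ℤ) : Prop where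
  zero : c 0 = 0
  last : c (ℓ + 1) = 0
  nonneg : ∀ k, 0 ≤ c k
  coord_eq : ∀ k < ℓ, (coord x k : ℤ) = m + c k - c (k + 1)

variable {ℓ m n : ℕ} {x : Fin (ℓ + 1) → ℕ} {c : ℕ → ℤ}

lemma IsAreaSeq.sum_range (h : IsAreaSeq m x c) {k : ℕ} (hk : k ≤ ℓ) :
    ∑ r ∈ Finset.range k, (coord x r : ℤ) = m * k - c k := by
  induction k with
  | zero => simp [h.zero]
  | succ k ih =>
    rw [Finset.sum_range_succ, ih (by omega), h.coord_eq k (by omega)]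
    push_cast
    ring

lemma IsAreaSeq.sum_Icc (h : IsAreaSeq m x c) {i j : ℕ} (hij : i ≤ j) (hj : j < ℓ) :
    ∑ r ∈ Finset.Icc i j, (coord x r : ℤ) = m * (j - i + 1) + c i - c (j + 1) := by
  have e : Finset.Icc i j = Finset.Ico i (j + 1) := by
    ext
    simp
  rw [e, Finset.sum_Ico_eq_sub _ (by omega : i ≤ j + 1), h.sum_range (by omega),
    h.sum_range (by omega)]
  push_cast
  ring

lemma slope_eq (hn : n = (ℓ + 1) * m + 1) : (n : ℚ) / ((ℓ : ℚ) + 1) = m + 1 / ((ℓ : ℚ) + 1) := by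
  have : (ℓ : ℚ) + 1 ≠ 0 := by positivity
  rw [hn]
  push_cast
  field_simp

lemma maxArea_eq (hn : n = (ℓ + 1) * m + 1) :
    maxArea ℓ n = ∑ i ∈ Finset.range ℓ, (m : ℤ) * (i + 1) := by
  refine Finset.sum_congr rfl fun i hi => ?_
  have hi : i < ℓ := Finset.mem_range.1 hi
  have h0 : (0 : ℚ) < (ℓ : ℚ) + 1 := by positivity
  have h1 : (i : ℚ) + 1 < ℓ + 1 := by exact_mod_cast Nat.succ_lt_succ hi
  rw [slope_eq hn, Int.floor_eq_iff]
  push_cast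
  have e : (m + 1 / ((ℓ : ℚ) + 1)) * ((i : ℚ) + 1) = m * (i + 1) + ((i : ℚ) + 1) / (ℓ + 1) := by
    field_simp
  rw [e]
  have h2 : ((i : ℚ) + 1) / (ℓ + 1) < 1 := (div_lt_one h0).2 h1
  have h3 : 0 ≤ ((i : ℚ) + 1) / (ℓ + 1) := by positivity
  constructor <;> linarith

lemma maxArea_sub_area (n : ℕ) (x : Fin (ℓ + 1) → ℕ) :
    maxArea ℓ n - area n x = ∑ s ∈ Finset.range (ℓ + 1), ∑ r ∈ Finset.range s, (coord x r : ℤ) := by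
  rw [area, sub_sub_cancel, sum_range_mul_sub]

lemma IsAreaSeq.area_eq (h : IsAreaSeq m x c) (hn : n = (ℓ + 1) * m + 1) :
    area n x = ∑ i ∈ Finset.range ℓ, c (i + 1) := by
  rw [area, sum_range_mul_sub, maxArea_eq hn, Finset.sum_range_succ', Finset.range_zero,
    Finset.sum_empty, add_zero, ← Finset.sum_sub_distrib]
  refine Finset.sum_congr rfl fun i hi => ?_
  rw [h.sum_range (Finset.mem_range.1 hi)]
  push_cast
  ring

/-- Here β_{ij} is c_i - c_{j+1} minus a fraction strictly between 0 and 1. For β < 0 the floor is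
c_{j+1} - c_i and only the points of row i - 1 missed above survive. For β > 0 it is c_i - c_{j+1} -
1, which explains the bound C - 1 in `rowLow`, and only those of row i missed below survive. -/
lemma IsAreaSeq.gamma_eq (h : IsAreaSeq m x c) (hn : n = (ℓ + 1) * m + 1) {i j : ℕ} (hi : 1 ≤ i)
    (hij : i ≤ j) (hj : j < ℓ) :
    gamma n x i j = rowHigh (-c (i - 1)) (m - c (i - 1 + 1)) (m - c (j + 1)) +
      rowLow (-c i) (m - c (i + 1)) (-c (j + 1)) := by
  have h0 : (0 : ℚ) < (ℓ : ℚ) + 1 := by positivity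
  set e : ℚ := ((j : ℚ) - i + 1) / (ℓ + 1) with he
  have hij' : (i : ℚ) ≤ j := by exact_mod_cast hij
  have hj' : (j : ℚ) < ℓ := by exact_mod_cast hj
  have hi' : (0 : ℚ) ≤ i := by positivity
  have e0 : 0 < e := div_pos (by linarith) h0
  have e1 : e < 1 := (div_lt_one h0).2 (by linarith)
  have hb : beta n x i j = ((c i - c (j + 1) : ℤ) : ℚ) - e := by
    have := congrArg (Int.cast : ℤ → ℚ) (h.sum_Icc hij hj)
    push_cast at this
    rw [beta, this, slope_eq hn, he]
    push_cast
    field_simp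
    ring
  have hx := h.coord_eq i (by omega)
  have hx' := h.coord_eq (i - 1) (by omega)
  have hp := Int.natCast_nonneg (coord x i)
  have hp' := Int.natCast_nonneg (coord x (i - 1))
  have hi1 : i - 1 + 1 = i := by omega
  rw [hi1] at hx' ⊢
  rw [gamma, hb]
  by_cases hc : c i ≤ c (j + 1)
  · have hc' : ((c i - c (j + 1) : ℤ) : ℚ) ≤ 0 := by exact_mod_cast sub_nonpos.2 hc
    have hneg : ((c i - c (j + 1) : ℤ) : ℚ) - e < 0 := by linarith
    have hfl : ⌊|((c i - c (j + 1) : ℤ) : ℚ) - e|⌋ = c (j + 1) - c i := by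
      rw [abs_of_neg hneg, Int.floor_eq_iff]
      push_cast
      constructor <;> linarith
    rw [if_pos hneg, hfl, rowHigh, rowLow, hx']
    omega
  · have hc' : (1 : ℚ) ≤ ((c i - c (j + 1) : ℤ) : ℚ) := by
      exact_mod_cast (by omega : 1 ≤ c i - c (j + 1))
    have hpos : 0 < ((c i - c (j + 1) : ℤ) : ℚ) - e := by linarith
    have hfl : ⌊|((c i - c (j + 1) : ℤ) : ℚ) - e|⌋ = c i - c (j + 1) - 1 := by
      rw [abs_of_pos hpos, Int.floor_eq_iff]
      push_cast
      constructor <;> linarith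
    rw [if_neg hpos.le.not_gt, if_pos hpos, hfl, rowHigh, rowLow, hx]
    omega

lemma IsAreaSeq.row_le (h : IsAreaSeq m x c) {k : ℕ} (hk : k < ℓ + 1) : -c k ≤ m - c (k + 1) := by
  rcases Nat.lt_succ_iff_lt_or_eq.1 hk with hk | rfl
  · have := h.coord_eq k hk
    omega
  · have := h.nonneg k
    rw [h.last]
    omega

/-- M - area is the sum of the lengths x_r over all pairs of rows r < s, and `rowPair_eq` splits
each length into points met by row s, giving `rowStat`, and points missed, giving degr. Row 0 starts
at 0 and the last row ends at m, so the boundary pairs miss nothing. -/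
lemma IsAreaSeq.degr_add_rowStat (h : IsAreaSeq m x c) (hn : n = (ℓ + 1) * m + 1) :
    degr n x + rowStat ((List.range (ℓ + 1)).map fun k => (-c k, (m : ℤ) - c (k + 1))) =
      maxArea ℓ n - area n x := by
  have e1 : degr n x = ∑ s ∈ Finset.range (ℓ + 1), ∑ r ∈ Finset.range s,
      (rowLow (-c r) (m - c (r + 1)) (-c s) + rowHigh (-c r) (m - c (r + 1)) (m - c (s + 1))) := by
    rw [degr, ← sum_Ico_Ico_eq_sum_range (F := fun r s => rowLow (-c r) (m - c (r + 1)) (-c s))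
      (G := fun r t => rowHigh (-c r) (m - c (r + 1)) (m - c t))]
    · refine Finset.sum_congr rfl fun i hi => Finset.sum_congr rfl fun j hj => ?_
      rw [Finset.mem_Ico] at hi hj
      exact h.gamma_eq hn hi.1 hj.1 hj.2
    · intro s
      have := h.nonneg s
      simp only [rowLow, h.zero]
      omega
    · intro r
      have := h.nonneg (r + 1)
      simp only [rowHigh, h.last]
      omega
  rw [maxArea_sub_area, e1, rowStat_map_range]
  push_cast
  rw [← Finset.sum_add_distrib]
  refine Finset.sum_congr rfl fun s hs => ?_
  rw [← Finset.sum_add_distrib]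
  refine Finset.sum_congr rfl fun r hr => ?_
  rw [Finset.mem_range] at hs hr
  rw [rowPair_eq (h.row_le (by omega)) (h.row_le hs), h.coord_eq r (by omega)]
  ring

/-- The gaps in the minimum are c_{i+1} + (i + 1)/(ℓ + 1) with c nonnegative, so the value 1/(ℓ + 1)
can be reached only at i = 0. -/
lemma IsAreaSeq.under_eq_iff (h : IsAreaSeq m x c) (hn : n = (ℓ + 1) * m + 1) (hℓ : 1 ≤ ℓ) :
    under n x = ((1 / ((ℓ : ℚ) + 1) : ℚ) : WithTop ℚ) ↔ c 1 = 0 := by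
  have h0 : (0 : ℚ) < (ℓ : ℚ) + 1 := by positivity
  have e : under n x = (Finset.range ℓ).inf fun i =>
      (((c (i + 1) : ℚ) + ((i : ℚ) + 1) / (ℓ + 1) : ℚ) : WithTop ℚ) := by
    refine Finset.inf_congr rfl fun i hi => ?_
    have := congrArg (Int.cast : ℤ → ℚ) (h.sum_range (Finset.mem_range.1 hi))
    push_cast at this
    rw [this, slope_eq hn]
    norm_cast
    push_cast
    field_simp
    ring
  rw [e]
  constructor
  · intro hu
    have hne : (Finset.range ℓ).Nonempty := ⟨0, Finset.mem_range.2 hℓ⟩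
    obtain ⟨i, hi, hi'⟩ := Finset.exists_mem_eq_inf (Finset.range ℓ) hne fun i =>
      (((c (i + 1) : ℚ) + ((i : ℚ) + 1) / (ℓ + 1) : ℚ) : WithTop ℚ)
    rw [hu] at hi'
    have hi'' : 1 / ((ℓ : ℚ) + 1) = (c (i + 1) : ℚ) + ((i : ℚ) + 1) / (ℓ + 1) := by
      exact_mod_cast hi'
    have hc : (0 : ℚ) ≤ c (i + 1) := by exact_mod_cast h.nonneg _
    have hi0 : i = 0 := by
      by_contra hne
      have : (1 : ℚ) ≤ i := by exact_mod_cast Nat.one_le_iff_ne_zero.2 hne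
      have : 1 / ((ℓ : ℚ) + 1) < ((i : ℚ) + 1) / (ℓ + 1) :=
        div_lt_div_of_pos_right (by linarith) h0
      linarith
    subst hi0
    have : (c (0 + 1) : ℚ) = 0 := by
      simp only [Nat.cast_zero, zero_add] at hi''
      simpa using hi''
    exact_mod_cast this
  · intro hc
    apply le_antisymm
    · refine (Finset.inf_le (Finset.mem_range.2 hℓ)).trans (le_of_eq ?_)
      simp [hc]
    · refine Finset.le_inf fun i _ => ?_
      have hc' : (0 : ℚ) ≤ c (i + 1) := by exact_mod_cast h.nonneg _
      have : 1 / ((ℓ : ℚ) + 1) ≤ ((i : ℚ) + 1) / (ℓ + 1) :=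
        div_le_div_of_nonneg_right (by linarith [(Nat.cast_nonneg i : (0 : ℚ) ≤ i)]) h0.le
      exact_mod_cast (by linarith : 1 / ((ℓ : ℚ) + 1) ≤ (c (i + 1) : ℚ) + ((i : ℚ) + 1) / (ℓ + 1))

end AreaSeq

end RationalCatalan

namespace RationalCatalan

/-! ### The bijection between paths and area sequences -/

variable {ℓ m n : ℕ}

/-- The area coordinates of a path. -/
def areaTuple (m : ℕ) (x : Fin (ℓ + 1) → ℕ) : Fin ℓ → ℕ :=
  fun i => m * (i + 1) - ∑ r ∈ Finset.range (i + 1), coord x r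

/-- The path with given area coordinates. -/
def pathOfArea (m : ℕ) (a : Fin ℓ → ℕ) : Fin (ℓ + 1) → ℕ := fun k =>
  -- As n exceeds (ℓ + 1) m by one, the last coordinate receives the surplus.
  (m + listExpo (0 :: toList a) k - listExpo (0 :: toList a) (k + 1)
    + if (k : ℕ) = ℓ then 1 else 0 : ℤ).toNat

lemma listExpo_cons_toList {a : Fin ℓ → ℕ} {k : ℕ} (hk : k < ℓ) :
    listExpo (0 :: toList a) (k + 1) = a ⟨k, hk⟩ := by
  simp [listExpo, toList, hk]

lemma listExpo_cons_toList_of_le {a : Fin ℓ → ℕ} {k : ℕ} (hk : ℓ ≤ k) :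
    listExpo (0 :: toList a) (k + 1) = 0 := by
  simp [listExpo, toList, hk]

lemma listExpo_cons_toList_nonneg (a : Fin ℓ → ℕ) (k : ℕ) : 0 ≤ listExpo (0 :: toList a) k := by
  rcases k with _ | k
  · simp [listExpo]
  · by_cases hk : k < ℓ
    · rw [listExpo_cons_toList hk]
      exact Int.natCast_nonneg _
    · rw [listExpo_cons_toList_of_le (not_lt.1 hk)]

/-- The slope bound is m (i + 1) plus a fraction strictly between 0 and 1, so the strict rational
inequality is a weak inequality of integers. -/
lemma mem_paths_iff (hn : n = (ℓ + 1) * m + 1) {x : Fin (ℓ + 1) → ℕ} : x ∈ paths ℓ n ↔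
    ∑ k ∈ Finset.range (ℓ + 1), coord x k = n ∧
      ∀ i < ℓ, ∑ k ∈ Finset.range (i + 1), coord x k ≤ m * (i + 1) := by
  rw [paths, Finset.mem_filter, Finset.Nat.mem_antidiagonalTuple, Finset.sum_range]
  have e : ∑ i : Fin (ℓ + 1), coord x i = ∑ i, x i :=
    Finset.sum_congr rfl fun i _ => by simp [coord, i.2]
  rw [e]
  refine and_congr_right fun _ => forall_congr' fun i => ?_
  rw [Finset.mem_range]
  refine forall_congr' fun hi => ?_
  have h0 : (0 : ℚ) < (ℓ : ℚ) + 1 := by positivity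
  have h1 : (n : ℚ) * ((i : ℚ) + 1) / ((ℓ : ℚ) + 1) =
      ((m * (i + 1) : ℕ) : ℚ) + ((i : ℚ) + 1) / (ℓ + 1) := by
    rw [hn]
    push_cast
    field_simp
  have h2 : ((i : ℚ) + 1) / (ℓ + 1) < 1 :=
    (div_lt_one h0).2 (by exact_mod_cast Nat.succ_lt_succ hi)
  have h3 : 0 < ((i : ℚ) + 1) / (ℓ + 1) := by positivity
  rw [h1, ← Nat.cast_sum]
  constructor
  · intro h
    have : ((∑ k ∈ Finset.range (i + 1), coord x k : ℕ) : ℚ) < ((m * (i + 1) + 1 : ℕ) : ℚ) := by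
      rw [Nat.cast_add, Nat.cast_one]
      linarith
    exact Nat.lt_succ_iff.1 (by exact_mod_cast this)
  · intro h
    have : ((∑ k ∈ Finset.range (i + 1), coord x k : ℕ) : ℚ) ≤ ((m * (i + 1) : ℕ) : ℚ) := by
      exact_mod_cast h
    linarith

lemma isAreaSeq_areaTuple (hn : n = (ℓ + 1) * m + 1) {x : Fin (ℓ + 1) → ℕ} (hx : x ∈ paths ℓ n) :
    IsAreaSeq m x (listExpo (0 :: toList (areaTuple m x))) := by
  have hs := ((mem_paths_iff hn).1 hx).2
  have e : ∀ k ≤ ℓ, listExpo (0 :: toList (areaTuple m x)) k =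
      m * k - ∑ r ∈ Finset.range k, (coord x r : ℤ) := by
    intro k hk
    rcases k with _ | k
    · simp [listExpo]
    · rw [listExpo_cons_toList hk, areaTuple]
      push_cast [Nat.cast_sub (hs k hk)]
      rfl
  refine ⟨by simp [listExpo], listExpo_cons_toList_of_le le_rfl,
    listExpo_cons_toList_nonneg _, fun k hk => ?_⟩
  rw [e k hk.le, e (k + 1) hk, Finset.sum_range_succ]
  push_cast
  ring

lemma isAreaSeq_pathOfArea {a : Fin ℓ → ℕ} (ha : ∀ r ∈ dyckRows m (toList a), r.1 ≤ r.2) :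
    IsAreaSeq m (pathOfArea m a) (listExpo (0 :: toList a)) := by
  refine ⟨by simp [listExpo], listExpo_cons_toList_of_le le_rfl,
    listExpo_cons_toList_nonneg _, fun k hk => ?_⟩
  rw [dyckRows_eq_map_range, length_toList] at ha
  have := ha _ (List.mem_map_of_mem (List.mem_range.2 (hk.trans ℓ.lt_succ_self)))
  simp only at this
  rw [coord, dif_pos (hk.trans ℓ.lt_succ_self), pathOfArea, if_neg hk.ne]
  simp only
  omega

lemma pathOfArea_mem (hn : n = (ℓ + 1) * m + 1) {a : Fin ℓ → ℕ}
    (ha : ∀ r ∈ dyckRows m (toList a), r.1 ≤ r.2) : pathOfArea m a ∈ paths ℓ n := by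
  have h := isAreaSeq_pathOfArea ha
  rw [mem_paths_iff hn]
  refine ⟨?_, fun i hi => ?_⟩
  · have hc : (coord (pathOfArea m a) ℓ : ℤ) = m + listExpo (0 :: toList a) ℓ + 1 := by
      have := h.nonneg ℓ
      rw [coord, dif_pos ℓ.lt_succ_self, pathOfArea, if_pos rfl]
      simp only [h.last]
      omega
    have : ∑ k ∈ Finset.range (ℓ + 1), (coord (pathOfArea m a) k : ℤ) = n := by
      rw [Finset.sum_range_succ, h.sum_range le_rfl, hc, hn]
      push_cast
      ring
    exact_mod_cast this
  · have h1 := h.sum_range hi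
    have h2 := h.nonneg (i + 1)
    have : ∑ k ∈ Finset.range (i + 1), (coord (pathOfArea m a) k : ℤ) ≤ m * (i + 1) := by
      rw [h1]
      push_cast
      linarith
    exact_mod_cast this

lemma areaTuple_eq_of_isAreaSeq {x : Fin (ℓ + 1) → ℕ} {a : Fin ℓ → ℕ}
    (h : IsAreaSeq m x (listExpo (0 :: toList a))) : areaTuple m x = a := by
  funext i
  have h1 := h.sum_range (Nat.succ_le_of_lt i.2)
  rw [Nat.succ_eq_add_one, listExpo_cons_toList i.2] at h1
  have h2 : ((∑ r ∈ Finset.range (i + 1), coord x r : ℕ) : ℤ) = (m * (i + 1) : ℕ) - (a i : ℤ) := by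
    push_cast
    push_cast at h1
    exact h1
  rw [areaTuple]
  omega

lemma areaTuple_injOn (hn : n = (ℓ + 1) * m + 1) :
    Set.InjOn (areaTuple (ℓ := ℓ) m) (paths ℓ n) := by
  intro x hx y hy hxy
  have h1 := isAreaSeq_areaTuple hn hx
  have h2 := isAreaSeq_areaTuple hn hy
  rw [← hxy] at h2
  have hlt : ∀ k < ℓ, coord x k = coord y k := fun k hk => by
    have := (h1.coord_eq k hk).trans (h2.coord_eq k hk).symm
    exact_mod_cast this
  have hl : coord x ℓ = coord y ℓ := by
    have := (((mem_paths_iff hn).1 hx).1).trans (((mem_paths_iff hn).1 hy).1).symm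
    rwa [Finset.sum_range_succ, Finset.sum_range_succ,
      Finset.sum_congr rfl (fun k hk => hlt k (Finset.mem_range.1 hk)), Nat.add_left_cancel_iff]
      at this
  funext k
  have : coord x k = coord y k := by
    rcases Nat.lt_succ_iff_lt_or_eq.1 k.2 with hk | hk
    · exact hlt k hk
    · rw [hk, hl]
  simpa [coord, k.2] using this

lemma sum_listExpo_toList (a : Fin ℓ → ℕ) :
    ∑ i ∈ Finset.range ℓ, listExpo (0 :: toList a) (i + 1) = ((∑ i, a i : ℕ) : ℤ) := by
  rw [Finset.sum_range]
  push_cast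
  exact Finset.sum_congr rfl fun i _ => listExpo_cons_toList i.2

lemma isDyckSeq_areaTuple_iff (hn : n = (ℓ + 1) * m + 1) {x : Fin (ℓ + 1) → ℕ}
    (hx : x ∈ paths ℓ n) {d j : ℕ} (hj : maxArea ℓ n - d - area n x = j) :
    IsDyckSeq m j (toList (areaTuple m x)) ↔ degr n x = d := by
  have h := isAreaSeq_areaTuple hn hx
  have hd := h.degr_add_rowStat hn
  rw [IsDyckSeq, dyckRows_eq_map_range, length_toList]
  constructor
  · intro h'
    rw [h'.2] at hd
    omega
  · intro h'
    refine ⟨fun r hr => ?_, ?_⟩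
    · obtain ⟨k, hk, rfl⟩ := List.mem_map.1 hr
      exact h.row_le (List.mem_range.1 hk)
    · have : ((rowStat ((List.range (ℓ + 1)).map fun k =>
          (-listExpo (0 :: toList (areaTuple m x)) k,
            (m : ℤ) - listExpo (0 :: toList (areaTuple m x)) (k + 1))) : ℕ) : ℤ) = j := by omega
      exact_mod_cast this

lemma area_eq_sum_areaTuple (hn : n = (ℓ + 1) * m + 1) {x : Fin (ℓ + 1) → ℕ}
    (hx : x ∈ paths ℓ n) : area n x = ((∑ i, areaTuple m x i : ℕ) : ℤ) := by
  rw [(isAreaSeq_areaTuple hn hx).area_eq hn, sum_listExpo_toList]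

/-- Paths of given degree and area correspond to area sequences of given statistic. -/
lemma card_paths_filter (hn : n = (ℓ + 1) * m + 1) {d i j : ℕ}
    (hij : ((i + j : ℕ) : ℤ) = maxArea ℓ n - d)
    (P : (Fin (ℓ + 1) → ℕ) → Prop) (Q : (Fin ℓ → ℕ) → Prop) [DecidablePred P] [DecidablePred Q]
    (hPQ : ∀ x ∈ paths ℓ n, P x ↔ Q (areaTuple m x)) :
    ((paths ℓ n).filter fun x => (P x ∧ degr n x = d) ∧ area n x = i).card =
      ((Finset.Nat.antidiagonalTuple ℓ i).filter fun a => IsDyckSeq m j (toList a) ∧ Q a).card := by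
  refine Finset.card_bij (fun x _ => areaTuple m x) (fun x hx => ?_) (fun x hx y hy hxy => ?_)
    (fun a ha => ?_)
  · obtain ⟨hx, ⟨hP, hd⟩, hi⟩ := Finset.mem_filter.1 hx
    refine Finset.mem_filter.2 ⟨?_, (isDyckSeq_areaTuple_iff hn hx (by omega)).2 hd, (hPQ x hx).1 hP⟩
    rw [Finset.Nat.mem_antidiagonalTuple]
    rw [area_eq_sum_areaTuple hn hx] at hi
    exact_mod_cast hi
  · exact areaTuple_injOn hn (Finset.mem_filter.1 hx).1 (Finset.mem_filter.1 hy).1 hxy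
  · obtain ⟨ha, hD, hQ⟩ := Finset.mem_filter.1 ha
    have hmem := pathOfArea_mem hn hD.1
    have hat := areaTuple_eq_of_isAreaSeq (isAreaSeq_pathOfArea hD.1)
    have hi : area n (pathOfArea m a) = i := by
      rw [area_eq_sum_areaTuple hn hmem, hat, Finset.Nat.mem_antidiagonalTuple.1 ha]
    refine ⟨_, Finset.mem_filter.2 ⟨hmem, ⟨(hPQ _ hmem).2 (hat.symm ▸ hQ), ?_⟩, hi⟩, hat⟩
    exact (isDyckSeq_areaTuple_iff hn hmem (by omega)).1 (hat.symm ▸ hD)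

lemma under_eq_iff_areaTuple {p : ℕ} (hn : n = (p + 1 + 1) * m + 1) {x : Fin (p + 1 + 1) → ℕ}
    (hx : x ∈ paths (p + 1) n) :
    under n x = ((1 / (((p + 1 : ℕ) : ℚ) + 1) : ℚ) : WithTop ℚ) ↔ areaTuple m x 0 = 0 := by
  rw [(isAreaSeq_areaTuple hn hx).under_eq_iff hn (by omega),
    listExpo_cons_toList (Nat.succ_pos p)]
  exact Int.natCast_eq_zero

lemma card_pathsOfDegr_filter {p d i j : ℕ} (hn : n = (p + 1 + 1) * m + 1)
    (hij : ((i + j : ℕ) : ℤ) = maxArea (p + 1) n - d) :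
    (((pathsOfDegr (p + 1) n d).filter fun x => area n x = i).card : ℤ) = pathCount m p i j := by
  rw [pathCount_eq, pathsOfDegr, Finset.filter_filter]
  have := card_paths_filter hn hij (fun _ => True) (fun _ => True) fun _ _ => Iff.rfl
  simp only [true_and, and_true] at this
  exact_mod_cast this

lemma card_maximalPathsOfDegr_filter {p d i j : ℕ} (hn : n = (p + 1 + 1) * m + 1)
    (hij : ((i + j : ℕ) : ℤ) = maxArea (p + 1) n - d) :
    (((maximalPathsOfDegr (p + 1) n d).filter fun x => area n x = i).card : ℤ) =
      maximalCount m p i j := by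
  rw [maximalCount_eq, maximalPathsOfDegr, maximalPaths, Finset.filter_filter, Finset.filter_filter]
  simp only [← and_assoc]
  exact congrArg _ (card_paths_filter hn hij _ (fun a => a 0 = 0) fun _ hx =>
    under_eq_iff_areaTuple hn hx)

/-- The area and the row statistic are natural numbers, so the integer exponents in the Catalan
polynomial are nonnegative and the sums run over an antidiagonal. -/
lemma area_bounds (hn : n = (ℓ + 1) * m + 1) {x : Fin (ℓ + 1) → ℕ} (hx : x ∈ paths ℓ n) {d : ℕ}
    (hd : degr n x = d) : ∃ i j : ℕ, area n x = i ∧ maxArea ℓ n - d = ((i + j : ℕ) : ℤ) := by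
  have h := (isAreaSeq_areaTuple hn hx).degr_add_rowStat hn
  rw [area_eq_sum_areaTuple hn hx] at h
  refine ⟨_, rowStat (((List.range (ℓ + 1)).map fun k =>
    (-listExpo (0 :: toList (areaTuple m x)) k,
      (m : ℤ) - listExpo (0 :: toList (areaTuple m x)) (k + 1)))),
    area_eq_sum_areaTuple hn hx, ?_⟩
  rw [Nat.cast_add]
  omega

/-! ### From counts to polynomials, and the conclusion -/

lemma sum_eq_sum_antidiagonal {K : Type*} [Field K] (hn : n = (ℓ + 1) * m + 1) {d D : ℕ}
    (hD : maxArea ℓ n - d = D) {S : Finset (Fin (ℓ + 1) → ℕ)} (hS : S ⊆ pathsOfDegr ℓ n d)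
    {A : ℕ → ℕ → ℤ}
    (hA : ∀ i j, i + j = D → ((S.filter fun x => area n x = i).card : ℤ) = A i j) (F : ℤ → K) :
    ∑ x ∈ S, F (area n x) =
      ∑ y ∈ Finset.HasAntidiagonal.antidiagonal D, (A y.1 y.2 : K) * F y.1 := by
  have hbd : ∀ x ∈ S, ∃ i j : ℕ, area n x = i ∧ i + j = D := by
    intro x hx
    obtain ⟨hx, hd⟩ := Finset.mem_filter.1 (hS hx)
    obtain ⟨i, j, h1, h2⟩ := area_bounds hn hx hd
    exact ⟨i, j, h1, by omega⟩
  have hmap : ∀ x ∈ S, ((area n x).toNat, D - (area n x).toNat) ∈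
      Finset.HasAntidiagonal.antidiagonal D := by
    intro x hx
    obtain ⟨i, j, h1, h2⟩ := hbd x hx
    rw [Finset.HasAntidiagonal.mem_antidiagonal, h1]
    simp only [Int.toNat_natCast]
    omega
  rw [← Finset.sum_fiberwise_of_maps_to hmap]
  refine Finset.sum_congr rfl fun y hy => ?_
  have hy' := Finset.HasAntidiagonal.mem_antidiagonal.1 hy
  have e : (S.filter fun x => ((area n x).toNat, D - (area n x).toNat) = y) =
      S.filter fun x => area n x = y.1 := by
    refine Finset.filter_congr fun x hx => ?_
    obtain ⟨i, j, h1, h2⟩ := hbd x hx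
    rw [h1, Int.toNat_natCast]
    constructor
    · rintro rfl
      rfl
    · intro h
      ext
      · exact_mod_cast h
      · simp only
        omega
  rw [e, Finset.sum_congr rfl (fun x hx => by rw [(Finset.mem_filter.1 hx).2]), Finset.sum_const,
    ← hA _ _ hy', Int.cast_natCast, nsmul_eq_mul]

lemma catalanPart_eq {K : Type*} [Field K] {p d D : ℕ} (hn : n = (p + 1 + 1) * m + 1)
    (hD : maxArea (p + 1) n - d = D) (q t : K) : catalanPart (p + 1) n d q t =
      ∑ y ∈ Finset.HasAntidiagonal.antidiagonal D,
        (pathCount m p y.1 y.2 : K) * (q ^ y.1 * t ^ y.2) := by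
  rw [catalanPart, sum_eq_sum_antidiagonal hn hD subset_rfl
    (fun i j hij => card_pathsOfDegr_filter hn (by rw [hD, hij]))
    fun z => q ^ z * t ^ (maxArea (p + 1) n - (d : ℤ) - z)]
  refine Finset.sum_congr rfl fun y hy => ?_
  have hy' := Finset.HasAntidiagonal.mem_antidiagonal.1 hy
  have e : maxArea (p + 1) n - (d : ℤ) - y.1 = (y.2 : ℕ) := by omega
  rw [e, zpow_natCast, zpow_natCast]

lemma sum_sym_eq {K : Type*} [Field K] {p d D : ℕ} (hn : n = (p + 1 + 1) * m + 1)
    (hD : maxArea (p + 1) n - d = D) (q t : K) :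
    ∑ x ∈ maximalPathsOfDegr (p + 1) n d,
        sym q t (area n x) (maxArea (p + 1) n - (d : ℤ) - area n x) =
      ∑ y ∈ Finset.HasAntidiagonal.antidiagonal D, (maximalCount m p y.1 y.2 : K) *
        ((q ^ (y.2 + 1) * t ^ y.1 - q ^ y.1 * t ^ (y.2 + 1)) / (q - t)) := by
  have hsub : maximalPathsOfDegr (p + 1) n d ⊆ pathsOfDegr (p + 1) n d :=
    Finset.filter_subset_filter _ (Finset.filter_subset _ _)
  rw [sum_eq_sum_antidiagonal hn hD hsub
    (fun i j hij => card_maximalPathsOfDegr_filter hn (by rw [hD, hij]))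
    fun z => sym q t z (maxArea (p + 1) n - (d : ℤ) - z)]
  refine Finset.sum_congr rfl fun y hy => ?_
  have hy' := Finset.HasAntidiagonal.mem_antidiagonal.1 hy
  have e : maxArea (p + 1) n - (d : ℤ) - y.1 = (y.2 : ℕ) := by omega
  rw [e, sym, ← Nat.cast_succ, zpow_natCast, zpow_natCast, zpow_natCast, zpow_natCast]

lemma catalanPart_eq_sum_sym {K : Type*} [Field K] {p d : ℕ} (hn : n = (p + 1 + 1) * m + 1)
    {q t : K} (h : q - t ≠ 0) :
    catalanPart (p + 1) n d q t = ∑ x ∈ maximalPathsOfDegr (p + 1) n d,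
      sym q t (area n x) (maxArea (p + 1) n - (d : ℤ) - area n x) := by
  by_cases h0 : 0 ≤ maxArea (p + 1) n - (d : ℤ)
  · obtain ⟨D, hD⟩ := Int.eq_ofNat_of_zero_le h0
    obtain ⟨N, hN, h1, h2⟩ := exists_symm_difference m p
    rw [catalanPart_eq hn hD, sum_sym_eq hn hD,
      sum_symm_difference h (pathCount_symm m p) hN h1 h2]
  -- If M - d is negative there are no paths of this degree, and both sides are empty sums.
  · have hemp : pathsOfDegr (p + 1) n d = ∅ := by
      refine Finset.eq_empty_of_forall_notMem fun x hx => h0 ?_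
      obtain ⟨hx, hd⟩ := Finset.mem_filter.1 hx
      obtain ⟨i, j, -, h2⟩ := area_bounds hn hx hd
      omega
    have hemp' : maximalPathsOfDegr (p + 1) n d = ∅ :=
      Finset.subset_empty.1 (hemp ▸ Finset.filter_subset_filter _ (Finset.filter_subset _ _))
    rw [catalanPart, hemp, hemp', Finset.sum_empty, Finset.sum_empty]

lemma sym_swap {K : Type*} [Field K] (q t : K) (a b : ℤ) : sym t q a b = sym q t a b := by
  rw [sym, sym, ← neg_sub q t, div_neg, ← neg_div]
  congr 1
  ring

lemma qVar_sub_tVar_ne_zero : qVar - tVar ≠ 0 := by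
  intro h
  have h' := IsFractionRing.injective (MvPolynomial (Fin 2) ℤ) RatQT (sub_eq_zero.1 h)
  exact absurd (MvPolynomial.X_injective h') (by decide)

end RationalCatalan

theorem mainTheorem1 (ℓ m n d : ℕ) (hℓ : 1 ≤ ℓ) (hm : 1 ≤ m) (hn : n = (ℓ + 1) * m + 1)
    (hd : d ≤ 20) :
    RationalCatalan.catalanPart ℓ n d RationalCatalan.qVar RationalCatalan.tVar =
        ∑ x ∈ RationalCatalan.maximalPathsOfDegr ℓ n d,
          RationalCatalan.sym RationalCatalan.qVar RationalCatalan.tVar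
            (RationalCatalan.area n x)
            (RationalCatalan.maxArea ℓ n - (d : ℤ) - RationalCatalan.area n x) ∧
      RationalCatalan.catalanPart ℓ n d RationalCatalan.qVar RationalCatalan.tVar =
        RationalCatalan.catalanPart ℓ n d RationalCatalan.tVar RationalCatalan.qVar := by
  obtain ⟨p, rfl⟩ := Nat.exists_eq_add_of_le' hℓ
  have h := RationalCatalan.qVar_sub_tVar_ne_zero
  refine ⟨RationalCatalan.catalanPart_eq_sum_sym hn h, ?_⟩
  -- The first identity holds for any two distinct elements of a field, so it applies also with q
  -- and t exchanged, and each summand is invariant under this exchange.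
  rw [RationalCatalan.catalanPart_eq_sum_sym hn h,
    RationalCatalan.catalanPart_eq_sum_sym hn (neg_sub RationalCatalan.qVar _ ▸ neg_ne_zero.2 h)]
  exact Finset.sum_congr rfl fun x _ => (RationalCatalan.sym_swap _ _ _ _).symm
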